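/- Let $n\ge 3$, let $M$ be a Riemann surface, and let $\mathbb{R}^{n+1,1}$ be $\mathbb{R}^{n+2}$ with the scalar product $\langle x,y\rangle=-x_0y_0+\sum_{i=1}^{n+1}x_iy_i$, whose projectivized light cone is identified with $S^n$ by $x\leftrightarrow[1:x]$. Let $f,\hat f:M\to S^n$ be smooth immersions with smooth lifts $Y,\hat Y$ into the light cone such that $\langle Y,\hat Y\rangle=-1$, and let $H=Y\wedge\hat Y:M\to G_{1,1}(\mathbb{R}^{n+1,1})\subset\Lambda^2\mathbb{R}^{n+1,1}$ be the induced map into the Grassmannian of 2-dimensional Minkowski subspaces. (Conformality is with respect to the Riemann surface $M$; for $H$ it means $\langle H_z,H_z\rangle=0$, so that the induced metric may be degenerate.) Then the following three conditions are equivalent. (i) $f$ and $\hat f$ are Willmore surfaces and are adjoint transforms of each other; (ii) $f$, $\hat f$ and $H$ are conformal, $\hat f(p)$ lies on the mean curvature sphere of $f$ at $p$, and $f(p)$ lies on the mean curvature sphere of $\hat f$ at $p$, for all $p\in M$; (iii) $f$ and $\hat f$ are conformal, and $H$ is conformal and harmonic. Here the mean curvature sphere of a conformal immersion $f$ at $p$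 is the 2-sphere of the null lines in $V_p=\mathrm{Span}\{F,F_u,F_v,F_{z\bar z}\}$, where $F$ is any local lift of $f$ and $z=u+iv$ a local holomorphic coordinate; it is tangent to $f$ at $f(p)$ and is oriented compatibly with $f$. An immersion is Willmore if it is critical for $W(f)=\frac18\int_M|\mathrm{II}^\circ|^2\,dA$, with $\mathrm{II}^\circ$ the trace-free second fundamental form in $S^n$, under compactly supported variations of the map. The map $\hat f$ is an adjoint transform of the conformal Willmore immersion $f$ if it is conformal, and if for every $p$ it lies on the mean curvature sphere of $f$ at $p$ and co-touches it there: $\langle X_1+iX_2,\hat Y_u-i\hat Y_v\rangle=0$ (complex bilinear extension), where $X_1,X_2\in V_p$ are orthogonal to $\hat Y(p)$ and represent an oriented orthonormal basis of the tangent plane of this oriented sphere at $\hat f(p)$. The map $H$ is harmonic if it is critical for the energy $\int_M(\langle H_u,H_u\rangle+\langle H_v,H_v\rangle)\,du\,dv$ under compactly supported variations through maps into $G_{1,1}(\mathbb{R}^{n+1,1})$. -/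

import Mathlib

open scoped Manifold ContDiff
open MeasureTheory Set

noncomputable section

namespace MoebiusSurface

/-! ### The Minkowski space and its bivectors -/

/-- The vector space underlying the Minkowski space `ℝ^{n+1,1}`, with coordinates
`y_0, y_1, …, y_{n+1}`. -/
abbrev Mink (n : ℕ) := Fin (n + 2) → ℝ

/-- The sign of a coordinate: `-1` for `y_0`, and `1` for the others. -/
def sgn {n : ℕ} (i : Fin (n + 2)) : ℝ := if i = 0 then -1 else 1

/-- The Lorentzian scalar product `⟨x, y⟩ = - x_0 y_0 + ∑_{i ≥ 1} x_i y_i`. -/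
def mink {n : ℕ} (x y : Mink n) : ℝ := ∑ i, sgn i * (x i * y i)

/-- Bivectors are written as arrays of coefficients; the elements of `Λ² ℝ^{n+1,1}` are the
antisymmetric ones. -/
abbrev Bivec (n : ℕ) := Fin (n + 2) → Fin (n + 2) → ℝ

/-- The bivector `x ∧ y`. -/
def wedge {n : ℕ} (x y : Mink n) : Bivec n := fun i j => x i * y j - x j * y i

/-- The induced scalar product of bivectors, for which
`⟨a ∧ b, c ∧ d⟩ = ⟨a, c⟩ ⟨b, d⟩ - ⟨a, d⟩ ⟨b, c⟩`. -/
def binner {n : ℕ} (A B : Bivec n) : ℝ :=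
  (1 / 2) * ∑ i, ∑ j, sgn i * sgn j * (A i j * B i j)

/-! ### The sphere as the projectivized light cone -/

/-- The Euclidean space `ℝ^{n+1}`. -/
abbrev Euc (n : ℕ) := EuclideanSpace ℝ (Fin (n + 1))

/-- The unit sphere `S^n` of `ℝ^{n+1}`. -/
abbrev Sph (n : ℕ) := Metric.sphere (0 : Euc n) 1

/-- The light-like vector `(1, x)` representing the point `x` of `S^n`. -/
def stdLift {n : ℕ} (x : Sph n) : Mink n := Fin.cons 1 fun i => (x : Euc n) i

/-! ### Derivatives in a complex coordinate `z = u + i v` -/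

/-- The coordinate directions `∂_u` and `∂_v` of `ℂ`. -/
def dir : Fin 2 → ℂ := ![1, Complex.I]

/-- The partial derivatives `∂_u F` (index `0`) and `∂_v F` (index `1`). -/
def pd {W : Type*} [NormedAddCommGroup W] [NormedSpace ℝ W] (i : Fin 2) (F : ℂ → W) (z : ℂ) : W :=
  fderiv ℝ F z (dir i)

/-- `F_uu + F_vv`, which is `4 F_{z z̄}`. -/
def lap {W : Type*} [NormedAddCommGroup W] [NormedSpace ℝ W] (F : ℂ → W) (z : ℂ) : W :=
  pd 0 (pd 0 F) z + pd 1 (pd 1 F) z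

section Surface

variable {n : ℕ} {M : Type*} [TopologicalSpace M] [ChartedSpace ℂ M]

/-- The map `f : M → S^n`, regarded as a map into `ℝ^{n+1}`, in the chart `e`. -/
def eucRep (e : OpenPartialHomeomorph M ℂ) (f : M → Sph n) : ℂ → Euc n :=
  fun z => (f (e.symm z) : Euc n)

/-- The lift `(1, f)` of `f : M → S^n` in the chart `e`. -/
def liftRep (e : OpenPartialHomeomorph M ℂ) (f : M → Sph n) : ℂ → Mink n :=
  fun z => stdLift (f (e.symm z))

/-- `f` is a smooth immersion of the real surface `M` into `S^n`. -/
structure IsSmoothImmersion (f : M → Sph n) : Prop where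
  smooth : ContMDiff 𝓘(ℝ, ℂ) 𝓘(ℝ, Euc n) ∞ fun p => (f p : Euc n)
  injective_fderiv : ∀ e ∈ atlas ℂ M, ∀ z ∈ e.target,
    Function.Injective (fderiv ℝ (eucRep e f) z)

/-- `Y` is a smooth map into the light cone such that `Y(p)` spans the null line `f(p)`. -/
structure IsLift (Y : M → Mink n) (f : M → Sph n) : Prop where
  smooth : ContMDiff 𝓘(ℝ, ℂ) 𝓘(ℝ, Mink n) ∞ Y
  spans : ∀ p, ∃ c : ℝ, c ≠ 0 ∧ Y p = c • stdLift (f p)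

/-- `f : M → S^n` is conformal: `⟨f_z, f_z⟩ = 0` in the holomorphic charts of `M`. -/
def IsConformal (f : M → Sph n) : Prop :=
  ∀ e ∈ atlas ℂ M, ∀ z ∈ e.target,
    inner ℝ (pd 0 (eucRep e f) z) (pd 0 (eucRep e f) z)
        = inner ℝ (pd 1 (eucRep e f) z) (pd 1 (eucRep e f) z) ∧
      inner ℝ (pd 0 (eucRep e f) z) (pd 1 (eucRep e f) z) = 0

/-! ### The mean curvature sphere -/

/-- The subspace `V = Span {F, F_u, F_v, F_{z z̄}}` for the lift `F = (1, f)` of the conformal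
immersion `f`, at the point of coordinate `z`. The mean curvature sphere of `f` at that point
is the 2-sphere formed by the null lines in `V`. -/
def meanSphere (e : OpenPartialHomeomorph M ℂ) (f : M → Sph n) (z : ℂ) :
    Submodule ℝ (Mink n) :=
  Submodule.span ℝ
    {liftRep e f z, pd 0 (liftRep e f) z, pd 1 (liftRep e f) z, lap (liftRep e f) z}

/-- Each point `g(p)` lies on the mean curvature sphere of `f` at `p`. -/
def LiesOnMeanSphere (f g : M → Sph n) : Prop :=
  ∀ e ∈ atlas ℂ M, ∀ z ∈ e.target, liftRep e g z ∈ meanSphere e f z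

/-! ### Co-touching and adjoint transforms -/

/-- A frame `(x₁, x₂)` representing a 2-dimensional oriented contact element at the point of
the sphere given by the light-like vector `q`: orthogonal to `q`, and orthonormal up to a common
factor. -/
structure IsContactFrame (q x₁ x₂ : Mink n) : Prop where
  null : mink q q = 0
  ne_zero : q ≠ 0
  orth₁ : mink q x₁ = 0
  orth₂ : mink q x₂ = 0
  length : mink x₁ x₁ = mink x₂ x₂
  pos : 0 < mink x₁ x₁
  orth : mink x₁ x₂ = 0

/-- The contact elements `(q, x₁, x₂)` and `(q', x₁', x₂')` of the 2-sphere given by the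
4-dimensional Minkowski subspace `V` come from the same orientation of this sphere. The
orientation of the sphere corresponds to the one of `V` for which `(q, x₁, x₂, t)` is positive
whenever `⟨q, t⟩ < 0`; two bases of `V` are equally oriented iff no 4-form takes values of
opposite signs on them. -/
def SameOrientation (V : Submodule ℝ (Mink n)) (q x₁ x₂ q' x₁' x₂' : Mink n) : Prop :=
  ∀ t ∈ V, ∀ t' ∈ V, mink q t < 0 → mink q' t' < 0 →
    ∀ α : Mink n [⋀^Fin 4]→ₗ[ℝ] ℝ, 0 ≤ α ![q, x₁, x₂, t] * α ![q', x₁', x₂', t']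

/-- `(1/2) ⟨x₁ + i x₂, y₁ - i y₂⟩`, for the complex bilinear extension of the scalar product. -/
def coTouchInvariant (x₁ x₂ y₁ y₂ : Mink n) : ℂ :=
  (1 / 2) * ((mink x₁ y₁ + mink x₂ y₂ : ℝ) + (mink x₂ y₁ - mink x₁ y₂ : ℝ) * Complex.I)

/-- At the point of coordinate `z`, the map `g` lies on the mean curvature sphere of `f` and
co-touches it: the contact element of this sphere at `g`, for the orientation compatible with
`f`, and the one of `g` have a vanishing invariant `(1/2) ⟨x₁ + i x₂, y₁ - i y₂⟩`. -/
def CoTouchesMeanSphere (e : OpenPartialHomeomorph M ℂ) (f g : M → Sph n) (z : ℂ) : Prop :=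
  liftRep e g z ∈ meanSphere e f z ∧
    ∃ x₁ ∈ meanSphere e f z, ∃ x₂ ∈ meanSphere e f z,
      IsContactFrame (liftRep e g z) x₁ x₂ ∧
      SameOrientation (meanSphere e f z)
        (liftRep e f z) (pd 0 (liftRep e f) z) (pd 1 (liftRep e f) z)
        (liftRep e g z) x₁ x₂ ∧
      coTouchInvariant x₁ x₂ (pd 0 (liftRep e g) z) (pd 1 (liftRep e g) z) = 0

/-- `g` is an adjoint transform of the conformal surface `f`: it is conformal and co-touches the
mean curvature sphere of `f` at corresponding points. -/
def IsAdjointTransform (f g : M → Sph n) : Prop :=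
  IsConformal f ∧ IsConformal g ∧
    ∀ e ∈ atlas ℂ M, ∀ z ∈ e.target, CoTouchesMeanSphere e f g z

/-! ### Willmore surfaces -/

/-- The induced metric `g_ij` of a map into `S^n ⊆ ℝ^{n+1}`. -/
def metricMat (F : ℂ → Euc n) (z : ℂ) : Matrix (Fin 2) (Fin 2) ℝ :=
  Matrix.of fun i j => inner ℝ (pd i F z) (pd j F z)

/-- The second fundamental form `II_ij` in `S^n`: the component of `∂_i ∂_j F` orthogonal to
`F` and to `∂_u F`, `∂_v F`. -/
def secondForm (F : ℂ → Euc n) (z : ℂ) (i j : Fin 2) : Euc n :=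
  (Submodule.span ℝ {F z, pd 0 F z, pd 1 F z})ᗮ.starProjection (pd i (pd j F) z)

/-- The density of the Willmore functional, in arbitrary real coordinates: one eighth of
`|II°|² dA`, with `II°` the trace-free part of the second fundamental form. In
conformal coordinates this is `⟨κ, κ̄⟩ du dv`, with `κ` the Hopf differential. -/
def willmoreDensity (F : ℂ → Euc n) (z : ℂ) : ℝ :=
  (1 / 8) *
    ((∑ i, ∑ j, ∑ k, ∑ l, (metricMat F z)⁻¹ i k * (metricMat F z)⁻¹ j l *
        inner ℝ (secondForm F z i j) (secondForm F z k l)) -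
      (1 / 2) * ‖∑ i, ∑ j, (metricMat F z)⁻¹ i j • secondForm F z i j‖ ^ 2) *
    Real.sqrt (metricMat F z).det

/-- The immersion `f` is Willmore: it is critical for the Willmore functional under all smooth
variations `Φ_t` of the map through maps into `S^n` that are supported in a compact part `K` of
a chart (`Φ_t` is an immersion near `K` for small `t`, so the functional is taken for the
conformal structure induced by `Φ_t`). Such supports suffice, the first variation being linear
in the variation field. -/
def IsWillmore (f : M → Sph n) : Prop :=
  ∀ e ∈ atlas ℂ M, ∀ K : Set ℂ, IsCompact K → K ⊆ e.target →
    ∀ Φ : ℝ → ℂ → Euc n,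
      ContDiffOn ℝ ∞ (fun q : ℝ × ℂ => Φ q.1 q.2) (univ ×ˢ e.target) →
      (∀ t, ∀ z ∈ e.target, Φ t z ∈ Metric.sphere (0 : Euc n) 1) →
      (∀ z ∈ e.target, Φ 0 z = eucRep e f z) →
      (∀ t, ∀ z ∈ e.target, z ∉ K → Φ t z = eucRep e f z) →
      HasDerivAt (fun t => ∫ z in K, willmoreDensity (Φ t) z) 0 0

/-! ### Maps into the Grassmannian of Minkowski planes -/

/-- The map `H : M → Λ² ℝ^{n+1,1}` is (weakly) conformal: `⟨H_z, H_z⟩ = 0` in the charts of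
`M`. -/
def IsConformalBivec (H : M → Bivec n) : Prop :=
  ∀ e ∈ atlas ℂ M, ∀ z ∈ e.target,
    binner (pd 0 (H ∘ e.symm) z) (pd 0 (H ∘ e.symm) z)
        = binner (pd 1 (H ∘ e.symm) z) (pd 1 (H ∘ e.symm) z) ∧
      binner (pd 0 (H ∘ e.symm) z) (pd 1 (H ∘ e.symm) z) = 0

/-- The density `⟨G_u, G_u⟩ + ⟨G_v, G_v⟩` of the (conformally invariant) energy. -/
def energyDensity (G : ℂ → Bivec n) (z : ℂ) : ℝ :=
  binner (pd 0 G z) (pd 0 G z) + binner (pd 1 G z) (pd 1 G z)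

/-- The Grassmannian of 2-dimensional Minkowski subspaces is the submanifold of `Λ² ℝ^{n+1,1}`
of all `y ∧ y'` with `y`, `y'` light-like and `⟨y, y'⟩ = -1`. The map `H` into it is harmonic: it
is critical for the energy under all smooth variations `H_t = y_t ∧ y'_t` through maps into the
Grassmannian that are supported in a compact part `K` of a chart. -/
def IsHarmonicBivec (H : M → Bivec n) : Prop :=
  ∀ e ∈ atlas ℂ M, ∀ K : Set ℂ, IsCompact K → K ⊆ e.target →
    ∀ y y' : ℝ → ℂ → Mink n,
      ContDiffOn ℝ ∞ (fun q : ℝ × ℂ => y q.1 q.2) (univ ×ˢ e.target) →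
      ContDiffOn ℝ ∞ (fun q : ℝ × ℂ => y' q.1 q.2) (univ ×ˢ e.target) →
      (∀ t, ∀ z ∈ e.target, mink (y t z) (y t z) = 0 ∧ mink (y' t z) (y' t z) = 0 ∧
        mink (y t z) (y' t z) = -1) →
      (∀ z ∈ e.target, wedge (y 0 z) (y' 0 z) = H (e.symm z)) →
      (∀ t, ∀ z ∈ e.target, z ∉ K → wedge (y t z) (y' t z) = H (e.symm z)) →
      HasDerivAt (fun t => ∫ z in K, energyDensity (fun w => wedge (y t w) (y' t w)) z) 0 0

end Surface

end MoebiusSurface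

end

namespace MoebiusSurface

/-! ### Algebra of the scalar products -/

section Algebra

variable {n : ℕ}

/-! The map `H` depends only on `f` and `fh`: rescaling a lift is compensated by `⟨Y, Yh⟩ = -1`, so
`H` is `pointPair` of the two surfaces, and exchanging them changes its sign. The geometric
conditions then become statements about `H`.

Harmonicity. At `y ∧ y'` the Grassmannian has the tangent vectors `y ∧ ζ` and `y' ∧ ζ` with `ζ`
orthogonal to `y` and `y'`, so `H` is critical iff `ΔH` is orthogonal to them
(`NullPair.isCritical_iff`). Pairing `ΔH` with `y ∧ ζ` gives `⟨Δy + 2⟨y_u, y'⟩ y_u + 2⟨y_v, y'⟩ y_v,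
ζ⟩`. This vanishes for all `ζ` iff the vector on the left lies in the plane of `y` and `y'`, which
for conformal `y` amounts to `y'` lying in `Span {y, y_u, y_v, Δy}`. Hence harmonicity says that
each surface lies on the mean curvature spheres of the other (`SpherePair.isCritical_iff`).

Conformality. Let `e_i` be `y_i` made orthogonal to the light-like vector `q` of the second surface
by subtracting a multiple of `y`. Up to a factor, `⟨H_i, H_j⟩` is the symmetrization of `⟨e_i,
q_j⟩`. On a sphere through both points, the oriented contact element at `q` is represented by `(e_1,
-e_2)`, because passing from one point to the other reverses the orientation. Co-touching is
therefore the vanishing of the trace-free part of this symmetrization, that is, conformality of `H`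
(`ConformalJet.coTouch_iff`, `SpherePair.coTouch_iff`).

Willmore property. Vary `f` and keep `fh` fixed. For every immersion `F` avoiding `G`, the Willmore
density is, up to the factor 8, a nonnegative quadratic term in the difference between the mean
curvature sphere and the tangent sphere through `G`, minus the energy density of `pointPair F G` for
the metric of `F`, plus divergences (`SpherePair.willmoreDensity_decomposition`). The divergences
integrate to a constant along the variation. The quadratic term vanishes to second order, as its
square root vanishes at the start. When `H` is conformal, replacing the metric of `F` by the fixed
conformal structure changes the energy only to second order, and the resulting energy is critical by
harmonicity. Hence `f` is Willmore (`SpherePair.hasDerivAt_willmore`), and by symmetry so is `fh`.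
-/

lemma mink_comm (x y : Mink n) : mink x y = mink y x := by
  simp only [mink, mul_comm (x _) (y _)]

lemma mink_add_left (x x' y : Mink n) : mink (x + x') y = mink x y + mink x' y := by
  simp only [mink, ← Finset.sum_add_distrib, Pi.add_apply]
  exact Finset.sum_congr rfl fun i _ => by ring

lemma mink_smul_left (c : ℝ) (x y : Mink n) : mink (c • x) y = c * mink x y := by
  simp only [mink, Finset.mul_sum, Pi.smul_apply, smul_eq_mul]
  exact Finset.sum_congr rfl fun i _ => by ring

lemma mink_add_right (x y y' : Mink n) : mink x (y + y') = mink x y + mink x y' := by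
  rw [mink_comm, mink_add_left, mink_comm y, mink_comm y']

lemma mink_smul_right (c : ℝ) (x y : Mink n) : mink x (c • y) = c * mink x y := by
  rw [mink_comm, mink_smul_left, mink_comm y]

lemma mink_neg_left (x y : Mink n) : mink (-x) y = - mink x y := by
  rw [← neg_one_smul ℝ x, mink_smul_left, neg_one_mul]

lemma mink_neg_right (x y : Mink n) : mink x (-y) = - mink x y := by
  rw [mink_comm, mink_neg_left, mink_comm y]

lemma mink_sub_left (x x' y : Mink n) : mink (x - x') y = mink x y - mink x' y := by
  rw [sub_eq_add_neg, mink_add_left, mink_neg_left, sub_eq_add_neg]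

lemma mink_sub_right (x y y' : Mink n) : mink x (y - y') = mink x y - mink x y' := by
  rw [sub_eq_add_neg, mink_add_right, mink_neg_right, sub_eq_add_neg]

lemma mink_zero_right (y : Mink n) : mink y 0 = 0 := by simp [mink]

lemma sgn_mul_self (i : Fin (n + 2)) : sgn i * sgn i = 1 := by
  unfold sgn; split_ifs <;> norm_num

/-- The Lorentzian scalar product is nondegenerate. -/
lemma eq_zero_of_mink_eq_zero {x : Mink n} (h : ∀ w, mink x w = 0) : x = 0 := by
  funext i
  have := h (Pi.single i (sgn i))
  rw [mink, Finset.sum_eq_single i] at this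
  · simp only [Pi.single_eq_same, Pi.zero_apply] at this ⊢
    linear_combination this - x i * sgn_mul_self i
  · intro j _ hj
    simp [Pi.single_eq_of_ne hj]
  · simp

lemma binner_comm (A B : Bivec n) : binner A B = binner B A := by
  simp only [binner, mul_comm (A _ _) (B _ _)]

lemma binner_add_left (A A' B : Bivec n) : binner (A + A') B = binner A B + binner A' B := by
  simp only [binner, ← mul_add, ← Finset.sum_add_distrib, Pi.add_apply]
  congr 1
  exact Finset.sum_congr rfl fun i _ => Finset.sum_congr rfl fun j _ => by ring

lemma binner_smul_left (c : ℝ) (A B : Bivec n) : binner (c • A) B = c * binner A B := by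
  simp only [binner, mul_left_comm c, Finset.mul_sum, Pi.smul_apply, smul_eq_mul]
  exact Finset.sum_congr rfl fun i _ => Finset.sum_congr rfl fun j _ => by ring

lemma binner_add_right (A B B' : Bivec n) : binner A (B + B') = binner A B + binner A B' := by
  rw [binner_comm, binner_add_left, binner_comm B, binner_comm B']

lemma binner_smul_right (c : ℝ) (A B : Bivec n) : binner A (c • B) = c * binner A B := by
  rw [binner_comm, binner_smul_left, binner_comm B]

lemma binner_neg_left (A B : Bivec n) : binner (-A) B = - binner A B := by
  rw [← neg_one_smul ℝ A, binner_smul_left, neg_one_mul]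

lemma binner_neg_right (A B : Bivec n) : binner A (-B) = - binner A B := by
  rw [binner_comm, binner_neg_left, binner_comm B]

/-- The double sum runs over ordered pairs of indices, so each product of scalar products occurs
twice, once with `i` and `j` exchanged; this accounts for the factor 1/2 in `binner`. -/
lemma binner_wedge (a b c d : Mink n) :
    binner (wedge a b) (wedge c d) = mink a c * mink b d - mink a d * mink b c := by
  have h : ∀ x y : Mink n, mink x y = ∑ i, sgn i * (x i * y i) := fun _ _ => rfl
  have e1 : mink a c * mink b d = ∑ i, ∑ j, (sgn i * (a i * c i)) * (sgn j * (b j * d j)) := by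
    rw [h, h, Finset.sum_mul_sum]
  have e1' : mink a c * mink b d = ∑ i, ∑ j, (sgn j * (a j * c j)) * (sgn i * (b i * d i)) := by
    rw [mul_comm, h, h, Finset.sum_mul_sum]
    exact Finset.sum_congr rfl fun i _ => Finset.sum_congr rfl fun j _ => by ring
  have e2 : mink a d * mink b c = ∑ i, ∑ j, (sgn i * (a i * d i)) * (sgn j * (b j * c j)) := by
    rw [h, h, Finset.sum_mul_sum]
  have e2' : mink a d * mink b c = ∑ i, ∑ j, (sgn j * (a j * d j)) * (sgn i * (b i * c i)) := by
    rw [mul_comm, h, h, Finset.sum_mul_sum]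
    exact Finset.sum_congr rfl fun i _ => Finset.sum_congr rfl fun j _ => by ring
  have key : ∑ i, ∑ j, sgn i * sgn j * (wedge a b i j * wedge c d i j)
      = (mink a c * mink b d + mink a c * mink b d)
        - (mink a d * mink b c + mink a d * mink b c) := by
    trans (∑ i, ∑ j, (sgn i * (a i * c i)) * (sgn j * (b j * d j))
        + ∑ i, ∑ j, (sgn j * (a j * c j)) * (sgn i * (b i * d i)))
        - (∑ i, ∑ j, (sgn i * (a i * d i)) * (sgn j * (b j * c j))
        + ∑ i, ∑ j, (sgn j * (a j * d j)) * (sgn i * (b i * c i)))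
    · simp only [← Finset.sum_add_distrib, ← Finset.sum_sub_distrib]
      refine Finset.sum_congr rfl fun i _ => Finset.sum_congr rfl fun j _ => ?_
      simp only [wedge]
      ring
    · rw [← e1, ← e1', ← e2, ← e2']
  rw [binner, key]
  ring

lemma wedge_add_right (x y y' : Mink n) : wedge x (y + y') = wedge x y + wedge x y' := by
  funext i j; simp only [wedge, Pi.add_apply]; ring

lemma wedge_smul_left (c : ℝ) (x y : Mink n) : wedge (c • x) y = c • wedge x y := by
  funext i j; simp only [wedge, Pi.smul_apply, smul_eq_mul]; ring

lemma wedge_smul_right (c : ℝ) (x y : Mink n) : wedge x (c • y) = c • wedge x y := by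
  funext i j; simp only [wedge, Pi.smul_apply, smul_eq_mul]; ring

lemma wedge_self (x : Mink n) : wedge x x = 0 := by
  funext i j; simp only [wedge, Pi.zero_apply]; ring

lemma wedge_swap (x y : Mink n) : wedge y x = - wedge x y := by
  funext i j; simp only [wedge, Pi.neg_apply]; ring

/-- The contraction of `x ∧ y` with a vector. -/
lemma sum_wedge_mul (x y v : Mink n) :
    (fun i => ∑ j, wedge x y i j * (sgn j * v j)) = mink y v • x - mink x v • y := by
  funext i
  simp only [Pi.sub_apply, Pi.smul_apply, smul_eq_mul, mink, Finset.sum_mul,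
    ← Finset.sum_sub_distrib, wedge]
  exact Finset.sum_congr rfl fun j _ => by ring

/-- The vector `(a, x)` of `ℝ^{n+1,1}`. -/
def minkCons (a : ℝ) (x : Euc n) : Mink n := Fin.cons a fun i => x i

lemma minkCons_add (a b : ℝ) (x y : Euc n) :
    minkCons (a + b) (x + y) = minkCons a x + minkCons b y := by
  funext i
  refine Fin.cases ?_ (fun j => ?_) i <;> simp [minkCons]

lemma minkCons_smul (c a : ℝ) (x : Euc n) : minkCons (c * a) (c • x) = c • minkCons a x := by
  funext i
  refine Fin.cases ?_ (fun j => ?_) i <;> simp [minkCons]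

lemma minkCons_injective {a b : ℝ} {x y : Euc n} (h : minkCons a x = minkCons b y) :
    a = b ∧ x = y := by
  refine ⟨congrFun h 0, ?_⟩
  ext i
  have := congrFun h i.succ
  simpa [minkCons] using this

lemma stdLift_eq (x : Sph n) : stdLift x = minkCons 1 (x : Euc n) := rfl

lemma mink_minkCons (a b : ℝ) (x y : Euc n) :
    mink (minkCons a x) (minkCons b y) = inner ℝ x y - a * b := by
  rw [mink, Fin.sum_univ_succ]
  simp only [sgn, if_true, minkCons, Fin.cons_zero, Fin.cons_succ, Fin.succ_ne_zero, if_false,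
    PiLp.inner_apply, RCLike.inner_apply, conj_trivial, one_mul]
  rw [Finset.sum_congr rfl fun i _ => mul_comm (x i) (y i)]
  ring

end Algebra

/-! ### Partial derivatives -/

section Calculus

variable {V W : Type*} [NormedAddCommGroup V] [NormedSpace ℝ V]
  [NormedAddCommGroup W] [NormedSpace ℝ W]

lemma contDiffOn_fderiv_apply {Q : V → W} {O : Set V} (hO : IsOpen O) (hQ : ContDiffOn ℝ ∞ Q O)
    (a : V) : ContDiffOn ℝ ∞ (fun x => fderiv ℝ Q x a) O :=
  (hQ.fderiv_of_isOpen hO (m := ∞) (by simp)).clm_apply contDiffOn_const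

lemma fderiv_fderiv_apply_comm {Q : V → W} {x : V} (hQ : ContDiffAt ℝ ∞ Q x) (a b : V) :
    fderiv ℝ (fun x => fderiv ℝ Q x a) x b = fderiv ℝ (fun x => fderiv ℝ Q x b) x a := by
  have hd : DifferentiableAt ℝ (fderiv ℝ Q) x :=
    (hQ.fderiv_right (m := ∞) (by simp)).differentiableAt (by simp)
  have h := (hQ.isSymmSndFDerivAt (by
    rw [minSmoothness_of_isRCLikeNormedField]; exact WithTop.coe_le_coe.2 (le_top (a := (2 : ℕ∞))))).eq b a
  rw [fderiv_clm_apply hd (differentiableAt_const a), fderiv_clm_apply hd (differentiableAt_const b)]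
  simpa using h

lemma contDiffOn_pd {F : ℂ → W} {U : Set ℂ} (hU : IsOpen U) (hF : ContDiffOn ℝ ∞ F U) (i : Fin 2) :
    ContDiffOn ℝ ∞ (pd i F) U :=
  contDiffOn_fderiv_apply hU hF (dir i)

lemma differentiableAt_of_contDiffOn {F : V → W} {U : Set V} (hU : IsOpen U)
    (hF : ContDiffOn ℝ ∞ F U) {z : V} (hz : z ∈ U) : DifferentiableAt ℝ F z :=
  (hF.contDiffAt (hU.mem_nhds hz)).differentiableAt (by simp)

lemma pd_comm {F : ℂ → W} {U : Set ℂ} (hU : IsOpen U) (hF : ContDiffOn ℝ ∞ F U) {z : ℂ}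
    (hz : z ∈ U) (i j : Fin 2) : pd i (pd j F) z = pd j (pd i F) z :=
  fderiv_fderiv_apply_comm (hF.contDiffAt (hU.mem_nhds hz)) _ _

lemma hasDerivAt_line {F : ℂ → W} {z : ℂ} (hF : DifferentiableAt ℝ F z) (i : Fin 2) :
    HasDerivAt (fun t : ℝ => F (z + t • dir i)) (pd i F z) 0 :=
  hF.hasFDerivAt.hasLineDerivAt (dir i)

lemma pd_eq_of_hasDerivAt {F : ℂ → W} {z : ℂ} {i : Fin 2} {d : W} (hF : DifferentiableAt ℝ F z)
    (h : HasDerivAt (fun t : ℝ => F (z + t • dir i)) d 0) : pd i F z = d :=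
  (hasDerivAt_line hF i).unique h

lemma pd_congr {F F' : ℂ → W} {U : Set ℂ} (hU : IsOpen U) (h : EqOn F F' U) (i : Fin 2) :
    EqOn (pd i F) (pd i F') U := fun z hz => by
  unfold pd
  rw [(h.eventuallyEq_of_mem (hU.mem_nhds hz)).fderiv_eq]

lemma lap_congr {F F' : ℂ → W} {U : Set ℂ} (hU : IsOpen U) (h : EqOn F F' U) :
    EqOn (lap F) (lap F') U := fun z hz => by
  unfold lap
  rw [pd_congr hU (pd_congr hU h 0) 0 hz, pd_congr hU (pd_congr hU h 1) 1 hz]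

lemma pd_const (c : W) (i : Fin 2) (z : ℂ) : pd i (fun _ => c) z = 0 := by
  simp [pd]

lemma pd_add {F G : ℂ → W} {z : ℂ} (hF : DifferentiableAt ℝ F z) (hG : DifferentiableAt ℝ G z)
    (i : Fin 2) : pd i (fun w => F w + G w) z = pd i F z + pd i G z := by
  simp [pd, fderiv_fun_add hF hG]

lemma pd_sub {F G : ℂ → W} {z : ℂ} (hF : DifferentiableAt ℝ F z) (hG : DifferentiableAt ℝ G z)
    (i : Fin 2) : pd i (fun w => F w - G w) z = pd i F z - pd i G z := by
  simp [pd, fderiv_fun_sub hF hG]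

lemma pd_smul {c : ℂ → ℝ} {F : ℂ → W} {z : ℂ} (hc : DifferentiableAt ℝ c z)
    (hF : DifferentiableAt ℝ F z) (i : Fin 2) :
    pd i (fun w => c w • F w) z = c z • pd i F z + pd i c z • F z := by
  simp [pd, fderiv_fun_smul hc hF]

lemma pd_inner {W : Type*} [NormedAddCommGroup W] [InnerProductSpace ℝ W] {F G : ℂ → W} {z : ℂ}
    (hF : DifferentiableAt ℝ F z) (hG : DifferentiableAt ℝ G z) (i : Fin 2) :
    pd i (fun w => inner ℝ (F w) (G w)) z = inner ℝ (F z) (pd i G z) + inner ℝ (pd i F z) (G z) :=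
  fderiv_inner_apply ℝ hF hG _

variable {n : ℕ}

lemma hasDerivAt_mink {x y : ℝ → Mink n} {x' y' : Mink n} {t : ℝ} (hx : HasDerivAt x x' t)
    (hy : HasDerivAt y y' t) :
    HasDerivAt (fun t => mink (x t) (y t)) (mink x' (y t) + mink (x t) y') t := by
  have := HasDerivAt.fun_sum (u := Finset.univ) fun i _ =>
    (((hasDerivAt_pi.1 hx i).mul (hasDerivAt_pi.1 hy i)).const_mul (sgn i))
  refine this.congr_deriv ?_
  simp only [mink, ← Finset.sum_add_distrib, mul_add]

lemma hasDerivAt_wedge {x y : ℝ → Mink n} {x' y' : Mink n} {t : ℝ} (hx : HasDerivAt x x' t)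
    (hy : HasDerivAt y y' t) :
    HasDerivAt (fun t => wedge (x t) (y t)) (wedge x' (y t) + wedge (x t) y') t := by
  refine hasDerivAt_pi.2 fun i => hasDerivAt_pi.2 fun j => ?_
  refine (((hasDerivAt_pi.1 hx i).mul (hasDerivAt_pi.1 hy j)).sub
    ((hasDerivAt_pi.1 hx j).mul (hasDerivAt_pi.1 hy i))).congr_deriv ?_
  simp only [wedge, Pi.add_apply]
  ring

lemma hasDerivAt_binner {A B : ℝ → Bivec n} {A' B' : Bivec n} {t : ℝ} (hA : HasDerivAt A A' t)
    (hB : HasDerivAt B B' t) :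
    HasDerivAt (fun t => binner (A t) (B t)) (binner A' (B t) + binner (A t) B') t := by
  have := (HasDerivAt.fun_sum (u := Finset.univ) fun i _ =>
    HasDerivAt.fun_sum (u := Finset.univ) fun j _ =>
    (((hasDerivAt_pi.1 (hasDerivAt_pi.1 hA i) j).mul
      (hasDerivAt_pi.1 (hasDerivAt_pi.1 hB i) j)).const_mul (sgn i * sgn j))).const_mul (1 / 2 : ℝ)
  refine this.congr_deriv ?_
  simp only [binner, Finset.sum_add_distrib, mul_add]

lemma contDiffOn_mink {O : Set V} {x y : V → Mink n} (hx : ContDiffOn ℝ ∞ x O)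
    (hy : ContDiffOn ℝ ∞ y O) : ContDiffOn ℝ ∞ (fun q => mink (x q) (y q)) O :=
  ContDiffOn.sum fun i _ => contDiffOn_const.mul ((contDiffOn_pi.1 hx i).mul (contDiffOn_pi.1 hy i))

lemma contDiffOn_wedge {O : Set V} {x y : V → Mink n} (hx : ContDiffOn ℝ ∞ x O)
    (hy : ContDiffOn ℝ ∞ y O) : ContDiffOn ℝ ∞ (fun q => wedge (x q) (y q)) O :=
  contDiffOn_pi.2 fun i => contDiffOn_pi.2 fun j =>
    ((contDiffOn_pi.1 hx i).mul (contDiffOn_pi.1 hy j)).sub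
      ((contDiffOn_pi.1 hx j).mul (contDiffOn_pi.1 hy i))

lemma contDiffOn_binner {O : Set V} {A B : V → Bivec n} (hA : ContDiffOn ℝ ∞ A O)
    (hB : ContDiffOn ℝ ∞ B O) : ContDiffOn ℝ ∞ (fun q => binner (A q) (B q)) O :=
  contDiffOn_const.mul <| ContDiffOn.sum fun i _ => ContDiffOn.sum fun j _ =>
    contDiffOn_const.mul ((contDiffOn_pi.1 (contDiffOn_pi.1 hA i) j).mul
      (contDiffOn_pi.1 (contDiffOn_pi.1 hB i) j))

lemma differentiableAt_mink {x y : V → Mink n} {z : V} (hx : DifferentiableAt ℝ x z)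
    (hy : DifferentiableAt ℝ y z) : DifferentiableAt ℝ (fun q => mink (x q) (y q)) z := by
  unfold mink; fun_prop

lemma differentiableAt_wedge {x y : V → Mink n} {z : V} (hx : DifferentiableAt ℝ x z)
    (hy : DifferentiableAt ℝ y z) : DifferentiableAt ℝ (fun q => wedge (x q) (y q)) z := by
  unfold wedge; fun_prop

lemma differentiableAt_binner {A B : V → Bivec n} {z : V} (hA : DifferentiableAt ℝ A z)
    (hB : DifferentiableAt ℝ B z) : DifferentiableAt ℝ (fun q => binner (A q) (B q)) z := by
  unfold binner; fun_prop

lemma pd_mink {x y : ℂ → Mink n} {z : ℂ} (hx : DifferentiableAt ℝ x z)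
    (hy : DifferentiableAt ℝ y z) (i : Fin 2) :
    pd i (fun w => mink (x w) (y w)) z = mink (pd i x z) (y z) + mink (x z) (pd i y z) := by
  refine pd_eq_of_hasDerivAt (differentiableAt_mink hx hy) ?_
  simpa using hasDerivAt_mink (hasDerivAt_line hx i) (hasDerivAt_line hy i)

lemma pd_wedge {x y : ℂ → Mink n} {z : ℂ} (hx : DifferentiableAt ℝ x z)
    (hy : DifferentiableAt ℝ y z) (i : Fin 2) :
    pd i (fun w => wedge (x w) (y w)) z = wedge (pd i x z) (y z) + wedge (x z) (pd i y z) := by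
  refine pd_eq_of_hasDerivAt (differentiableAt_wedge hx hy) ?_
  simpa using hasDerivAt_wedge (hasDerivAt_line hx i) (hasDerivAt_line hy i)

lemma pd_binner {A B : ℂ → Bivec n} {z : ℂ} (hA : DifferentiableAt ℝ A z)
    (hB : DifferentiableAt ℝ B z) (i : Fin 2) :
    pd i (fun w => binner (A w) (B w)) z = binner (pd i A z) (B z) + binner (A z) (pd i B z) := by
  refine pd_eq_of_hasDerivAt (differentiableAt_binner hA hB) ?_
  simpa using hasDerivAt_binner (hasDerivAt_line hA i) (hasDerivAt_line hB i)

/-- The continuous linear map `x ↦ (0, x)`. -/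
noncomputable def minkIncl (n : ℕ) : Euc n →L[ℝ] Mink n :=
  LinearMap.toContinuousLinearMap
    { toFun := minkCons 0
      map_add' := fun x y => by simpa using minkCons_add 0 0 x y
      map_smul' := fun c x => by simpa using minkCons_smul c 0 x }

lemma minkCons_one_eq (x : Euc n) : minkCons 1 x = minkCons 1 0 + minkIncl n x := by
  have := minkCons_add 1 0 0 x
  rwa [add_zero, zero_add] at this

lemma contDiffOn_minkCons_one {O : Set V} {F : V → Euc n} (hF : ContDiffOn ℝ ∞ F O) :
    ContDiffOn ℝ ∞ (fun q => minkCons 1 (F q)) O := by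
  exact (contDiffOn_const.add ((minkIncl n).contDiff.comp_contDiffOn hF)).congr
    fun q _ => minkCons_one_eq (F q)

lemma pd_minkCons (a : ℝ) {F : ℂ → Euc n} {z : ℂ} (hF : DifferentiableAt ℝ F z) (i : Fin 2) :
    pd i (fun w => minkCons a (F w)) z = minkCons 0 (pd i F z) := by
  have h : (fun w => minkCons a (F w)) = fun w => minkCons a 0 + minkIncl n (F w) := by
    funext w
    have := minkCons_add a 0 0 (F w)
    rwa [add_zero, zero_add] at this
  have h' : HasFDerivAt (fun w => minkCons a 0 + minkIncl n (F w))
      ((minkIncl n).comp (fderiv ℝ F z)) z :=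
    ((minkIncl n).hasFDerivAt.comp z hF.hasFDerivAt).const_add _
  rw [h, pd, h'.fderiv]
  rfl

/-! ### Families of maps depending on a parameter -/

lemma hasFDerivAt_slice {Q : ℝ × ℂ → W} {t : ℝ} {z : ℂ} (hQ : DifferentiableAt ℝ Q (t, z)) :
    HasFDerivAt (fun w => Q (t, w)) ((fderiv ℝ Q (t, z)).comp (ContinuousLinearMap.inr ℝ ℝ ℂ)) z :=
  hQ.hasFDerivAt.comp z (hasFDerivAt_prodMk_right t z)

lemma pd_slice {Q : ℝ × ℂ → W} {t : ℝ} {z : ℂ} (hQ : DifferentiableAt ℝ Q (t, z)) (i : Fin 2) :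
    pd i (fun w => Q (t, w)) z = fderiv ℝ Q (t, z) (0, dir i) := by
  rw [pd, (hasFDerivAt_slice hQ).fderiv]
  simp

lemma hasDerivAt_time {Q : ℝ × ℂ → W} {t : ℝ} {z : ℂ} (hQ : DifferentiableAt ℝ Q (t, z)) :
    HasDerivAt (fun s => Q (s, z)) (fderiv ℝ Q (t, z) (1, 0)) t := by
  have := (hQ.hasFDerivAt.comp t (hasFDerivAt_prodMk_left t z)).hasDerivAt
  exact this.congr_deriv (by simp)

lemma contDiffOn_slice {Q : ℝ × ℂ → W} {I : Set ℝ} {U : Set ℂ}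
    (hQ : ContDiffOn ℝ ∞ Q (I ×ˢ U)) {t : ℝ} (ht : t ∈ I) :
    ContDiffOn ℝ ∞ (fun w => Q (t, w)) U :=
  hQ.comp (by fun_prop) fun _ hw => ⟨ht, hw⟩

lemma contDiffOn_pd_slice {Q : ℝ × ℂ → W} {O : Set (ℝ × ℂ)} (hO : IsOpen O)
    (hQ : ContDiffOn ℝ ∞ Q O) (i : Fin 2) :
    ContDiffOn ℝ ∞ (fun q : ℝ × ℂ => pd i (fun w => Q (q.1, w)) q.2) O :=
  (contDiffOn_fderiv_apply hO hQ (0, dir i)).congr fun _ hq =>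
    pd_slice (differentiableAt_of_contDiffOn hO hQ hq) i

/-- Both sides are mixed second derivatives of `Q` on `ℝ × ℂ`, in a time and a space direction, and
these commute. -/
lemma hasDerivAt_time_pd {Q : ℝ × ℂ → W} {I : Set ℝ} {U : Set ℂ} (hI : IsOpen I) (hU : IsOpen U)
    (hQ : ContDiffOn ℝ ∞ Q (I ×ˢ U)) {t : ℝ} (ht : t ∈ I) {z : ℂ} (hz : z ∈ U) (i : Fin 2) :
    HasDerivAt (fun s => pd i (fun w => Q (s, w)) z)
      (pd i (fun w => deriv (fun s => Q (s, w)) t) z) t := by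
  have hO := hI.prod hU
  have hD : ∀ {w}, w ∈ U → DifferentiableAt ℝ Q (t, w) := fun hw =>
    differentiableAt_of_contDiffOn hO hQ ⟨ht, hw⟩
  have h1 : pd i (fun w => deriv (fun s => Q (s, w)) t) z
      = pd i (fun w => fderiv ℝ Q (t, w) (1, 0)) z :=
    pd_congr hU (fun w hw => (hasDerivAt_time (hD hw)).deriv) i hz
  have h2 := contDiffOn_fderiv_apply hO hQ (1, (0 : ℂ))
  have h3 := contDiffOn_fderiv_apply hO hQ ((0 : ℝ), dir i)
  rw [h1, pd_slice (Q := fun q => fderiv ℝ Q q (1, 0))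
    (differentiableAt_of_contDiffOn hO h2 ⟨ht, hz⟩),
    fderiv_fderiv_apply_comm (hQ.contDiffAt (hO.mem_nhds ⟨ht, hz⟩))]
  refine (hasDerivAt_time (differentiableAt_of_contDiffOn hO h3 ⟨ht, hz⟩)).congr_of_eventuallyEq ?_
  filter_upwards [hI.mem_nhds ht] with s hs
  exact pd_slice (differentiableAt_of_contDiffOn hO hQ ⟨hs, hz⟩) i

end Calculus

/-! ### Integrals over compact parts of a chart -/

section Integrals

variable {U K : Set ℂ}

/-- Near a point of `K` the extension by zero agrees with `X`, which already vanishes on `U \ K`;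
the complement of `K` is open, and there the extension is zero. -/
lemma contDiff_indicator {W : Type*} [NormedAddCommGroup W] [NormedSpace ℝ W]
    (hU : IsOpen U) (hK : IsCompact K) (hKU : K ⊆ U) {X : ℂ → W} (hX : ContDiffOn ℝ ∞ X U)
    (h0 : ∀ z ∈ U, z ∉ K → X z = 0) : ContDiff ℝ ∞ (K.indicator X) := by
  have hEq : EqOn (K.indicator X) X U := fun z hz => by
    by_cases hzK : z ∈ K
    · rw [indicator_of_mem hzK]
    · rw [indicator_of_notMem hzK, h0 z hz hzK]
  refine contDiff_iff_contDiffAt.2 fun z => ?_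
  by_cases hz : z ∈ K
  · exact (hX.contDiffAt (hU.mem_nhds (hKU hz))).congr_of_eventuallyEq
      (hEq.eventuallyEq_of_mem (hU.mem_nhds (hKU hz)))
  · refine contDiffAt_const (c := (0 : W)) |>.congr_of_eventuallyEq ?_
    filter_upwards [hK.isClosed.isOpen_compl.mem_nhds hz] with w hw
    exact indicator_of_notMem hw _

/-- The integral of a derivative of a compactly supported function vanishes. -/
lemma setIntegral_pd_eq_zero (hU : IsOpen U) (hK : IsCompact K) (hKU : K ⊆ U) {X : ℂ → ℝ}
    (hX : ContDiffOn ℝ ∞ X U) (h0 : ∀ z ∈ U, z ∉ K → X z = 0) (i : Fin 2) :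
    ∫ z in K, pd i X z = 0 := by
  have hEq : EqOn X (K.indicator X) U := fun z hz => by
    by_cases hzK : z ∈ K
    · rw [indicator_of_mem hzK]
    · rw [indicator_of_notMem hzK, h0 z hz hzK]
  have hC := contDiff_indicator hU hK hKU hX h0
  have hsupp : HasCompactSupport (K.indicator X) :=
    HasCompactSupport.intro hK fun z hz => indicator_of_notMem hz _
  have hd : ∀ z, HasLineDerivAt ℝ (K.indicator X) (pd i (K.indicator X) z) z (dir i) := fun z =>
    (hC.differentiable (by simp) z).hasFDerivAt.hasLineDerivAt (dir i)
  have hcont : Continuous (pd i (K.indicator X)) :=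
    (hC.continuous_fderiv (by simp)).clm_apply continuous_const
  have hsupp' : HasCompactSupport (pd i (K.indicator X)) := hsupp.fderiv_apply ℝ (dir i)
  have hint := hC.continuous.integrable_of_hasCompactSupport (μ := volume) hsupp
  have hint' := hcont.integrable_of_hasCompactSupport (μ := volume) hsupp'
  -- Integration by parts against the constant function 1.
  have key := integral_bilinear_hasLineDerivAt_right_eq_neg_left_of_integrable
    (μ := (volume : Measure ℂ)) (f := K.indicator X) (f' := pd i (K.indicator X))
    (g := fun _ => (1 : ℝ)) (g' := fun _ => 0) (v := dir i) (B := ContinuousLinearMap.mul ℝ ℝ)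
    (by simpa using hint') (by simp) (by simpa using hint) (fun z _ => hd z)
    (fun z _ => (hasFDerivAt_const (1 : ℝ) z).hasLineDerivAt (dir i))
  have hall : ∫ z, pd i (K.indicator X) z = 0 := by simpa using key
  rw [setIntegral_congr_fun hK.measurableSet ((pd_congr hU hEq i).mono hKU),
    setIntegral_eq_integral_of_forall_compl_eq_zero, hall]
  intro z hz
  have : (K.indicator X) =ᶠ[nhds z] fun _ => 0 := by
    filter_upwards [hK.isClosed.isOpen_compl.mem_nhds hz] with w hw
    exact indicator_of_notMem hw _
  simp [pd, this.fderiv_eq]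

/-- Differentiation under the integral sign; the time derivative is bounded on the compact product
of a closed time interval and `K`, which provides the dominating constant. -/
lemma hasDerivAt_setIntegral {I : Set ℝ} (hI : IsOpen I) (hU : IsOpen U) (hK : IsCompact K)
    (hKU : K ⊆ U) {q : ℝ × ℂ → ℝ} (hq : ContDiffOn ℝ ∞ q (I ×ˢ U)) {t₀ : ℝ} (ht₀ : t₀ ∈ I) :
    HasDerivAt (fun t => ∫ z in K, q (t, z)) (∫ z in K, deriv (fun t => q (t, z)) t₀) t₀ := by
  obtain ⟨ε, hε, hεI⟩ := Metric.nhds_basis_closedBall.mem_iff.1 (hI.mem_nhds ht₀)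
  have hO := hI.prod hU
  have hq' := (contDiffOn_fderiv_apply hO hq (1, (0 : ℂ))).continuousOn
  have hsub : Metric.closedBall t₀ ε ×ˢ K ⊆ I ×ˢ U := prod_mono hεI hKU
  obtain ⟨C, hC⟩ := ((isCompact_closedBall t₀ ε).prod hK).exists_bound_of_continuousOn
    (hq'.mono hsub)
  have hbI : Metric.ball t₀ ε ⊆ I := Metric.ball_subset_closedBall.trans hεI
  have hslice : ∀ t ∈ I, ContinuousOn (fun z => q (t, z)) K := fun t ht =>
    (contDiffOn_slice hq ht).continuousOn.mono hKU
  have hder : ∀ t ∈ I, ∀ z ∈ U, HasDerivAt (fun s => q (s, z)) (fderiv ℝ q (t, z) (1, 0)) t :=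
    fun t ht z hz => hasDerivAt_time (differentiableAt_of_contDiffOn hO hq ⟨ht, hz⟩)
  have h := (hasDerivAt_integral_of_dominated_loc_of_deriv_le
    (μ := volume.restrict K) (F := fun t z => q (t, z))
    (F' := fun t z => fderiv ℝ q (t, z) (1, 0)) (bound := fun _ => C)
    (Metric.ball_mem_nhds t₀ hε) ?_ ?_ ?_ ?_ ?_ ?_).2
  · rwa [setIntegral_congr_fun hK.measurableSet
      fun z hz => (hder t₀ ht₀ z (hKU hz)).deriv]
  · filter_upwards [hI.mem_nhds ht₀] with t ht
    exact (hslice t ht).aestronglyMeasurable hK.measurableSet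
  · exact (hslice t₀ ht₀).integrableOn_compact hK
  · refine ContinuousOn.aestronglyMeasurable ?_ hK.measurableSet
    exact hq'.comp (by fun_prop) fun z hz => ⟨ht₀, hKU hz⟩
  · filter_upwards [ae_restrict_mem hK.measurableSet] with z hz t ht
    exact hC (t, z) ⟨Metric.ball_subset_closedBall ht, hz⟩
  · have : IsFiniteMeasure (volume.restrict K) := ⟨by simpa using hK.measure_lt_top⟩
    exact integrable_const C
  · filter_upwards [ae_restrict_mem hK.measurableSet] with z hz t ht
    exact hder t (hbI ht) z (hKU hz)

/-- The first variation of the energy, for maps into the space of bivectors. -/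
lemma hasDerivAt_energy {n : ℕ} {I : Set ℝ} (hI : IsOpen I) (h0I : (0 : ℝ) ∈ I) (hU : IsOpen U)
    (hK : IsCompact K) (hKU : K ⊆ U) {G : ℝ → ℂ → Bivec n}
    (hG : ContDiffOn ℝ ∞ (fun q : ℝ × ℂ => G q.1 q.2) (I ×ˢ U))
    (hsupp : ∀ t ∈ I, ∀ z ∈ U, z ∉ K → G t z = G 0 z) :
    HasDerivAt (fun t => ∫ z in K, energyDensity (G t) z)
      (-2 * ∫ z in K, binner (lap (G 0) z) (deriv (fun t => G t z) 0)) 0 := by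
  have hO := hI.prod hU
  set B : ℂ → Bivec n := fun z => deriv (fun t => G t z) 0 with hB
  have hG0 : ContDiffOn ℝ ∞ (G 0) U := contDiffOn_slice hG h0I
  have hBs : ContDiffOn ℝ ∞ B U := by
    have := contDiffOn_slice (contDiffOn_fderiv_apply hO hG (1, (0 : ℂ))) h0I
    exact this.congr fun z hz =>
      (hasDerivAt_time (Q := fun q : ℝ × ℂ => G q.1 q.2)
        (differentiableAt_of_contDiffOn hO hG ⟨h0I, hz⟩)).deriv
  have hB0 : ∀ z ∈ U, z ∉ K → B z = 0 := fun z hz hzK => by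
    have : (fun t => G t z) =ᶠ[nhds 0] fun _ => G 0 z := by
      filter_upwards [hI.mem_nhds h0I] with t ht using hsupp t ht z hz hzK
    rw [hB]
    simp only [this.deriv_eq, deriv_const]
  have hpd : ∀ i, ContDiffOn ℝ ∞ (fun q : ℝ × ℂ => pd i (G q.1) q.2) (I ×ˢ U) := fun i =>
    contDiffOn_pd_slice hO hG i
  have hE : ContDiffOn ℝ ∞ (fun q : ℝ × ℂ => energyDensity (G q.1) q.2) (I ×ˢ U) :=
    (contDiffOn_binner (hpd 0) (hpd 0)).add (contDiffOn_binner (hpd 1) (hpd 1))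
  refine (hasDerivAt_setIntegral hI hU hK hKU hE h0I).congr_deriv ?_
  -- With `B` the variation field, the density varies by `2 div X - 2 ⟨ΔG, B⟩`, and `X` vanishes off
  -- `K`, so its divergence integrates to zero.
  set X : Fin 2 → ℂ → ℝ := fun i z => binner (pd i (G 0) z) (B z) with hXdef
  have hX : ∀ i, ContDiffOn ℝ ∞ (X i) U := fun i =>
    contDiffOn_binner (contDiffOn_pd hU hG0 i) hBs
  have hX0 : ∀ i, ∀ z ∈ U, z ∉ K → X i z = 0 := fun i z hz hzK => by
    simp [hXdef, hB0 z hz hzK, binner]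
  have hpt : ∀ z ∈ K, deriv (fun t => energyDensity (G t) z) 0
      = 2 * (pd 0 (X 0) z + pd 1 (X 1) z) - 2 * binner (lap (G 0) z) (B z) := by
    intro z hz
    have ht : ∀ i, HasDerivAt (fun t => pd i (G t) z) (pd i B z) 0 := fun i =>
      hasDerivAt_time_pd hI hU hG h0I (hKU hz) i
    have h1 : ∀ i, pd i (X i) z = binner (pd i (pd i (G 0)) z) (B z)
        + binner (pd i (G 0) z) (pd i B z) := fun i =>
      pd_binner (differentiableAt_of_contDiffOn hU (contDiffOn_pd hU hG0 i) (hKU hz))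
        (differentiableAt_of_contDiffOn hU hBs (hKU hz)) i
    have h2 := ((hasDerivAt_binner (ht 0) (ht 0)).add (hasDerivAt_binner (ht 1) (ht 1))).deriv
    have h3 : deriv (fun t => energyDensity (G t) z) 0 = _ := h2
    rw [h3, h1, h1, lap, binner_add_left, binner_comm (pd 0 B z), binner_comm (pd 1 B z)]
    ring
  rw [setIntegral_congr_fun hK.measurableSet hpt]
  have hi : ∀ i, IntegrableOn (pd i (X i)) K := fun i =>
    ((contDiffOn_pd hU (hX i) i).continuousOn.mono hKU).integrableOn_compact hK
  have hc2 : ContinuousOn (fun z => binner (lap (G 0) z) (B z)) U :=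
    (contDiffOn_binner ((contDiffOn_pd hU (contDiffOn_pd hU hG0 0) 0).add
      (contDiffOn_pd hU (contDiffOn_pd hU hG0 1) 1)) hBs).continuousOn
  have hi2 := (hc2.mono hKU).integrableOn_compact hK (μ := volume)
  have hi1 : IntegrableOn (fun z => 2 * (pd 0 (X 0) z + pd 1 (X 1) z)) K :=
    ((hi 0).add (hi 1)).const_mul 2
  rw [integral_sub hi1 (hi2.const_mul 2), integral_const_mul,
    integral_const_mul, integral_add (hi 0) (hi 1),
    setIntegral_pd_eq_zero hU hK hKU (hX 0) (hX0 0),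
    setIntegral_pd_eq_zero hU hK hKU (hX 1) (hX0 1)]
  ring

end Integrals

/-! ### Maps in the charts of the surface -/

section Charts

variable {n : ℕ} {M : Type*} [TopologicalSpace M] [ChartedSpace ℂ M]

/-- Holomorphic transition maps are smooth over `ℝ`, so real smooth maps on `M` can be read in the
holomorphic charts. -/
lemma isManifold_real [IsManifold 𝓘(ℂ, ℂ) ω M] : IsManifold 𝓘(ℝ, ℂ) ∞ M := by
  refine isManifold_of_contDiffOn 𝓘(ℝ, ℂ) ∞ M fun e e' he he' => ?_
  have h := HasGroupoid.compatible (G := contDiffGroupoid ω 𝓘(ℂ, ℂ)) he he'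
  rw [contDiffGroupoid, mem_groupoid_of_pregroupoid] at h
  exact ((h.1 : ContDiffOn ℂ ω _ _).restrict_scalars ℝ).of_le le_top

lemma contDiffOn_chart [IsManifold 𝓘(ℂ, ℂ) ω M] {W : Type*} [NormedAddCommGroup W]
    [NormedSpace ℝ W] {g : M → W} (hg : ContMDiff 𝓘(ℝ, ℂ) 𝓘(ℝ, W) ∞ g)
    {e : OpenPartialHomeomorph M ℂ} (he : e ∈ atlas ℂ M) :
    ContDiffOn ℝ ∞ (g ∘ e.symm) e.target := by
  have := isManifold_real (M := M)
  exact contMDiffOn_iff_contDiffOn.1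
    (hg.comp_contMDiffOn (contMDiffOn_symm_of_mem_maximalAtlas
      (IsManifold.subset_maximalAtlas he)))

end Charts

/-! ### Light-like maps and their derivatives -/

section Jets

variable {n : ℕ} {U : Set ℂ} {y : ℂ → Mink n}

lemma mink_pd_of_const (hU : IsOpen U) {x y : ℂ → Mink n} (hx : ContDiffOn ℝ ∞ x U)
    (hy : ContDiffOn ℝ ∞ y U) {c : ℝ} (h0 : ∀ z ∈ U, mink (x z) (y z) = c) {z : ℂ} (hz : z ∈ U)
    (i : Fin 2) : mink (pd i x z) (y z) + mink (x z) (pd i y z) = 0 := by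
  rw [← pd_mink (differentiableAt_of_contDiffOn hU hx hz)
    (differentiableAt_of_contDiffOn hU hy hz), pd_congr hU h0 i hz, pd_const]

lemma mink_pd_of_null (hU : IsOpen U) (hy : ContDiffOn ℝ ∞ y U)
    (h0 : ∀ z ∈ U, mink (y z) (y z) = 0) {z : ℂ} (hz : z ∈ U) (i : Fin 2) :
    mink (y z) (pd i y z) = 0 := by
  have := mink_pd_of_const hU hy hy h0 hz i
  rw [mink_comm (pd i y z)] at this
  linarith

lemma mink_pd_pd_of_null (hU : IsOpen U) (hy : ContDiffOn ℝ ∞ y U)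
    (h0 : ∀ z ∈ U, mink (y z) (y z) = 0) {z : ℂ} (hz : z ∈ U) (i j : Fin 2) :
    mink (y z) (pd i (pd j y) z) = - mink (pd i y z) (pd j y z) := by
  have := mink_pd_of_const hU hy (contDiffOn_pd hU hy j)
    (fun w hw => mink_pd_of_null hU hy h0 hw j) hz i
  linarith

lemma mink_lap_of_null (hU : IsOpen U) (hy : ContDiffOn ℝ ∞ y U)
    (h0 : ∀ z ∈ U, mink (y z) (y z) = 0) {z : ℂ} (hz : z ∈ U) :
    mink (y z) (lap y z) = - (mink (pd 0 y z) (pd 0 y z) + mink (pd 1 y z) (pd 1 y z)) := by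
  rw [lap, mink_add_right, mink_pd_pd_of_null hU hy h0 hz, mink_pd_pd_of_null hU hy h0 hz]
  ring

/-- The equation `⟨Δy, y_j⟩ = 0` for conformal `y`. -/
lemma mink_lap_pd_of_conformal (hU : IsOpen U) (hy : ContDiffOn ℝ ∞ y U)
    (hc : ∀ z ∈ U, mink (pd 0 y z) (pd 0 y z) = mink (pd 1 y z) (pd 1 y z) ∧
      mink (pd 0 y z) (pd 1 y z) = 0) {z : ℂ} (hz : z ∈ U) (j : Fin 2) :
    mink (lap y z) (pd j y z) = 0 := by
  have hs := contDiffOn_pd hU hy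
  have hd := fun k => differentiableAt_of_contDiffOn hU (hs k) hz
  have h1 : ∀ i, pd i (fun w => mink (pd 0 y w) (pd 0 y w)) z
      = pd i (fun w => mink (pd 1 y w) (pd 1 y w)) z := fun i =>
    pd_congr hU (fun w hw => (hc w hw).1) i hz
  have h2 : ∀ i, mink (pd i (pd 0 y) z) (pd 1 y z) + mink (pd 0 y z) (pd i (pd 1 y) z) = 0 :=
    fun i => mink_pd_of_const hU (hs 0) (hs 1) (fun w hw => (hc w hw).2) hz i
  simp only [pd_mink (hd _) (hd _)] at h1
  have h10 := h1 0
  have h11 := h1 1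
  have h20 := h2 0
  have h21 := h2 1
  rw [pd_comm hU hy hz 1 0] at h11 h21
  rw [mink_comm (pd 0 y z), mink_comm (pd 1 y z) (pd 0 (pd 1 y) z)] at h10
  rw [mink_comm (pd 0 y z), mink_comm (pd 1 y z) (pd 1 (pd 1 y) z)] at h11
  rw [mink_comm (pd 0 y z)] at h20 h21
  rw [lap, mink_add_left]
  fin_cases j
  · simp only [Fin.zero_eta]; linarith
  · simp only [Fin.mk_one]; linarith

end Jets

/-! ### The mean curvature sphere of a light-like conformal map -/

section SphereAlgebra

variable {n : ℕ}

/-- The components, up to sign, of `⟨H_i, H_j⟩` for `H = y ∧ q / -⟨y, q⟩`. -/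
noncomputable def mixedForm (y q yi qj : Mink n) : ℝ := mink yi qj - mink yi q * mink y qj / mink y q

/-- A pointwise version of the second order jet of a conformal light-like map. -/
structure ConformalJet (y y₁ y₂ l : Mink n) : Prop where
  null : mink y y = 0
  orth₁ : mink y y₁ = 0
  orth₂ : mink y y₂ = 0
  length : mink y₁ y₁ = mink y₂ y₂
  pos : 0 < mink y₁ y₁
  orth : mink y₁ y₂ = 0
  lap : mink y l = -(2 * mink y₁ y₁)
  lap₁ : mink l y₁ = 0
  lap₂ : mink l y₂ = 0

variable {y y₁ y₂ l q : Mink n}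

lemma mem_span_four {a b c d x : Mink n} :
    x ∈ Submodule.span ℝ {a, b, c, d} ↔
      ∃ α β γ δ : ℝ, x = α • a + β • b + γ • c + δ • d := by
  constructor
  · intro h
    obtain ⟨α, w, hw, rfl⟩ := Submodule.mem_span_insert.1 h
    obtain ⟨β, γ, δ, rfl⟩ := Submodule.mem_span_triple.1 hw
    exact ⟨α, β, γ, δ, by abel⟩
  · rintro ⟨α, β, γ, δ, rfl⟩
    refine add_mem (add_mem (add_mem ?_ ?_) ?_) ?_ <;>
      exact Submodule.smul_mem _ _ (Submodule.subset_span (by simp))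

/-- The mean curvature sphere contains `q` iff the Laplacian satisfies the harmonicity equation. -/
lemma ConformalJet.mem_span_iff (h : ConformalJet y y₁ y₂ l) (hq : mink q q = 0)
    (hyq : mink y q = -1) :
    q ∈ Submodule.span ℝ {y, y₁, y₂, l} ↔
      ∀ ζ, mink y ζ = 0 → mink q ζ = 0 →
        mink l ζ + 2 * (mink y₁ q * mink y₁ ζ + mink y₂ q * mink y₂ ζ) = 0 := by
  have hpos := h.pos
  have hlen := h.length
  have e1 := h.orth₁
  have e2 := h.orth₂
  have e3 := h.orth
  have e4 := h.lap
  have e5 := h.lap₁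
  have e6 := h.lap₂
  constructor
  · intro hmem ζ h1 h2
    obtain ⟨α, β, γ, δ, hd⟩ := mem_span_four.1 hmem
    have f0 : mink y q = -1 := hyq
    have f1 : mink y₁ q = β * mink y₁ y₁ := by
      rw [hd]
      simp only [mink_add_right, mink_smul_right, mink_comm y₁ y, mink_comm y₁ l, e1, e3, e5]
      ring
    have f2 : mink y₂ q = γ * mink y₁ y₁ := by
      rw [hd]
      simp only [mink_add_right, mink_smul_right, mink_comm y₂ y, mink_comm y₂ l, mink_comm y₂ y₁,
        e2, e3, e6, hlen]
      ring
    rw [hd] at f0 h2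
    simp only [mink_add_right, mink_smul_right, mink_add_left, mink_smul_left, h.null, e1, e2, e4,
      h1] at f0 h2
    rw [f1, f2]
    -- In `Span {y, y₁, y₂, l}` only `l` pairs nontrivially with `y`, so `⟨y, q⟩ = -1` fixes its
    -- coefficient in `q`.
    have hδ : δ * (2 * mink y₁ y₁) = 1 := by linarith
    have : mink l ζ * (δ * (2 * mink y₁ y₁)) = mink l ζ := by rw [hδ, mul_one]
    linear_combination (2 * mink y₁ y₁) * h2 - this
  · intro hE
    -- The equation for `ζ` says that `r` is orthogonal to everything orthogonal to `y` and `q`.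
    -- Hence `r` lies in their plane, and solving for `q` is possible because `⟨r, y⟩` is nonzero.
    set r : Mink n := l + (2 * mink y₁ q) • y₁ + (2 * mink y₂ q) • y₂ with hr
    have hrζ : ∀ ζ, mink y ζ = 0 → mink q ζ = 0 → mink r ζ = 0 := fun ζ h1 h2 => by
      rw [hr]
      simp only [mink_add_left, mink_smul_left]
      linear_combination hE ζ h1 h2
    have hry : mink r y = -(2 * mink y₁ y₁) := by
      rw [hr]
      simp only [mink_add_left, mink_smul_left, mink_comm l, mink_comm y₁ y, mink_comm y₂ y, e1, e2,
        e4]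
      ring
    have hz : r + mink r q • y + mink r y • q = 0 := by
      refine eq_zero_of_mink_eq_zero fun w => ?_
      -- This is the orthogonal projection of `w` away from the Minkowski plane of the null vectors
      -- `y` and `q`, with the signs coming from `⟨y, q⟩ = -1`.
      have := hrζ (w + mink q w • y + mink y w • q) ?_ ?_
      · simp only [mink_add_right, mink_smul_right] at this
        simp only [mink_add_left, mink_smul_left]
        linear_combination this
      · simp only [mink_add_right, mink_smul_right, h.null, hyq]
        ring
      · simp only [mink_add_right, mink_smul_right, hq, mink_comm q y, hyq]
        ring
    refine mem_span_four.2 ⟨mink r q / (2 * mink y₁ y₁), mink y₁ q / mink y₁ y₁,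
      mink y₂ q / mink y₁ y₁, 1 / (2 * mink y₁ y₁), ?_⟩
    rw [hry] at hz
    have hq' : (2 * mink y₁ y₁) • q = r + mink r q • y := by
      linear_combination (norm := module) (-1 : ℝ) • hz
    have hq2 : q = (1 / (2 * mink y₁ y₁)) • (r + mink r q • y) := by
      rw [← hq', smul_smul, one_div_mul_cancel (by positivity), one_smul]
    have hne : mink y₁ y₁ ≠ 0 := hpos.ne'
    generalize mink r q = c at hq2 ⊢
    rw [hr] at hq2
    generalize mink y₁ q = a at hq2 ⊢
    generalize mink y₂ q = b at hq2 ⊢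
    generalize mink y₁ y₁ = d at hq2 hne ⊢
    funext k
    have := congrFun hq2 k
    simp only [Pi.add_apply, Pi.smul_apply, smul_eq_mul] at this ⊢
    rw [this]
    field_simp
    ring

/-- Pairing with `y` detects the coefficient of `l`, so `⟨y, q⟩ ≠ 0` lets `q` replace `l` as a
generator. -/
lemma ConformalJet.exists_decomposition (h : ConformalJet y y₁ y₂ l) (hyq : mink y q ≠ 0)
    (hq : q ∈ Submodule.span ℝ {y, y₁, y₂, l}) {x : Mink n}
    (hx : x ∈ Submodule.span ℝ {y, y₁, y₂, l}) :
    ∃ α β γ δ : ℝ, x = α • y + β • y₁ + γ • y₂ + δ • q := by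
  obtain ⟨a, b, c, d, hd⟩ := mem_span_four.1 hq
  obtain ⟨a', b', c', d', hd'⟩ := mem_span_four.1 hx
  have h0 : mink y q = d * -(2 * mink y₁ y₁) := by
    rw [hd]
    simp only [mink_add_right, mink_smul_right, h.null, h.orth₁, h.orth₂, h.lap]
    ring
  have hd0 : d ≠ 0 := by
    rintro rfl
    exact hyq (by rw [h0]; ring)
  refine ⟨a' - d' / d * a, b' - d' / d * b, c' - d' / d * c, d' / d, ?_⟩
  rw [hd', hd]
  funext k
  simp only [Pi.add_apply, Pi.smul_apply, smul_eq_mul]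
  field_simp
  ring

lemma coTouchInvariant_eq_zero_iff {x₁ x₂ q₁ q₂ : Mink n} :
    coTouchInvariant x₁ x₂ q₁ q₂ = 0 ↔
      mink x₁ q₁ + mink x₂ q₂ = 0 ∧ mink x₂ q₁ - mink x₁ q₂ = 0 := by
  rw [coTouchInvariant, mul_eq_zero]
  simp only [one_div, inv_eq_zero, OfNat.ofNat_ne_zero, false_or, Complex.ext_iff]
  simp

/-- The alternating form `(v_i) ↦ det ⟨v_i, w_j⟩`. -/
noncomputable def gramForm (w : Fin 4 → Mink n) : Mink n [⋀^Fin 4]→ₗ[ℝ] ℝ :=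
  Matrix.detRowAlternating.compLinearMap
    { toFun := fun v j => mink v (w j)
      map_add' := fun v v' => funext fun j => mink_add_left v v' (w j)
      map_smul' := fun c v => funext fun j => mink_smul_left c v (w j) }

lemma gramForm_apply (w v : Fin 4 → Mink n) :
    gramForm w v = Matrix.det (Matrix.of fun i j => mink (v i) (w j)) := rfl

/-- Modulo the null vectors, both contact frames are expressed in the common orthogonal frame `e₁`,
`e₂`. The basis for the second one starts with `q` and ends with `y`, the first one the other way
round; this transposition makes equal orientation mean a nonpositive determinant. -/
lemma det_le_zero_of_sameOrientation {V : Submodule ℝ (Mink n)} {y y₁ y₂ q x₁ x₂ e₁ e₂ : Mink n}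
    {c₁ c₂ p₁ p₂ a b c d : ℝ} (hyV : y ∈ V) (hqV : q ∈ V)
    (hy : mink y y = 0) (hq : mink q q = 0) (hyq : mink y q < 0) (hy₁ : mink y e₁ = 0)
    (hy₂ : mink y e₂ = 0) (hq₁ : mink q e₁ = 0) (hq₂ : mink q e₂ = 0)
    (hlen : mink e₁ e₁ = mink e₂ e₂) (hpos : 0 < mink e₁ e₁) (horth : mink e₁ e₂ = 0)
    (h₁ : y₁ = e₁ + c₁ • y) (h₂ : y₂ = e₂ + c₂ • y)
    (hx₁ : x₁ = p₁ • q + a • e₁ + b • e₂) (hx₂ : x₂ = p₂ • q + c • e₁ + d • e₂)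
    (h : SameOrientation V y y₁ y₂ q x₁ x₂) : a * d - b * c ≤ 0 := by
  have hqy : mink q y = mink y q := mink_comm _ _
  -- Since `⟨y, q⟩ < 0`, each null vector is an admissible last vector for the other one, and one
  -- 4-form that is nonzero on the sphere's subspace suffices as a test.
  have h3 := h q hqV y hyV hyq (by rwa [hqy]) (gramForm ![y, e₁, e₂, q])
  have hv1 : gramForm ![y, e₁, e₂, q] ![y, y₁, y₂, q] = -(mink y q ^ 2 * mink e₁ e₁ ^ 2) := by
    rw [gramForm_apply, h₁, h₂]
    simp [Matrix.det_succ_row_zero, Fin.sum_univ_succ, mink_add_left, mink_smul_left, hy, hy₁, hy₂,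
      hq₁, hq₂, hq, horth, mink_comm e₁ y, mink_comm e₂ y, mink_comm e₂ e₁, mink_comm e₁ q,
      mink_comm e₂ q, hqy, ← hlen, Fin.succAbove]
    ring
  have hv2 : gramForm ![y, e₁, e₂, q] ![q, x₁, x₂, y]
      = mink y q ^ 2 * mink e₁ e₁ ^ 2 * (a * d - b * c) := by
    rw [gramForm_apply, hx₁, hx₂]
    simp [Matrix.det_succ_row_zero, Fin.sum_univ_succ, mink_add_left, mink_smul_left, hy, hy₁, hy₂,
      hq₁, hq₂, hq, horth, mink_comm e₁ y, mink_comm e₂ y, mink_comm e₂ e₁, mink_comm e₁ q,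
      mink_comm e₂ q, hqy, ← hlen, Fin.succAbove]
    ring
  rw [hv1, hv2] at h3
  have hP : 0 < mink y q ^ 2 * mink e₁ e₁ ^ 2 := by
    have := hyq.ne
    positivity
  generalize mink y q ^ 2 * mink e₁ e₁ ^ 2 = P at h3 hP
  by_contra! hcon
  have : 0 < P * (P * (a * d - b * c)) := by positivity
  linarith

end SphereAlgebra

/-! ### Orientation of contact elements and co-touching -/

section CoTouch

variable {n : ℕ} {y y₁ y₂ l q : Mink n}

/-- Orthogonal rows of equal length make the matrix with rows `(a, b)`, `(c, d)` a multiple of an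
orthogonal one; a nonpositive determinant leaves only multiples of reflections. -/
lemma conformal_reflection {a b c d : ℝ} (hl : a * a + b * b = c * c + d * d)
    (ho : a * c + b * d = 0) (hdet : a * d - b * c ≤ 0) : c = b ∧ d = -a := by
  have h1 : (a * d - b * c) ^ 2 = (a * a + b * b) ^ 2 := by
    linear_combination (-(a * a + b * b)) * hl - (a * c + b * d) * ho
  have h2 : a * d - b * c = -(a * a + b * b) := by
    rcases sq_eq_sq_iff_eq_or_eq_neg.1 h1 with h | h
    · have := add_nonneg (mul_self_nonneg a) (mul_self_nonneg b)
      linarith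
    · exact h
  have h3 : (d + a) ^ 2 + (c - b) ^ 2 = 0 := by linear_combination 2 * h2 - hl
  constructor
  · have : (c - b) ^ 2 = 0 := by nlinarith [sq_nonneg (d + a), sq_nonneg (c - b)]
    linarith [pow_eq_zero_iff (two_ne_zero) |>.1 this]
  · have : (d + a) ^ 2 = 0 := by nlinarith [sq_nonneg (d + a), sq_nonneg (c - b)]
    linarith [pow_eq_zero_iff (two_ne_zero) |>.1 this]

lemma alternating_four_last (α : Mink n [⋀^Fin 4]→ₗ[ℝ] ℝ) (u v w : Mink n) (a b c d : ℝ)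
    (x : Mink n) : α ![u, v, w, a • u + b • v + c • w + d • x] = d * α ![u, v, w, x] := by
  have hup : ∀ x : Mink n, ![u, v, w, x] = Function.update ![u, v, w, 0] 3 x := fun x => by
    funext i; fin_cases i <;> rfl
  have hu : α ![u, v, w, u] = 0 := α.map_eq_zero_of_eq _ (i := 0) (j := 3) rfl (by decide)
  have hv : α ![u, v, w, v] = 0 := α.map_eq_zero_of_eq _ (i := 1) (j := 3) rfl (by decide)
  have hw : α ![u, v, w, w] = 0 := α.map_eq_zero_of_eq _ (i := 2) (j := 3) rfl (by decide)
  rw [hup] at hu hv hw ⊢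
  rw [hup x, α.map_update_add, α.map_update_add, α.map_update_add, α.map_update_smul,
    α.map_update_smul, α.map_update_smul, α.map_update_smul, hu, hv, hw]
  simp

/-- The last entry `y` kills the multiples of `y` in the middle slots, and the minus sign of the
third entry cancels the sign of the exchange of `q` and `y`. -/
lemma alternating_four_shift (α : Mink n [⋀^Fin 4]→ₗ[ℝ] ℝ) (q v w y : Mink n) (c₁ c₂ : ℝ) :
    α ![q, v + c₁ • y, -(w + c₂ • y), y] = α ![y, v, w, q] := by
  have h1 : ∀ (w : Mink n) (x : Mink n),
      ![q, x, w, y] = Function.update ![q, 0, w, y] 1 x := fun w x => by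
    funext i; fin_cases i <;> rfl
  have h2 : ∀ (v : Mink n) (x : Mink n),
      ![q, v, x, y] = Function.update ![q, v, 0, y] 2 x := fun v x => by
    funext i; fin_cases i <;> rfl
  have s1 : ∀ w : Mink n, α ![q, y, w, y] = 0 := fun w =>
    α.map_eq_zero_of_eq _ (i := 1) (j := 3) rfl (by decide)
  have s2 : ∀ v : Mink n, α ![q, v, y, y] = 0 := fun v =>
    α.map_eq_zero_of_eq _ (i := 2) (j := 3) rfl (by decide)
  have e1 : ∀ w : Mink n, α ![q, v + c₁ • y, w, y] = α ![q, v, w, y] := fun w => by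
    have := s1 w
    rw [h1] at this
    rw [h1, α.map_update_add, α.map_update_smul, this, ← h1]
    simp
  have e2 : α ![q, v, -(w + c₂ • y), y] = - α ![q, v, w, y] := by
    have := s2 v
    rw [h2] at this
    rw [h2, ← neg_one_smul ℝ, α.map_update_smul, α.map_update_add, α.map_update_smul, this, ← h2]
    simp
  have hsw : ![q, v, w, y] = ![y, v, w, q] ∘ Equiv.swap 0 3 := by
    funext i; fin_cases i <;> rfl
  rw [e1, e2, hsw, α.map_swap _ (by decide : (0 : Fin 4) ≠ 3), neg_neg]

/-- Co-touching of the mean curvature sphere is the vanishing of the trace-free part of the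
symmetrized mixed form. -/
lemma ConformalJet.coTouch_iff (h : ConformalJet y y₁ y₂ l) (hq : mink q q = 0)
    (hyq : mink y q < 0) (hmem : q ∈ Submodule.span ℝ {y, y₁, y₂, l}) {q₁ q₂ : Mink n}
    (hq₁ : mink q q₁ = 0) (hq₂ : mink q q₂ = 0) :
    (∃ x₁ ∈ Submodule.span ℝ {y, y₁, y₂, l}, ∃ x₂ ∈ Submodule.span ℝ {y, y₁, y₂, l},
      IsContactFrame q x₁ x₂ ∧
      SameOrientation (Submodule.span ℝ {y, y₁, y₂, l}) y y₁ y₂ q x₁ x₂ ∧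
      coTouchInvariant x₁ x₂ q₁ q₂ = 0) ↔
    mixedForm y q y₁ q₁ = mixedForm y q y₂ q₂ ∧
      mixedForm y q y₁ q₂ + mixedForm y q y₂ q₁ = 0 := by
  have hτ : mink y q ≠ 0 := hyq.ne
  obtain ⟨c₁, hc₁⟩ : ∃ c, mink y₁ q = c * mink y q := ⟨_, (div_mul_cancel₀ _ hτ).symm⟩
  obtain ⟨c₂, hc₂⟩ : ∃ c, mink y₂ q = c * mink y q := ⟨_, (div_mul_cancel₀ _ hτ).symm⟩
  have hm₁ : ∀ x, mixedForm y q y₁ x = mink (y₁ - c₁ • y) x := fun x => by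
    rw [mixedForm, hc₁, mink_sub_left, mink_smul_left]
    field_simp
  have hm₂ : ∀ x, mixedForm y q y₂ x = mink (y₂ - c₂ • y) x := fun x => by
    rw [mixedForm, hc₂, mink_sub_left, mink_smul_left]
    field_simp
  simp only [hm₁, hm₂]
  -- The constants `c₁`, `c₂` make `e₁`, `e₂` orthogonal to `q` as well as to `y`, without changing
  -- their lengths and angle since `y` is null and orthogonal to `y₁`, `y₂`. The mixed form is then
  -- a plain scalar product with these vectors.
  obtain ⟨e₁, he₁⟩ : ∃ e, e = y₁ - c₁ • y := ⟨_, rfl⟩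
  obtain ⟨e₂, he₂⟩ : ∃ e, e = y₂ - c₂ • y := ⟨_, rfl⟩
  have hy₁ : y₁ = e₁ + c₁ • y := by rw [he₁]; abel
  have hy₂ : y₂ = e₂ + c₂ • y := by rw [he₂]; abel
  have hyy := h.null
  have ye₁ : mink y e₁ = 0 := by
    rw [he₁, mink_sub_right, mink_smul_right, h.orth₁, hyy]; ring
  have ye₂ : mink y e₂ = 0 := by
    rw [he₂, mink_sub_right, mink_smul_right, h.orth₂, hyy]; ring
  have qe₁ : mink q e₁ = 0 := by
    rw [he₁, mink_sub_right, mink_smul_right, mink_comm q, hc₁, mink_comm q]; ring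
  have qe₂ : mink q e₂ = 0 := by
    rw [he₂, mink_sub_right, mink_smul_right, mink_comm q, hc₂, mink_comm q]; ring
  have hpos : 0 < mink e₁ e₁ := by
    have := h.pos
    rw [hy₁] at this
    simpa only [mink_add_left, mink_add_right, mink_smul_left, mink_smul_right, ye₁, hyy,
      mink_comm e₁ y, mul_zero, add_zero] using this
  have hlen : mink e₁ e₁ = mink e₂ e₂ := by
    have := h.length
    rw [hy₁, hy₂] at this
    simpa only [mink_add_left, mink_add_right, mink_smul_left, mink_smul_right, ye₁, ye₂, hyy,
      mink_comm e₁ y, mink_comm e₂ y, mul_zero, add_zero] using this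
  have horth : mink e₁ e₂ = 0 := by
    have := h.orth
    rw [hy₁, hy₂] at this
    simpa only [mink_add_left, mink_add_right, mink_smul_left, mink_smul_right, ye₁, ye₂, hyy,
      mink_comm e₁ y, mul_zero, add_zero] using this
  rw [← he₁, ← he₂]
  have hqy : mink q y = mink y q := mink_comm _ _
  have hyV : y ∈ Submodule.span ℝ {y, y₁, y₂, l} := Submodule.subset_span (by simp)
  have h1V : y₁ ∈ Submodule.span ℝ {y, y₁, y₂, l} := Submodule.subset_span (by simp)
  have h2V : y₂ ∈ Submodule.span ℝ {y, y₁, y₂, l} := Submodule.subset_span (by simp)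
  constructor
  · rintro ⟨x₁, hx₁, x₂, hx₂, hF, hO, hI⟩
    have hdec : ∀ x ∈ Submodule.span ℝ {y, y₁, y₂, l}, mink q x = 0 →
        ∃ p a b : ℝ, x = p • q + a • e₁ + b • e₂ := by
      intro x hx hqx
      obtain ⟨α, β, γ, δ, hd⟩ := h.exists_decomposition hτ hmem hx
      have h0 : α + β * c₁ + γ * c₂ = 0 := by
        rw [hd, hy₁, hy₂] at hqx
        simp only [mink_add_right, mink_smul_right, qe₁, qe₂, hq, hqy] at hqx
        have : (α + β * c₁ + γ * c₂) * mink y q = 0 := by linear_combination hqx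
        exact (mul_eq_zero.1 this).resolve_right hτ
      refine ⟨δ, β, γ, ?_⟩
      rw [hd, hy₁, hy₂]
      linear_combination (norm := module) h0 • y
    obtain ⟨p₁, a, b, hd₁⟩ := hdec x₁ hx₁ hF.orth₁
    obtain ⟨p₂, c, d, hd₂⟩ := hdec x₂ hx₂ hF.orth₂
    have hdet := det_le_zero_of_sameOrientation hyV hmem hyy hq hyq ye₁ ye₂ qe₁ qe₂ hlen hpos horth
      hy₁ hy₂ hd₁ hd₂ hO
    have hl := hF.length
    have hp := hF.pos
    have ho := hF.orth
    rw [hd₁] at hp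
    rw [hd₁, hd₂] at hl ho
    simp only [mink_add_left, mink_add_right, mink_smul_left, mink_smul_right, qe₁, qe₂, hq,
      mink_comm e₁ q, mink_comm e₂ q, mink_comm e₂ e₁, horth, ← hlen, mul_zero, add_zero,
      zero_add] at hl ho hp
    have hl' : a * a + b * b = c * c + d * d :=
      mul_right_cancel₀ hpos.ne' (by linear_combination hl)
    have ho' : a * c + b * d = 0 :=
      (mul_eq_zero.1 (by linear_combination ho : (a * c + b * d) * mink e₁ e₁ = 0)).resolve_right
        hpos.ne'
    -- Modulo `q`, the frame is now a reflected and scaled copy of `(e₁, e₂)`. The two real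
    -- equations of co-touching form an invertible linear system for the two components of the
    -- trace-free part.
    obtain ⟨rfl, rfl⟩ := conformal_reflection hl' ho' hdet
    have hN : a * a + c * c ≠ 0 := by
      intro h0
      have : (a * a + c * c) * mink e₁ e₁ = 0 := by rw [h0, zero_mul]
      linarith
    obtain ⟨i1, i2⟩ := coTouchInvariant_eq_zero_iff.1 hI
    rw [hd₁, hd₂] at i1 i2
    simp only [mink_add_left, mink_smul_left, hq₁, hq₂, mul_zero, zero_add] at i1 i2
    constructor
    · refine mul_left_cancel₀ hN ?_
      linear_combination a * i1 + c * i2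
    · refine (mul_eq_zero.1 (?_ : (a * a + c * c) * _ = 0)).resolve_left hN
      linear_combination c * i1 - a * i2
  · rintro ⟨i1, i2⟩
    -- The sign of `-e₂` compensates the orientation reversal between the two points of the sphere.
    refine ⟨e₁, ?_, -e₂, ?_, ⟨hq, ?_, qe₁, ?_, ?_, hpos, ?_⟩, ?_, ?_⟩
    · rw [he₁]; exact sub_mem h1V (Submodule.smul_mem _ _ hyV)
    · rw [he₂]; exact neg_mem (sub_mem h2V (Submodule.smul_mem _ _ hyV))
    · rintro rfl
      exact hτ (mink_zero_right y)
    · rw [mink_neg_right, qe₂, neg_zero]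
    · rw [mink_neg_right, mink_neg_left, neg_neg, hlen]
    · rw [mink_neg_right, horth, neg_zero]
    · intro t ht t' ht' hyt hqt α
      obtain ⟨a, b, c, d, hd⟩ := h.exists_decomposition hτ hmem ht
      obtain ⟨a', b', c', d', hd'⟩ := h.exists_decomposition hτ hmem ht'
      have hdpos : 0 < d := by
        rw [hd] at hyt
        simp only [mink_add_right, mink_smul_right, hyy, h.orth₁, h.orth₂, mul_zero,
          zero_add] at hyt
        by_contra! hle
        nlinarith
      -- Only the coefficients of `t` along `q` and of `t'` along `y` survive in the 4-form. The
      -- time conditions make both positive, so the product is a positive multiple of a square.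
      have hd'2 : t' = d' • q + b' • e₁ + (-c') • (-e₂) + (a' + b' * c₁ + c' * c₂) • y := by
        rw [hd', hy₁, hy₂]
        module
      have hapos : 0 < a' + b' * c₁ + c' * c₂ := by
        rw [hd'2] at hqt
        simp only [mink_add_right, mink_smul_right, mink_neg_right, hq, qe₁, qe₂, hqy, mul_zero,
          neg_zero, zero_add] at hqt
        by_contra! hle
        nlinarith
      rw [hd, alternating_four_last, hd'2, alternating_four_last]
      have he : α ![q, e₁, -e₂, y] = α ![y, y₁, y₂, q] := by
        have := alternating_four_shift α q y₁ y₂ y (-c₁) (-c₂)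
        rw [← this, he₁, he₂]
        simp only [neg_smul, sub_eq_add_neg]
      rw [he]
      have : 0 ≤ (d * (a' + b' * c₁ + c' * c₂)) * (α ![y, y₁, y₂, q] * α ![y, y₁, y₂, q]) :=
        mul_nonneg (mul_pos hdpos hapos).le (mul_self_nonneg _)
      linarith
    · rw [coTouchInvariant_eq_zero_iff]
      simp only [mink_neg_left]
      constructor <;> linarith

end CoTouch

/-! ### Harmonic maps into the Grassmannian of Minkowski planes -/

section Harmonic

variable {n : ℕ} {U : Set ℂ} {y y' : ℂ → Mink n}

/-- Smooth light-like maps `y`, `y'` with `⟨y, y'⟩ = -1` on an open set. -/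
structure NullPair (U : Set ℂ) (y y' : ℂ → Mink n) : Prop where
  isOpen : IsOpen U
  smooth₁ : ContDiffOn ℝ ∞ y U
  smooth₂ : ContDiffOn ℝ ∞ y' U
  null₁ : ∀ z ∈ U, mink (y z) (y z) = 0
  null₂ : ∀ z ∈ U, mink (y' z) (y' z) = 0
  pairing : ∀ z ∈ U, mink (y z) (y' z) = -1

lemma NullPair.symm (h : NullPair U y y') : NullPair U y' y :=
  ⟨h.isOpen, h.smooth₂, h.smooth₁, h.null₂, h.null₁, fun z hz => by
    rw [mink_comm, h.pairing z hz]⟩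

/-- The map `G` from an open set of `ℂ` to the Grassmannian is critical for the energy. -/
def IsCriticalBivec (U : Set ℂ) (G : ℂ → Bivec n) : Prop :=
  ∀ K : Set ℂ, IsCompact K → K ⊆ U →
    ∀ y y' : ℝ → ℂ → Mink n,
      ContDiffOn ℝ ∞ (fun q : ℝ × ℂ => y q.1 q.2) (univ ×ˢ U) →
      ContDiffOn ℝ ∞ (fun q : ℝ × ℂ => y' q.1 q.2) (univ ×ˢ U) →
      (∀ t, ∀ z ∈ U, mink (y t z) (y t z) = 0 ∧ mink (y' t z) (y' t z) = 0 ∧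
        mink (y t z) (y' t z) = -1) →
      (∀ z ∈ U, wedge (y 0 z) (y' 0 z) = G z) →
      (∀ t, ∀ z ∈ U, z ∉ K → wedge (y t z) (y' t z) = G z) →
      HasDerivAt (fun t => ∫ z in K, energyDensity (fun w => wedge (y t w) (y' t w)) z) 0 0

lemma pd_neg {W : Type*} [NormedAddCommGroup W] [NormedSpace ℝ W] (F : ℂ → W) (i : Fin 2) :
    pd i (fun w => -F w) = fun w => -pd i F w := by
  funext z
  simp [pd]

lemma energyDensity_neg (G : ℂ → Bivec n) : energyDensity (fun w => -G w) = energyDensity G := by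
  funext z
  simp only [energyDensity, pd_neg, binner_neg_left, binner_neg_right, neg_neg]

lemma lap_neg {W : Type*} [NormedAddCommGroup W] [NormedSpace ℝ W] (F : ℂ → W) (z : ℂ) :
    lap (fun w => -F w) z = -lap F z := by
  simp only [lap, pd_neg]
  abel

/-- Exchanging `y` and `y'` turns the variations of `-G` into variations of `G`, and the energy
density does not see the sign. -/
lemma IsCriticalBivec.neg {G : ℂ → Bivec n} (h : IsCriticalBivec U G) :
    IsCriticalBivec U (fun z => -G z) := by
  intro K hK hKU y y' hy hy' h1 h2 h3
  have := h K hK hKU y' y hy' hy (fun t z hz => ⟨(h1 t z hz).2.1, (h1 t z hz).1, by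
    rw [mink_comm, (h1 t z hz).2.2]⟩) (fun z hz => by rw [wedge_swap, h2 z hz, neg_neg])
    (fun t z hz hzK => by rw [wedge_swap, h3 t z hz hzK, neg_neg])
  have he : ∀ t, energyDensity (fun w => wedge (y' t w) (y t w))
      = energyDensity (fun w => wedge (y t w) (y' t w)) := fun t => by
    rw [← energyDensity_neg]
    simp only [← wedge_swap]
  simpa only [he] using this

lemma IsCriticalBivec.congr {G G' : ℂ → Bivec n} (h : IsCriticalBivec U G) (he : EqOn G' G U) :
    IsCriticalBivec U G' := fun K hK hKU y y' hy hy' h1 h2 h3 =>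
  h K hK hKU y y' hy hy' h1 (fun z hz => by rw [h2 z hz, he hz])
    fun t z hz hzK => by rw [h3 t z hz hzK, he hz]

lemma NullPair.contDiffOn_wedge (h : NullPair U y y') :
    ContDiffOn ℝ ∞ (fun z => wedge (y z) (y' z)) U :=
  MoebiusSurface.contDiffOn_wedge h.smooth₁ h.smooth₂

/-- Pairing with `y ∧ ζ` removes every term of `Δ(y ∧ y')` except `Δy ∧ y'` and the mixed terms `y_j
∧ y'_j`. In the latter, differentiating `⟨y, y'⟩ = -1` replaces `⟨y, y'_j⟩` by `-⟨y_j, y'⟩`, so that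
only first derivatives of `y` remain. -/
lemma NullPair.binner_lap_wedge (h : NullPair U y y') {z : ℂ} (hz : z ∈ U) {ζ : Mink n}
    (h1 : mink (y z) ζ = 0) (h2 : mink (y' z) ζ = 0) :
    binner (lap (fun w => wedge (y w) (y' w)) z) (wedge (y z) ζ)
      = mink (lap y z) ζ + 2 * (mink (pd 0 y z) (y' z) * mink (pd 0 y z) ζ
        + mink (pd 1 y z) (y' z) * mink (pd 1 y z) ζ) := by
  have hU := h.isOpen
  have hd : ∀ {F : ℂ → Mink n}, ContDiffOn ℝ ∞ F U → ∀ {w}, w ∈ U → DifferentiableAt ℝ F w :=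
    fun hF _ hw => differentiableAt_of_contDiffOn hU hF hw
  have hpp : ∀ j, pd j (pd j (fun w => wedge (y w) (y' w))) z
      = wedge (pd j (pd j y) z) (y' z) + wedge (pd j y z) (pd j y' z)
        + (wedge (pd j y z) (pd j y' z) + wedge (y z) (pd j (pd j y') z)) := by
    intro j
    have s1 := contDiffOn_pd hU h.smooth₁ j
    have s2 := contDiffOn_pd hU h.smooth₂ j
    rw [pd_congr hU (fun w hw => pd_wedge (hd h.smooth₁ hw) (hd h.smooth₂ hw) j) j hz,
      pd_add (differentiableAt_wedge (hd s1 hz) (hd h.smooth₂ hz))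
        (differentiableAt_wedge (hd h.smooth₁ hz) (hd s2 hz)),
      pd_wedge (hd s1 hz) (hd h.smooth₂ hz), pd_wedge (hd h.smooth₁ hz) (hd s2 hz)]
  have hs : ∀ j, mink (pd j y z) (y' z) + mink (y z) (pd j y' z) = 0 := fun j =>
    mink_pd_of_const hU h.smooth₁ h.smooth₂ h.pairing hz j
  have hn : ∀ j, mink (pd j y z) (y z) = 0 := fun j => by
    rw [mink_comm, mink_pd_of_null hU h.smooth₁ h.null₁ hz]
  rw [lap, hpp, hpp, lap, mink_add_left]
  simp only [binner_add_left, binner_wedge, hn, h1, h2, h.null₁ z hz]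
  rw [mink_comm (y' z) (y z), h.pairing z hz, mink_comm (pd 0 y' z) (y z),
    mink_comm (pd 1 y' z) (y z)]
  linear_combination (-2 * mink (pd 0 y z) ζ) * hs 0 + (-2 * mink (pd 1 y z) ζ) * hs 1

/-- A null basis of a Minkowski plane with given bivector is unique up to scaling. -/
lemma eq_smul_of_wedge_eq {a a' b b' : Mink n} (ha : mink a a = 0)
    (haa : mink a a' = -1) (hb : mink b b = 0) (hbb : mink b b' = -1)
    (h : wedge b b' = wedge a a') : b = (-mink a' b) • a := by
  -- Equal bivectors have equal contractions. Contracting with `b` expresses `b` through `a` and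
  -- `a'`, and pairing the result with `a` rules out the component along `a'`.
  have hc : ∀ v, mink b' v • b - mink b v • b' = mink a' v • a - mink a v • a' := fun v => by
    rw [← sum_wedge_mul, ← sum_wedge_mul, h]
  have h1 := hc b
  rw [hb, mink_comm b' b, hbb] at h1
  have h0 : mink a b = 0 := by
    have := congrArg (mink a) h1
    rw [mink_sub_right, mink_sub_right, mink_smul_right, mink_smul_right, mink_smul_right,
      mink_smul_right, ha, haa] at this
    linarith
  rw [h0] at h1
  linear_combination (norm := module) (-1 : ℝ) • h1

/-- A bivector orthogonal to the tangent space at `a ∧ a'` of the Grassmannian. -/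
lemma binner_tangent_eq_zero {a a' b b' v v' : Mink n} {A : Bivec n} (ha : mink a a = 0)
    (ha' : mink a' a' = 0) (haa : mink a a' = -1) (hb : mink b b = 0) (hb' : mink b' b' = 0)
    (hbb : mink b b' = -1) (h : wedge b b' = wedge a a') (hv : mink b v = 0) (hv' : mink b' v' = 0)
    (hvv : mink v b' + mink b v' = 0)
    (hA : ∀ ζ, mink a ζ = 0 → mink a' ζ = 0 →
      binner A (wedge a ζ) = 0 ∧ binner A (wedge a' ζ) = 0) :
    binner A (wedge v b' + wedge b v') = 0 := by
  obtain ⟨c, hc⟩ : ∃ c : ℝ, b = c • a := ⟨_, eq_smul_of_wedge_eq ha haa hb hbb h⟩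
  obtain ⟨c', hc'⟩ : ∃ c : ℝ, b' = c • a' := ⟨_, eq_smul_of_wedge_eq ha'
    (by rw [mink_comm, haa]) hb' (by rw [mink_comm, hbb]) (by rw [wedge_swap, h, ← wedge_swap])⟩
  have hcc : c * c' = 1 := by
    rw [hc, hc', mink_smul_left, mink_smul_right, haa] at hbb
    linarith
  have hc0 : c ≠ 0 := left_ne_zero_of_mul_eq_one hcc
  have hc0' : c' ≠ 0 := right_ne_zero_of_mul_eq_one hcc
  rw [hc, mink_smul_left] at hv hvv
  rw [hc', mink_smul_left] at hv'
  rw [hc', mink_smul_right] at hvv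
  have hav := (mul_eq_zero.1 hv).resolve_left hc0
  have hav' := (mul_eq_zero.1 hv').resolve_left hc0'
  have haa' : mink a' a = -1 := by rw [mink_comm, haa]
  have hv1 : v = (v + mink v a' • a) - mink v a' • a := by abel
  have hv2 : v' = (v' + mink a v' • a') - mink a v' • a' := by abel
  obtain ⟨-, z1⟩ := hA (v + mink v a' • a)
    (by rw [mink_add_right, mink_smul_right, ha, hav]; ring)
    (by rw [mink_add_right, mink_smul_right, haa', mink_comm a' v]; ring)
  obtain ⟨z2, -⟩ := hA (v' + mink a v' • a')
    (by rw [mink_add_right, mink_smul_right, haa]; ring)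
    (by rw [mink_add_right, mink_smul_right, ha', hav']; ring)
  -- A derivative of a bivector in the Grassmannian has components `a' ∧ ζ`, `a ∧ ζ'` and a multiple
  -- of `a ∧ a'`; the last coefficient vanishes by the linearized normalization `hvv`.
  have hdec : wedge v b' + wedge b v' = (-c') • wedge a' (v + mink v a' • a)
      + c • wedge a (v' + mink a v' • a')
      + (-(c' * mink v a' + c * mink a v')) • wedge a a' := by
    rw [hc, hc']
    simp only [wedge_add_right, wedge_smul_right, wedge_smul_left, wedge_swap v a', wedge_swap a a']
    module
  rw [hdec, hvv]
  simp only [binner_add_right, binner_smul_right, z1, z2]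
  ring

/-- By the first variation formula it suffices that `ΔH` is orthogonal to the variation field, which
is tangent to the Grassmannian: differentiating the three normalizations of the varied null pair
gives exactly the conditions of `binner_tangent_eq_zero`. The varied pair may differ from `(y, y')`
by a scaling even at time 0. -/
lemma NullPair.isCritical_of_lap (h : NullPair U y y')
    (hE : ∀ z ∈ U, ∀ ζ, mink (y z) ζ = 0 → mink (y' z) ζ = 0 →
      binner (lap (fun w => wedge (y w) (y' w)) z) (wedge (y z) ζ) = 0 ∧
      binner (lap (fun w => wedge (y w) (y' w)) z) (wedge (y' z) ζ) = 0) :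
    IsCriticalBivec U (fun z => wedge (y z) (y' z)) := by
  intro K hK hKU x x' hx hx' h1 h2 h3
  have hU := h.isOpen
  have hO := isOpen_univ.prod hU (X := ℝ)
  refine (hasDerivAt_energy isOpen_univ (mem_univ 0) hU hK hKU
    (G := fun t w => wedge (x t w) (x' t w)) (MoebiusSurface.contDiffOn_wedge hx hx')
    (fun t _ z hz hzK => (h3 t z hz hzK).trans (h2 z hz).symm)).congr_deriv ?_
  rw [mul_eq_zero]
  right
  refine setIntegral_eq_zero_of_forall_eq_zero fun z hzK => ?_
  have hz := hKU hzK
  have d1 := hasDerivAt_time (Q := fun q : ℝ × ℂ => x q.1 q.2) (t := 0) (z := z)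
    (differentiableAt_of_contDiffOn hO hx ⟨mem_univ _, hz⟩)
  have d2 := hasDerivAt_time (Q := fun q : ℝ × ℂ => x' q.1 q.2) (t := 0) (z := z)
    (differentiableAt_of_contDiffOn hO hx' ⟨mem_univ _, hz⟩)
  rw [lap_congr hU h2 hz, (hasDerivAt_wedge d1 d2).deriv]
  have hz0 := h1 0 z hz
  have c1 := (hasDerivAt_mink d1 d1).unique
    ((hasDerivAt_const (0 : ℝ) (0 : ℝ)).congr_of_eventuallyEq
      (Filter.Eventually.of_forall fun t => (h1 t z hz).1))
  have c2 := (hasDerivAt_mink d2 d2).unique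
    ((hasDerivAt_const (0 : ℝ) (0 : ℝ)).congr_of_eventuallyEq
      (Filter.Eventually.of_forall fun t => (h1 t z hz).2.1))
  have c3 := (hasDerivAt_mink d1 d2).unique
    ((hasDerivAt_const (0 : ℝ) (-1 : ℝ)).congr_of_eventuallyEq
      (Filter.Eventually.of_forall fun t => (h1 t z hz).2.2))
  rw [mink_comm _ (x 0 z)] at c1
  rw [mink_comm _ (x' 0 z)] at c2
  exact binner_tangent_eq_zero (h.null₁ z hz) (h.null₂ z hz) (h.pairing z hz) hz0.1 hz0.2.1 hz0.2.2
    (h2 z hz) (by linarith) (by linarith) c3 (hE z hz)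

/-- The fundamental lemma of the calculus of variations, applied to variations that keep `y` and
move only `y'`. They realize `φ • (y ∧ N)` for every bump function `φ`, and continuity upgrades the
almost everywhere equation to the point `z`. -/
lemma NullPair.lap_of_isCritical (h : NullPair U y y')
    (hc : IsCriticalBivec U (fun z => wedge (y z) (y' z))) {z : ℂ} (hz : z ∈ U) {ζ : Mink n}
    (h1 : mink (y z) ζ = 0) (h2 : mink (y' z) ζ = 0) :
    binner (lap (fun w => wedge (y w) (y' w)) z) (wedge (y z) ζ) = 0 := by
  have hU := h.isOpen
  -- The constant vector `ζ` is projected orthogonally to `y` and `y'` at each point; at the given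
  -- `z` the projection changes nothing.
  set N : ℂ → Mink n := fun z => ζ + mink (y' z) ζ • y z + mink (y z) ζ • y' z with hN
  have hNs : ContDiffOn ℝ ∞ N U :=
    (contDiffOn_const.add ((contDiffOn_mink h.smooth₂ contDiffOn_const).smul h.smooth₁)).add
      ((contDiffOn_mink h.smooth₁ contDiffOn_const).smul h.smooth₂)
  have hN1 : ∀ w ∈ U, mink (y w) (N w) = 0 := fun w hw => by
    simp only [hN, mink_add_right, mink_smul_right, h.null₁ w hw, h.pairing w hw]
    ring
  have hN2 : ∀ w ∈ U, mink (y' w) (N w) = 0 := fun w hw => by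
    simp only [hN, mink_add_right, mink_smul_right, h.null₂ w hw, h.symm.pairing w hw]
    ring
  set L : ℂ → Bivec n := lap (fun w => wedge (y w) (y' w)) with hL
  have hLs : ContDiffOn ℝ ∞ L U :=
    (contDiffOn_pd hU (contDiffOn_pd hU h.contDiffOn_wedge 0) 0).add
      (contDiffOn_pd hU (contDiffOn_pd hU h.contDiffOn_wedge 1) 1)
  have hgs : ContDiffOn ℝ ∞ (fun w => binner (L w) (wedge (y w) (N w))) U :=
    contDiffOn_binner hLs (MoebiusSurface.contDiffOn_wedge h.smooth₁ hNs)
  have hae : ∀ᵐ w, w ∈ U → binner (L w) (wedge (y w) (N w)) = 0 := by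
    refine hU.ae_eq_zero_of_integral_contDiff_smul_eq_zero
      (hgs.continuousOn.locallyIntegrableOn hU.measurableSet) fun φ hφ hφc hφU => ?_
    have hφ1 : ContDiffOn ℝ ∞ (fun q : ℝ × ℂ => φ q.2) (univ ×ˢ U) :=
      (hφ.comp contDiff_snd).contDiffOn
    have hsnd : MapsTo (Prod.snd : ℝ × ℂ → ℂ) (univ ×ˢ U) U := fun q hq => hq.2
    have sy := h.smooth₁.comp contDiff_snd.contDiffOn hsnd
    have sy' := h.smooth₂.comp contDiff_snd.contDiffOn hsnd
    have sN := hNs.comp contDiff_snd.contDiffOn hsnd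
    have st : ContDiffOn ℝ ∞ (fun q : ℝ × ℂ => q.1) (univ ×ˢ U) := contDiff_fst.contDiffOn
    -- A null rotation fixing `y`: the quadratic term restores the null condition for `y' + tφN`,
    -- and being a multiple of `y` it disappears from the bivector, which is thus affine in `t`.
    set x' : ℝ → ℂ → Mink n := fun t w => y' w + (t * φ w) • N w
      + ((t * φ w) ^ 2 / 2 * mink (N w) (N w)) • y w with hx'
    have hx's : ContDiffOn ℝ ∞ (fun q : ℝ × ℂ => x' q.1 q.2) (univ ×ˢ U) :=
      (sy'.add ((st.mul hφ1).smul sN)).add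
        (((((st.mul hφ1).pow 2).div_const 2).mul (contDiffOn_mink sN sN)).smul sy)
    have hw : ∀ t w, wedge (y w) (x' t w)
        = wedge (y w) (y' w) + (t * φ w) • wedge (y w) (N w) := fun t w => by
      simp only [hx', wedge_add_right, wedge_smul_right, wedge_self, smul_zero, add_zero]
    have hφ0 : ∀ w, w ∉ tsupport φ → φ w = 0 := fun w hw => image_eq_zero_of_notMem_tsupport hw
    have hw0 : ∀ w, wedge (y w) (x' 0 w) = wedge (y w) (y' w) := fun w => by simp [hw]
    have hwK : ∀ t, ∀ w, w ∉ tsupport φ → wedge (y w) (x' t w) = wedge (y w) (y' w) :=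
      fun t w hwK => by simp [hw, hφ0 w hwK]
    have hcrit := hc (tsupport φ) hφc hφU (fun _ => y) x' sy hx's (fun t w hw => by
        refine ⟨h.null₁ w hw, ?_, ?_⟩
        · simp only [hx', mink_add_right, mink_add_left, mink_smul_right, mink_smul_left,
            h.null₁ w hw, h.null₂ w hw, hN1 w hw, hN2 w hw, mink_comm (N w) (y w),
            mink_comm (N w) (y' w), h.pairing w hw, h.symm.pairing w hw]
          ring
        · simp only [hx', mink_add_right, mink_smul_right,
            h.null₁ w hw, hN1 w hw, h.pairing w hw]
          ring) (fun w _ => hw0 w) (fun t w _ hwK' => hwK t w hwK')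
    have hE := hasDerivAt_energy isOpen_univ (mem_univ 0) hU hφc hφU
      (G := fun t w => wedge (y w) (x' t w)) (MoebiusSurface.contDiffOn_wedge sy hx's)
      (fun t _ w _ hwK' => (hwK t w hwK').trans (hw0 w).symm)
    have h0 := hE.unique hcrit
    have hder : ∀ w, deriv (fun t => wedge (y w) (x' t w)) 0 = φ w • wedge (y w) (N w) := by
      intro w
      simp only [hw]
      have := (((hasDerivAt_id (0 : ℝ)).mul_const (φ w)).smul_const
        (wedge (y w) (N w))).const_add (wedge (y w) (y' w))
      simpa using this.deriv
    have hL0 : lap (fun w => wedge (y w) (x' 0 w)) = L := by simp only [hw0, hL]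
    simp only [hder, hL0, binner_smul_right] at h0
    rw [← setIntegral_eq_integral_of_forall_compl_eq_zero (s := tsupport φ)
      fun w hw => by rw [hφ0 w hw, zero_smul]]
    simpa using h0
  have hcont := Measure.eqOn_open_of_ae_eq (μ := (volume : Measure ℂ))
    ((ae_restrict_iff' hU.measurableSet).2 hae) hU hgs.continuousOn continuousOn_const
  have hz0 := hcont hz
  have hNz : N z = ζ := by simp [hN, h1, h2]
  simpa only [hNz] using hz0

/-- The Euler-Lagrange equation of the energy. -/
lemma NullPair.isCritical_iff (h : NullPair U y y') :
    IsCriticalBivec U (fun z => wedge (y z) (y' z)) ↔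
      ∀ z ∈ U, ∀ ζ, mink (y z) ζ = 0 → mink (y' z) ζ = 0 →
      binner (lap (fun w => wedge (y w) (y' w)) z) (wedge (y z) ζ) = 0 ∧
      binner (lap (fun w => wedge (y w) (y' w)) z) (wedge (y' z) ζ) = 0 := by
  refine ⟨fun hc z hz ζ h1 h2 => ⟨h.lap_of_isCritical hc hz h1 h2, ?_⟩, h.isCritical_of_lap⟩
  have hc' : IsCriticalBivec U (fun z => wedge (y' z) (y z)) :=
    hc.neg.congr fun z _ => wedge_swap _ _
  have := h.symm.lap_of_isCritical hc' hz h2 h1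
  rw [show (fun w => wedge (y' w) (y w)) = fun w => -wedge (y w) (y' w) from
    funext fun w => wedge_swap _ _, lap_neg, binner_neg_left] at this
  linarith

end Harmonic

/-! ### Pairs of surfaces in the sphere -/

section SurfacePairs

variable {n : ℕ} {U : Set ℂ} {F G : ℂ → Euc n}

/-- A pair of smooth maps from an open set of `ℂ` into the sphere, different at every point. -/
structure SpherePair (U : Set ℂ) (F G : ℂ → Euc n) : Prop where
  isOpen : IsOpen U
  smooth₁ : ContDiffOn ℝ ∞ F U
  smooth₂ : ContDiffOn ℝ ∞ G U
  unit₁ : ∀ z ∈ U, inner ℝ (F z) (F z) = 1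
  unit₂ : ∀ z ∈ U, inner ℝ (G z) (G z) = 1
  pos : ∀ z ∈ U, 0 < 1 - inner ℝ (F z) (G z)

/-- `F` is a conformal immersion. -/
def IsConformalImmersion (U : Set ℂ) (F : ℂ → Euc n) : Prop :=
  ∀ z ∈ U, inner ℝ (pd 0 F z) (pd 0 F z) = inner ℝ (pd 1 F z) (pd 1 F z) ∧
    inner ℝ (pd 0 F z) (pd 1 F z) = 0 ∧ 0 < inner ℝ (pd 0 F z) (pd 0 F z)

/-- The Minkowski plane spanned by two different points of the sphere. -/
noncomputable def pointPair (a b : Euc n) : Bivec n :=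
  (1 - inner ℝ a b)⁻¹ • wedge (minkCons 1 a) (minkCons 1 b)

lemma pointPair_swap (a b : Euc n) : pointPair b a = - pointPair a b := by
  rw [pointPair, pointPair, wedge_swap, real_inner_comm, smul_neg]

lemma pointPair_eq_wedge (a b : Euc n) :
    pointPair a b = wedge (minkCons 1 a) ((1 - inner ℝ a b)⁻¹ • minkCons 1 b) := by
  rw [pointPair, wedge_smul_right]

/-- The span of the second order jet of the lift of `F`. -/
def jetSpan (F : ℂ → Euc n) (z : ℂ) : Submodule ℝ (Mink n) :=
  Submodule.span ℝ {minkCons 1 (F z), pd 0 (fun w => minkCons 1 (F w)) z,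
    pd 1 (fun w => minkCons 1 (F w)) z, lap (fun w => minkCons 1 (F w)) z}

lemma SpherePair.symm (h : SpherePair U F G) : SpherePair U G F :=
  ⟨h.isOpen, h.smooth₂, h.smooth₁, h.unit₂, h.unit₁, fun z hz => by
    rw [real_inner_comm]; exact h.pos z hz⟩

lemma differentiableAt_minkCons_one {V : Type*} [NormedAddCommGroup V] [NormedSpace ℝ V]
    {F : V → Euc n} {z : V} (hF : DifferentiableAt ℝ F z) :
    DifferentiableAt ℝ (fun w => minkCons 1 (F w)) z := by
  refine (((minkIncl n).differentiableAt.comp z hF).const_add (minkCons 1 0)).congr_of_eventuallyEq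
    (Filter.Eventually.of_forall fun w => minkCons_one_eq (F w))

lemma pd_inv {g : ℂ → ℝ} {z : ℂ} (hg : DifferentiableAt ℝ g z) (h0 : g z ≠ 0) (i : Fin 2) :
    pd i (fun w => (g w)⁻¹) z = - pd i g z / g z ^ 2 := by
  refine pd_eq_of_hasDerivAt (hg.fun_inv h0) ?_
  have := (hasDerivAt_line hg i).fun_inv (by simpa using h0)
  simpa using this

lemma SpherePair.nullPair (h : SpherePair U F G) :
    NullPair U (fun z => minkCons 1 (F z))
      (fun z => (1 - inner ℝ (F z) (G z))⁻¹ • minkCons 1 (G z)) where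
  isOpen := h.isOpen
  smooth₁ := contDiffOn_minkCons_one h.smooth₁
  smooth₂ := ((contDiffOn_const.sub (h.smooth₁.inner ℝ h.smooth₂)).inv
    fun z hz => (h.pos z hz).ne').smul (contDiffOn_minkCons_one h.smooth₂)
  null₁ z hz := by rw [mink_minkCons, h.unit₁ z hz]; ring
  null₂ z hz := by
    rw [mink_smul_left, mink_smul_right, mink_minkCons, h.unit₂ z hz]; ring
  pairing z hz := by
    have := (h.pos z hz).ne'
    rw [mink_smul_right, mink_minkCons]
    field_simp
    ring

lemma SpherePair.pd_pointPair (h : SpherePair U F G) {z : ℂ} (hz : z ∈ U) (i : Fin 2) :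
    pd i (fun w => pointPair (F w) (G w)) z
      = (1 - inner ℝ (F z) (G z))⁻¹ • (wedge (minkCons 0 (pd i F z)) (minkCons 1 (G z))
          + wedge (minkCons 1 (F z)) (minkCons 0 (pd i G z)))
        + ((inner ℝ (pd i F z) (G z) + inner ℝ (F z) (pd i G z)) / (1 - inner ℝ (F z) (G z)) ^ 2) •
          wedge (minkCons 1 (F z)) (minkCons 1 (G z)) := by
  have dF := differentiableAt_of_contDiffOn h.isOpen h.smooth₁ hz
  have dG := differentiableAt_of_contDiffOn h.isOpen h.smooth₂ hz
  have ds : DifferentiableAt ℝ (fun w => 1 - inner ℝ (F w) (G w)) z :=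
    (dF.inner ℝ dG).const_sub 1
  have hs := (h.pos z hz).ne'
  unfold pointPair
  rw [pd_smul (ds.fun_inv hs) (differentiableAt_wedge (differentiableAt_minkCons_one dF)
    (differentiableAt_minkCons_one dG)), pd_wedge (differentiableAt_minkCons_one dF)
    (differentiableAt_minkCons_one dG), pd_inv ds hs, pd_sub (differentiableAt_const _)
    (dF.inner ℝ dG), pd_const, pd_inner dF dG, pd_minkCons 1 dF, pd_minkCons 1 dG]
  congr 2
  ring

lemma binner_pointPair_derivative {f g f₁ g₁ f₂ g₂ : Euc n} (hf : inner ℝ f f = 1)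
    (hg : inner ℝ g g = 1) (hs : 1 - inner ℝ f g ≠ 0) (hf₁ : inner ℝ f f₁ = 0)
    (hg₁ : inner ℝ g g₁ = 0) (hf₂ : inner ℝ f f₂ = 0) (hg₂ : inner ℝ g g₂ = 0) :
    binner ((1 - inner ℝ f g)⁻¹ • (wedge (minkCons 0 f₁) (minkCons 1 g)
          + wedge (minkCons 1 f) (minkCons 0 g₁))
        + ((inner ℝ f₁ g + inner ℝ f g₁) / (1 - inner ℝ f g) ^ 2) •
          wedge (minkCons 1 f) (minkCons 1 g))
      ((1 - inner ℝ f g)⁻¹ • (wedge (minkCons 0 f₂) (minkCons 1 g)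
          + wedge (minkCons 1 f) (minkCons 0 g₂))
        + ((inner ℝ f₂ g + inner ℝ f g₂) / (1 - inner ℝ f g) ^ 2) •
          wedge (minkCons 1 f) (minkCons 1 g))
      = ((1 - inner ℝ f g) * (inner ℝ f₁ g₂ + inner ℝ f₂ g₁)
          + inner ℝ f₁ g * inner ℝ f g₂ + inner ℝ f₂ g * inner ℝ f g₁)
        / (1 - inner ℝ f g) ^ 2 := by
  have c0 : inner ℝ g f = inner ℝ f g := real_inner_comm _ _
  have c2 : inner ℝ g f₂ = inner ℝ f₂ g := real_inner_comm _ _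
  have c3 : inner ℝ g₁ f₂ = inner ℝ f₂ g₁ := real_inner_comm _ _
  have c4 : inner ℝ g₁ f = inner ℝ f g₁ := real_inner_comm _ _
  have d1 : inner ℝ f₁ f = 0 := by rw [real_inner_comm, hf₁]
  have d2 : inner ℝ g₁ g = 0 := by rw [real_inner_comm, hg₁]
  simp only [binner_add_left, binner_add_right, binner_smul_left, binner_smul_right, binner_wedge,
    mink_minkCons, hf, hg, hf₂, hg₂, c0, c2, c3, c4, d1, d2]
  field_simp
  ring

lemma SpherePair.inner_pd (h : SpherePair U F G) {z : ℂ} (hz : z ∈ U) (i : Fin 2) :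
    inner ℝ (F z) (pd i F z) = 0 := by
  have dF := differentiableAt_of_contDiffOn h.isOpen h.smooth₁ hz
  have := pd_inner dF dF i
  rw [pd_congr h.isOpen h.unit₁ i hz, pd_const, real_inner_comm (F z)] at this
  linarith

/-- The metric induced by the map into the Grassmannian. -/
lemma SpherePair.binner_pd (h : SpherePair U F G) {z : ℂ} (hz : z ∈ U) (i j : Fin 2) :
    binner (pd i (fun w => pointPair (F w) (G w)) z) (pd j (fun w => pointPair (F w) (G w)) z)
      = ((1 - inner ℝ (F z) (G z)) *
          (inner ℝ (pd i F z) (pd j G z) + inner ℝ (pd j F z) (pd i G z))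
          + inner ℝ (pd i F z) (G z) * inner ℝ (F z) (pd j G z)
          + inner ℝ (pd j F z) (G z) * inner ℝ (F z) (pd i G z))
        / (1 - inner ℝ (F z) (G z)) ^ 2 := by
  rw [h.pd_pointPair hz, h.pd_pointPair hz]
  exact binner_pointPair_derivative (h.unit₁ z hz) (h.unit₂ z hz) (h.pos z hz).ne'
    (h.inner_pd hz i) (h.symm.inner_pd hz i) (h.inner_pd hz j) (h.symm.inner_pd hz j)

/-- The link between the two notions of conformality: the metric of the map into the Grassmannian is
the symmetrized mixed form that governs co-touching, up to the factor `1 - ⟨F, G⟩ = -⟨y, q⟩` of the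
standard lifts. -/
lemma SpherePair.binner_pd_eq_mixedForm (h : SpherePair U F G) {z : ℂ} (hz : z ∈ U)
    (i j : Fin 2) :
    (1 - inner ℝ (F z) (G z)) *
      binner (pd i (fun w => pointPair (F w) (G w)) z) (pd j (fun w => pointPair (F w) (G w)) z)
      = mixedForm (minkCons 1 (F z)) (minkCons 1 (G z)) (pd i (fun w => minkCons 1 (F w)) z)
          (pd j (fun w => minkCons 1 (G w)) z)
        + mixedForm (minkCons 1 (F z)) (minkCons 1 (G z)) (pd j (fun w => minkCons 1 (F w)) z)
          (pd i (fun w => minkCons 1 (G w)) z) := by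
  have dF := differentiableAt_of_contDiffOn h.isOpen h.smooth₁ hz
  have dG := differentiableAt_of_contDiffOn h.isOpen h.smooth₂ hz
  have hs := (h.pos z hz).ne'
  have hs' : inner ℝ (F z) (G z) - 1 * 1 ≠ 0 := fun h0 => hs (by linarith)
  rw [h.binner_pd hz]
  simp only [mixedForm, mink_minkCons, pd_minkCons 1 dF, pd_minkCons 1 dG]
  have e : inner ℝ (F z) (G z) - 1 * 1 = -(1 - inner ℝ (F z) (G z)) := by ring
  rw [e]
  generalize 1 - inner ℝ (F z) (G z) = s at hs
  field_simp
  ring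

lemma SpherePair.conformalJet (h : SpherePair U F G) (hF : IsConformalImmersion U F) {z : ℂ}
    (hz : z ∈ U) :
    ConformalJet (minkCons 1 (F z)) (pd 0 (fun w => minkCons 1 (F w)) z)
      (pd 1 (fun w => minkCons 1 (F w)) z) (lap (fun w => minkCons 1 (F w)) z) := by
  have hU := h.isOpen
  have hp := h.nullPair
  have hpd : ∀ w ∈ U, ∀ i, pd i (fun w => minkCons 1 (F w)) w = minkCons 0 (pd i F w) :=
    fun w hw i => pd_minkCons 1 (differentiableAt_of_contDiffOn hU h.smooth₁ hw) i
  have hm : ∀ w ∈ U, ∀ i j, mink (pd i (fun w => minkCons 1 (F w)) w)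
      (pd j (fun w => minkCons 1 (F w)) w) = inner ℝ (pd i F w) (pd j F w) := fun w hw i j => by
    rw [hpd w hw, hpd w hw, mink_minkCons]; ring
  have hc : ∀ w ∈ U, mink (pd 0 (fun w => minkCons 1 (F w)) w) (pd 0 (fun w => minkCons 1 (F w)) w)
        = mink (pd 1 (fun w => minkCons 1 (F w)) w) (pd 1 (fun w => minkCons 1 (F w)) w) ∧
      mink (pd 0 (fun w => minkCons 1 (F w)) w) (pd 1 (fun w => minkCons 1 (F w)) w) = 0 :=
    fun w hw => by
      rw [hm w hw, hm w hw, hm w hw]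
      exact ⟨(hF w hw).1, (hF w hw).2.1⟩
  exact
    { null := hp.null₁ z hz
      orth₁ := mink_pd_of_null hU hp.smooth₁ hp.null₁ hz 0
      orth₂ := mink_pd_of_null hU hp.smooth₁ hp.null₁ hz 1
      length := (hc z hz).1
      pos := by rw [hm z hz]; exact (hF z hz).2.2
      orth := (hc z hz).2
      lap := by
        rw [mink_lap_of_null hU hp.smooth₁ hp.null₁ hz, ← (hc z hz).1]; ring
      lap₁ := mink_lap_pd_of_conformal hU hp.smooth₁ hc hz 0
      lap₂ := mink_lap_pd_of_conformal hU hp.smooth₁ hc hz 1 }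

/-- Membership in the mean curvature sphere is insensitive to scaling, so `G` may be lifted with
pairing -1. Then `ConformalJet.mem_span_iff` gives precisely the component of the Laplacian computed
in `NullPair.binner_lap_wedge`. -/
lemma SpherePair.mem_jetSpan_iff (h : SpherePair U F G) (hF : IsConformalImmersion U F) {z : ℂ}
    (hz : z ∈ U) :
    minkCons 1 (G z) ∈ jetSpan F z ↔
      ∀ ζ, mink (minkCons 1 (F z)) ζ = 0 → mink (minkCons 1 (G z)) ζ = 0 →
        binner (lap (fun w => pointPair (F w) (G w)) z) (wedge (minkCons 1 (F z)) ζ) = 0 := by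
  have hp := h.nullPair
  have hs := inv_ne_zero (h.pos z hz).ne'
  rw [← Submodule.smul_mem_iff _ hs, jetSpan,
    (h.conformalJet hF hz).mem_span_iff (hp.null₂ z hz) (hp.pairing z hz)]
  refine forall_congr' fun ζ => forall_congr' fun h1 => ?_
  have he : mink ((1 - inner ℝ (F z) (G z))⁻¹ • minkCons 1 (G z)) ζ = 0 ↔
      mink (minkCons 1 (G z)) ζ = 0 := by
    rw [mink_smul_left, mul_eq_zero, or_iff_right hs]
  rw [he]
  refine forall_congr' fun h2 => ?_
  rw [← hp.binner_lap_wedge hz h1 (he.2 h2)]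
  simp only [pointPair_eq_wedge]

/-- Harmonicity means that each surface lies on the mean curvature sphere of the other one. -/
lemma SpherePair.isCritical_iff (h : SpherePair U F G) (hF : IsConformalImmersion U F)
    (hG : IsConformalImmersion U G) :
    IsCriticalBivec U (fun w => pointPair (F w) (G w)) ↔
      ∀ z ∈ U, minkCons 1 (G z) ∈ jetSpan F z ∧ minkCons 1 (F z) ∈ jetSpan G z := by
  have hp := h.nullPair
  have hw : (fun w => pointPair (F w) (G w)) = _ := funext fun w => pointPair_eq_wedge (F w) (G w)
  rw [hw, hp.isCritical_iff, ← hw]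
  have hl : ∀ z, lap (fun w => pointPair (G w) (F w)) z
      = - lap (fun w => pointPair (F w) (G w)) z := fun z => by
    rw [show (fun w => pointPair (G w) (F w)) = fun w => -pointPair (F w) (G w) from
      funext fun w => pointPair_swap _ _, lap_neg]
  refine forall_congr' fun z => forall_congr' fun hz => ?_
  have hs := inv_ne_zero (h.pos z hz).ne'
  rw [h.mem_jetSpan_iff hF hz, h.symm.mem_jetSpan_iff hG hz]
  simp only [hl, binner_neg_left, neg_eq_zero, mink_smul_left, wedge_smul_left, binner_smul_right,
    mul_eq_zero, hs, false_or]
  -- The two families of tangent directions correspond to the two surfaces: `y ∧ ζ` tests whether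
  -- `G` is on the sphere of `F`, and `y' ∧ ζ` whether `F` is on the sphere of `G`.
  exact ⟨fun H => ⟨fun ζ h1 h2 => (H ζ h1 h2).1, fun ζ h1 h2 => (H ζ h2 h1).2⟩,
    fun H ζ h1 h2 => ⟨H.1 ζ h1 h2, H.2 ζ h2 h1⟩⟩

/-- Co-touching of the mean curvature sphere is the conformality of the map into the
Grassmannian. -/
lemma SpherePair.coTouch_iff (h : SpherePair U F G) (hF : IsConformalImmersion U F) {z : ℂ}
    (hz : z ∈ U) (hmem : minkCons 1 (G z) ∈ jetSpan F z) :
    (∃ x₁ ∈ jetSpan F z, ∃ x₂ ∈ jetSpan F z,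
      IsContactFrame (minkCons 1 (G z)) x₁ x₂ ∧
      SameOrientation (jetSpan F z) (minkCons 1 (F z)) (pd 0 (fun w => minkCons 1 (F w)) z)
        (pd 1 (fun w => minkCons 1 (F w)) z) (minkCons 1 (G z)) x₁ x₂ ∧
      coTouchInvariant x₁ x₂ (pd 0 (fun w => minkCons 1 (G w)) z)
        (pd 1 (fun w => minkCons 1 (G w)) z) = 0) ↔
    binner (pd 0 (fun w => pointPair (F w) (G w)) z) (pd 0 (fun w => pointPair (F w) (G w)) z)
        = binner (pd 1 (fun w => pointPair (F w) (G w)) z)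
          (pd 1 (fun w => pointPair (F w) (G w)) z) ∧
      binner (pd 0 (fun w => pointPair (F w) (G w)) z) (pd 1 (fun w => pointPair (F w) (G w)) z)
        = 0 := by
  have hs := h.pos z hz
  have hq := h.symm.nullPair
  have hJ := (h.conformalJet hF hz).coTouch_iff (hq.null₁ z hz)
    (by rw [mink_minkCons]; linarith) hmem (mink_pd_of_null h.isOpen hq.smooth₁ hq.null₁ hz 0)
    (mink_pd_of_null h.isOpen hq.smooth₁ hq.null₁ hz 1)
  refine hJ.trans ?_
  have h00 := h.binner_pd_eq_mixedForm hz 0 0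
  have h11 := h.binner_pd_eq_mixedForm hz 1 1
  have h01 := h.binner_pd_eq_mixedForm hz 0 1
  rw [← h01, mul_eq_zero, or_iff_right hs.ne']
  refine and_congr_left fun _ => ⟨fun h0 => mul_left_cancel₀ hs.ne' ?_, fun h0 => ?_⟩
  · rw [h00, h11, h0]
  · rw [h0, h11] at h00
    linarith

end SurfacePairs

/-! ### The Willmore density of an arbitrary immersion -/

section WillmoreDensity

/-- The algebraic content of `SpherePair.flux_eq`. Here `a`, `b`, `c` are the metric coefficients of
`F`, `r` is the root of their determinant and `s = 1 - ⟨F, G⟩`; `A`, `B`, `C` are the products of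
`F_uu`, `F_uv`, `F_vv` with `F_u`, `F_v`; and `u_i = ⟨F_i, G⟩`, `w_i = ⟨F, G_i⟩`, `k_ij = ⟨F_i,
G_j⟩`, `t_ij = ⟨F_ij, G⟩`. Eliminating `c` through `hD` leaves an identity of rational functions. -/
lemma flux_identity {a b c r s A₁ A₂ B₁ B₂ C₁ C₂ u₁ u₂ w₁ w₂ k₁₁ k₁₂ k₂₁ k₂₂ t₁₁ t₁₂ t₂₂ : ℝ}
    (ha : a ≠ 0) (hr : r ≠ 0) (hs : s ≠ 0) (hD : r ^ 2 = a * c - b ^ 2) :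
    2 / s * ((c * (t₁₁ + a * (1 - s)
            - (c * A₁ * u₁ - b * (A₁ * u₂ + A₂ * u₁) + a * A₂ * u₂) / r ^ 2)
          - 2 * b * (t₁₂ + b * (1 - s)
            - (c * B₁ * u₁ - b * (B₁ * u₂ + B₂ * u₁) + a * B₂ * u₂) / r ^ 2)
          + a * (t₂₂ + c * (1 - s)
            - (c * C₁ * u₁ - b * (C₁ * u₂ + C₂ * u₁) + a * C₂ * u₂) / r ^ 2)) / r)
      - 2 / s ^ 2 * r * (1 - (1 - s) ^ 2 - (c * u₁ ^ 2 - 2 * b * u₁ * u₂ + a * u₂ ^ 2) / r ^ 2)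
      + 2 * r
      = 2 * (((2 * B₂ * u₁ + c * (t₁₁ + k₁₁) - (A₂ + B₁) * u₂ - b * (t₁₂ + k₂₁)) * (s * r)
            - (c * u₁ - b * u₂) * (-(u₁ + w₁) * r
              + s * ((2 * A₁ * c + a * (2 * B₂) - 2 * b * (A₂ + B₁)) / (2 * r)))) / (s * r) ^ 2)
        + 2 * (((2 * B₁ * u₂ + a * (t₂₂ + k₂₂) - (B₂ + C₁) * u₁ - b * (t₁₂ + k₁₂)) * (s * r)
            - (a * u₂ - b * u₁) * (-(u₂ + w₂) * r
              + s * ((2 * B₁ * c + a * (2 * C₂) - 2 * b * (B₂ + C₁)) / (2 * r)))) / (s * r) ^ 2)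
        - (c * ((s * (k₁₁ + k₁₁) + u₁ * w₁ + u₁ * w₁) / s ^ 2)
          - 2 * b * ((s * (k₁₂ + k₂₁) + u₁ * w₂ + u₂ * w₁) / s ^ 2)
          + a * ((s * (k₂₂ + k₂₂) + u₂ * w₂ + u₂ * w₂) / s ^ 2)) / r := by
  have hc : c = (r ^ 2 + b ^ 2) / a := by field_simp; linarith
  subst hc
  field_simp
  ring

/-- The algebraic content of Gauss' equation, with `a`, `b`, `c`, `r`, `A`, `B`, `C` as in
`flux_identity`, `p = ⟨F_uu, F_vv⟩` and `q = ⟨F_uv, F_uv⟩`. The terms `m₁`, `m₂` contain the third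
derivatives of `F` and cancel. -/
lemma curvature_identity {a b c r A₁ A₂ B₁ B₂ C₁ C₂ m₁ m₂ p q : ℝ}
    (ha : a ≠ 0) (hr : r ≠ 0) (hD : r ^ 2 = a * c - b ^ 2) :
    ((p - a * c - (c * A₁ * C₁ - b * (A₁ * C₂ + A₂ * C₁) + a * A₂ * C₂) / r ^ 2)
        - (q - b * b - (c * B₁ * B₁ - b * (B₁ * B₂ + B₂ * B₁) + a * B₂ * B₂) / r ^ 2)) / r + r
      = ((2 * B₁ * A₂ + a * (m₁ + p) - (B₂ + C₁) * A₁ - b * m₂) * (a * r)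
            - (a * A₂ - b * A₁) * (2 * B₁ * r
              + a * ((2 * B₁ * c + a * (2 * C₂) - 2 * b * (B₂ + C₁)) / (2 * r)))) / (a * r) ^ 2
        - ((2 * A₁ * B₂ + a * (m₁ + q) - (A₂ + B₁) * B₁ - b * m₂) * (a * r)
            - (a * B₂ - b * B₁) * (2 * A₁ * r
              + a * ((2 * A₁ * c + a * (2 * B₂) - 2 * b * (A₂ + B₁)) / (2 * r)))) / (a * r) ^ 2 := by
  have hc : c = (r ^ 2 + b ^ 2) / a := by field_simp; linarith
  subst hc
  field_simp
  ring

/-- For a symmetric form on a plane, the squared norm of the trace-free part is half the squared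
trace minus twice the determinant. The indices 1, 2, 3 of the products `x` stand for the components
`uu`, `uv`, `vv`. -/
lemma trace_free_identity {a b c D x₁₁ x₁₂ x₁₃ x₂₂ x₂₃ x₃₃ : ℝ} (hD : D = a * c - b ^ 2)
    (h0 : D ≠ 0) :
    (c ^ 2 * x₁₁ - 4 * b * c * x₁₂ + 2 * b ^ 2 * x₁₃ + 2 * (a * c + b ^ 2) * x₂₂ - 4 * a * b * x₂₃
        + a ^ 2 * x₃₃) / D ^ 2
      - 1 / 2 * ((c ^ 2 * x₁₁ + 4 * b ^ 2 * x₂₂ + a ^ 2 * x₃₃ - 4 * b * c * x₁₂ + 2 * a * c * x₁₃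
        - 4 * a * b * x₂₃) / D ^ 2)
      = 1 / 2 * ((c ^ 2 * x₁₁ + 4 * b ^ 2 * x₂₂ + a ^ 2 * x₃₃ - 4 * b * c * x₁₂ + 2 * a * c * x₁₃
        - 4 * a * b * x₂₃) / D ^ 2) - 2 * (x₁₃ - x₂₂) / D := by
  subst hD
  field_simp
  ring

variable {n : ℕ} {U : Set ℂ} {F G : ℂ → Euc n} {z₀ : ℂ}

/-- The determinant of the induced metric. -/
noncomputable def metricDet (F : ℂ → Euc n) (z : ℂ) : ℝ :=
  inner ℝ (pd 0 F z) (pd 0 F z) * inner ℝ (pd 1 F z) (pd 1 F z) - inner ℝ (pd 0 F z) (pd 1 F z) ^ 2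

/-- The component of `v` orthogonal to `f`, `f₁`, `f₂`, for a unit vector `f` orthogonal to
`f₁`, `f₂`. -/
noncomputable def normalPart (f f₁ f₂ v : Euc n) : Euc n :=
  v - inner ℝ v f • f
    - (inner ℝ f₁ f₁ * inner ℝ f₂ f₂ - inner ℝ f₁ f₂ ^ 2)⁻¹ •
      ((inner ℝ f₂ f₂ * inner ℝ v f₁ - inner ℝ f₁ f₂ * inner ℝ v f₂) • f₁
        + (inner ℝ f₁ f₁ * inner ℝ v f₂ - inner ℝ f₁ f₂ * inner ℝ v f₁) • f₂)

lemma inner_normalPart_left {f f₁ f₂ : Euc n} (u v : Euc n) :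
    inner ℝ (normalPart f f₁ f₂ u) v = inner ℝ u v - inner ℝ u f * inner ℝ v f
      - (inner ℝ f₂ f₂ * inner ℝ u f₁ * inner ℝ v f₁
        - inner ℝ f₁ f₂ * (inner ℝ u f₁ * inner ℝ v f₂ + inner ℝ u f₂ * inner ℝ v f₁)
        + inner ℝ f₁ f₁ * inner ℝ u f₂ * inner ℝ v f₂) /
        (inner ℝ f₁ f₁ * inner ℝ f₂ f₂ - inner ℝ f₁ f₂ ^ 2) := by
  simp only [normalPart, inner_sub_left, inner_add_left, real_inner_smul_left]
  rw [real_inner_comm v f, real_inner_comm v f₁, real_inner_comm v f₂, div_eq_inv_mul]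
  ring

/-- A unit vector `f` and linearly independent vectors `f₁`, `f₂` orthogonal to it. -/
structure IsTangentFrame (f f₁ f₂ : Euc n) : Prop where
  unit : inner ℝ f f = 1
  orth₁ : inner ℝ f f₁ = 0
  orth₂ : inner ℝ f f₂ = 0
  det : inner ℝ f₁ f₁ * inner ℝ f₂ f₂ - inner ℝ f₁ f₂ ^ 2 ≠ 0

variable {f f₁ f₂ : Euc n}

lemma IsTangentFrame.inner_normalPart_frame (h : IsTangentFrame f f₁ f₂) (v : Euc n) :
    inner ℝ (normalPart f f₁ f₂ v) f = 0 ∧ inner ℝ (normalPart f f₁ f₂ v) f₁ = 0 ∧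
      inner ℝ (normalPart f f₁ f₂ v) f₂ = 0 := by
  have hD := h.det
  have c1 : inner ℝ f₁ f = 0 := by rw [real_inner_comm, h.orth₁]
  have c2 : inner ℝ f₂ f = 0 := by rw [real_inner_comm, h.orth₂]
  have c3 : inner ℝ f₂ f₁ = inner ℝ f₁ f₂ := real_inner_comm _ _
  simp only [inner_normalPart_left, h.unit, h.orth₁, h.orth₂, c1, c2, c3]
  have hi := mul_inv_cancel₀ hD
  refine ⟨by ring, ?_, ?_⟩
  · linear_combination (-inner ℝ v f₁) * hi
  · linear_combination (-inner ℝ v f₂) * hi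

lemma IsTangentFrame.inner_normalPart_normalPart (h : IsTangentFrame f f₁ f₂) (u v : Euc n) :
    inner ℝ (normalPart f f₁ f₂ u) (normalPart f f₁ f₂ v) = inner ℝ (normalPart f f₁ f₂ u) v := by
  obtain ⟨e0, e1, e2⟩ := h.inner_normalPart_frame u
  conv_lhs => rw [normalPart.eq_1 f f₁ f₂ v]
  simp only [inner_sub_right, inner_add_right, real_inner_smul_right, e0, e1, e2]
  ring

lemma IsTangentFrame.starProjection_eq (h : IsTangentFrame f f₁ f₂) (v : Euc n) :
    (Submodule.span ℝ {f, f₁, f₂})ᗮ.starProjection v = normalPart f f₁ f₂ v := by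
  obtain ⟨e0, e1, e2⟩ := h.inner_normalPart_frame v
  refine (Submodule.eq_starProjection_of_mem_of_inner_eq_zero
    (K := (Submodule.span ℝ {f, f₁, f₂})ᗮ) ?_ fun w hw => ?_)
  · rw [Submodule.mem_orthogonal']
    intro u hu
    obtain ⟨α, β, γ, rfl⟩ := Submodule.mem_span_triple.1 hu
    simp only [inner_add_right, real_inner_smul_right, e0, e1, e2]
    ring
  · rw [Submodule.mem_orthogonal] at hw
    have w0 := hw f (Submodule.subset_span (by simp))
    have w1 := hw f₁ (Submodule.subset_span (by simp))
    have w2 := hw f₂ (Submodule.subset_span (by simp))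
    rw [normalPart]
    simp only [inner_sub_left, inner_add_left, real_inner_smul_left, w0, w1, w2]
    ring

lemma metricMat_det (F : ℂ → Euc n) (z : ℂ) : (metricMat F z).det = metricDet F z := by
  rw [Matrix.det_fin_two, metricDet]
  simp only [metricMat, Matrix.of_apply]
  rw [real_inner_comm (pd 0 F z) (pd 1 F z)]
  ring

lemma metricMat_inv (F : ℂ → Euc n) (z : ℂ) :
    (metricMat F z)⁻¹ 0 0 = inner ℝ (pd 1 F z) (pd 1 F z) / metricDet F z ∧
    (metricMat F z)⁻¹ 0 1 = - inner ℝ (pd 0 F z) (pd 1 F z) / metricDet F z ∧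
    (metricMat F z)⁻¹ 1 0 = - inner ℝ (pd 0 F z) (pd 1 F z) / metricDet F z ∧
    (metricMat F z)⁻¹ 1 1 = inner ℝ (pd 0 F z) (pd 0 F z) / metricDet F z := by
  rw [Matrix.inv_def, Ring.inverse_eq_inv', metricMat_det, Matrix.adjugate_fin_two]
  simp only [metricMat, Matrix.smul_apply, Matrix.of_apply, Matrix.cons_val', Matrix.cons_val_zero,
    Matrix.cons_val_one, Matrix.cons_val_fin_one, smul_eq_mul, div_eq_inv_mul,
    real_inner_comm (pd 0 F z) (pd 1 F z), and_self]

/-- The Willmore density in terms of the mean curvature and the Gauss curvature. -/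
lemma eight_mul_willmoreDensity (hU : IsOpen U) (hF : ContDiffOn ℝ ∞ F U) {z : ℂ} (hz : z ∈ U)
    (hD : 0 < metricDet F z) :
    8 * willmoreDensity F z =
      (1 / 2 * (inner ℝ (inner ℝ (pd 1 F z) (pd 1 F z) • secondForm F z 0 0
          - (2 * inner ℝ (pd 0 F z) (pd 1 F z)) • secondForm F z 1 0
          + inner ℝ (pd 0 F z) (pd 0 F z) • secondForm F z 1 1)
        (inner ℝ (pd 1 F z) (pd 1 F z) • secondForm F z 0 0
          - (2 * inner ℝ (pd 0 F z) (pd 1 F z)) • secondForm F z 1 0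
          + inner ℝ (pd 0 F z) (pd 0 F z) • secondForm F z 1 1) / metricDet F z ^ 2)
        - 2 * (inner ℝ (secondForm F z 0 0) (secondForm F z 1 1)
          - inner ℝ (secondForm F z 1 0) (secondForm F z 1 0)) / metricDet F z)
      * Real.sqrt (metricDet F z) := by
  obtain ⟨i00, i01, i10, i11⟩ := metricMat_inv F z
  have hsym : secondForm F z 0 1 = secondForm F z 1 0 := by
    rw [secondForm, secondForm, pd_comm hU hF hz 0 1]
  rw [willmoreDensity, metricMat_det]
  simp only [Fin.sum_univ_two, i00, i01, i10, i11, hsym, ← real_inner_self_eq_norm_sq,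
    inner_add_left, inner_add_right, real_inner_smul_left, real_inner_smul_right, inner_sub_left,
    inner_sub_right]
  rw [real_inner_comm (secondForm F z 0 0) (secondForm F z 1 0),
    real_inner_comm (secondForm F z 0 0) (secondForm F z 1 1),
    real_inner_comm (secondForm F z 1 0) (secondForm F z 1 1)]
  linear_combination Real.sqrt (metricDet F z) * trace_free_identity
    (x₁₁ := inner ℝ (secondForm F z 0 0) (secondForm F z 0 0))
    (x₁₂ := inner ℝ (secondForm F z 0 0) (secondForm F z 1 0))
    (x₁₃ := inner ℝ (secondForm F z 0 0) (secondForm F z 1 1))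
    (x₂₂ := inner ℝ (secondForm F z 1 0) (secondForm F z 1 0))
    (x₂₃ := inner ℝ (secondForm F z 1 0) (secondForm F z 1 1))
    (x₃₃ := inner ℝ (secondForm F z 1 1) (secondForm F z 1 1))
    (show metricDet F z = _ from rfl) hD.ne'

/-! ### Divergence terms -/

/-- The components of the vector field `(2 / s) √g grad ⟨·, G⟩`, tangential to `F`. -/
noncomputable def fluxTerm (i : Fin 2) (F G : ℂ → Euc n) (z : ℂ) : ℝ :=
  2 * ((inner ℝ (pd (1 - i) F z) (pd (1 - i) F z) * inner ℝ (pd i F z) (G z)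
      - inner ℝ (pd 0 F z) (pd 1 F z) * inner ℝ (pd (1 - i) F z) (G z)) /
    ((1 - inner ℝ (F z) (G z)) * Real.sqrt (metricDet F z)))

/-- The connection form of the frame obtained from `F_u`, `F_v` by the Gram-Schmidt process. -/
noncomputable def connectionForm (i : Fin 2) (F : ℂ → Euc n) (z : ℂ) : ℝ :=
  (inner ℝ (pd 0 F z) (pd 0 F z) * inner ℝ (pd i (pd 0 F) z) (pd 1 F z)
      - inner ℝ (pd 0 F z) (pd 1 F z) * inner ℝ (pd i (pd 0 F) z) (pd 0 F z)) /
    (inner ℝ (pd 0 F z) (pd 0 F z) * Real.sqrt (metricDet F z))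

lemma metricDet_pos_left (hD : 0 < metricDet F z₀) : 0 < inner ℝ (pd 0 F z₀) (pd 0 F z₀) := by
  refine lt_of_le_of_ne real_inner_self_nonneg fun h0 => ?_
  rw [metricDet, ← h0] at hD
  nlinarith [sq_nonneg (inner ℝ (pd 0 F z₀) (pd 1 F z₀))]

end WillmoreDensity

/-! ### Smoothness and derivatives of the divergence terms -/

section Divergence

variable {n : ℕ} {U : Set ℂ} {F G : ℂ → Euc n}

lemma contDiffOn_metricDet (hU : IsOpen U) (hF : ContDiffOn ℝ ∞ F U) :
    ContDiffOn ℝ ∞ (metricDet F) U :=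
  have h := contDiffOn_pd hU hF
  ((((h 0).inner ℝ (h 0)).mul ((h 1).inner ℝ (h 1))).sub (((h 0).inner ℝ (h 1)).pow 2))

lemma SpherePair.contDiffOn_fluxTerm (h : SpherePair U F G) (hD : ∀ z ∈ U, 0 < metricDet F z)
    (i : Fin 2) : ContDiffOn ℝ ∞ (fluxTerm i F G) U := by
  have hp := contDiffOn_pd h.isOpen h.smooth₁
  refine contDiffOn_const.mul (ContDiffOn.div ?_ ?_ fun z hz =>
    (mul_pos (h.pos z hz) (Real.sqrt_pos.2 (hD z hz))).ne')
  · exact (((hp _).inner ℝ (hp _)).mul ((hp _).inner ℝ h.smooth₂)).sub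
      (((hp _).inner ℝ (hp _)).mul ((hp _).inner ℝ h.smooth₂))
  · exact (contDiffOn_const.sub (h.smooth₁.inner ℝ h.smooth₂)).mul
      ((contDiffOn_metricDet h.isOpen h.smooth₁).sqrt fun z hz => (hD z hz).ne')

lemma contDiffOn_connectionForm (hU : IsOpen U) (hF : ContDiffOn ℝ ∞ F U)
    (hD : ∀ z ∈ U, 0 < metricDet F z) (i : Fin 2) : ContDiffOn ℝ ∞ (connectionForm i F) U := by
  have hp := contDiffOn_pd hU hF
  have hpp := contDiffOn_pd hU (hp 0)
  refine ContDiffOn.div ?_ ?_ fun z hz =>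
    (mul_pos (metricDet_pos_left (hD z hz)) (Real.sqrt_pos.2 (hD z hz))).ne'
  · exact (((hp _).inner ℝ (hp _)).mul ((hpp _).inner ℝ (hp _))).sub
      (((hp _).inner ℝ (hp _)).mul ((hpp _).inner ℝ (hp _)))
  · exact ((hp _).inner ℝ (hp _)).mul
      ((contDiffOn_metricDet hU hF).sqrt fun z hz => (hD z hz).ne')

/-- The derivative of the determinant of the metric. -/
noncomputable def metricDetDeriv (i : Fin 2) (F : ℂ → Euc n) (z : ℂ) : ℝ :=
  2 * inner ℝ (pd i (pd 0 F) z) (pd 0 F z) * inner ℝ (pd 1 F z) (pd 1 F z)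
    + inner ℝ (pd 0 F z) (pd 0 F z) * (2 * inner ℝ (pd i (pd 1 F) z) (pd 1 F z))
    - 2 * inner ℝ (pd 0 F z) (pd 1 F z) *
      (inner ℝ (pd i (pd 0 F) z) (pd 1 F z) + inner ℝ (pd i (pd 1 F) z) (pd 0 F z))

lemma hasDerivAt_inner_line {F G : ℂ → Euc n} {z : ℂ} (hF : DifferentiableAt ℝ F z)
    (hG : DifferentiableAt ℝ G z) (i : Fin 2) :
    HasDerivAt (fun t : ℝ => inner ℝ (F (z + t • dir i)) (G (z + t • dir i)))
      (inner ℝ (pd i F z) (G z) + inner ℝ (pd i G z) (F z)) 0 := by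
  refine ((hasDerivAt_line hF i).inner ℝ (hasDerivAt_line hG i)).congr_deriv ?_
  rw [zero_smul, add_zero, add_comm, real_inner_comm (F z)]

lemma hasDerivAt_metricDet_line (hU : IsOpen U) (hF : ContDiffOn ℝ ∞ F U) {z : ℂ} (hz : z ∈ U)
    (i : Fin 2) :
    HasDerivAt (fun t : ℝ => metricDet F (z + t • dir i)) (metricDetDeriv i F z) 0 := by
  have d := fun k => differentiableAt_of_contDiffOn hU (contDiffOn_pd hU hF k) hz
  have e := fun k l => hasDerivAt_inner_line (d k) (d l) i
  refine (((e 0 0).mul (e 1 1)).sub ((e 0 1).pow 2)).congr_deriv ?_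
  simp only [zero_smul, add_zero, metricDetDeriv]
  ring

/-- Only the derivative of each component in its own direction enters the divergence; `1 - i` in
`Fin 2` is the other direction. -/
lemma SpherePair.pd_fluxTerm (h : SpherePair U F G) (hD : ∀ z ∈ U, 0 < metricDet F z) {z : ℂ}
    (hz : z ∈ U) (i : Fin 2) :
    pd i (fluxTerm i F G) z =
      2 * (((2 * inner ℝ (pd i (pd (1 - i) F) z) (pd (1 - i) F z) * inner ℝ (pd i F z) (G z)
            + inner ℝ (pd (1 - i) F z) (pd (1 - i) F z) *
              (inner ℝ (pd i (pd i F) z) (G z) + inner ℝ (pd i F z) (pd i G z))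
            - (inner ℝ (pd i (pd 0 F) z) (pd 1 F z) + inner ℝ (pd i (pd 1 F) z) (pd 0 F z)) *
              inner ℝ (pd (1 - i) F z) (G z)
            - inner ℝ (pd 0 F z) (pd 1 F z) *
              (inner ℝ (pd i (pd (1 - i) F) z) (G z) + inner ℝ (pd (1 - i) F z) (pd i G z))) *
            ((1 - inner ℝ (F z) (G z)) * Real.sqrt (metricDet F z))
          - (inner ℝ (pd (1 - i) F z) (pd (1 - i) F z) * inner ℝ (pd i F z) (G z)
            - inner ℝ (pd 0 F z) (pd 1 F z) * inner ℝ (pd (1 - i) F z) (G z)) *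
            (-(inner ℝ (pd i F z) (G z) + inner ℝ (F z) (pd i G z)) * Real.sqrt (metricDet F z)
              + (1 - inner ℝ (F z) (G z)) *
                (metricDetDeriv i F z / (2 * Real.sqrt (metricDet F z))))) /
        ((1 - inner ℝ (F z) (G z)) * Real.sqrt (metricDet F z)) ^ 2) := by
  have hU := h.isOpen
  have d0 := differentiableAt_of_contDiffOn hU h.smooth₁ hz
  have dG := differentiableAt_of_contDiffOn hU h.smooth₂ hz
  have d := fun k => differentiableAt_of_contDiffOn hU (contDiffOn_pd hU h.smooth₁ k) hz
  have e := fun k l => hasDerivAt_inner_line (d k) (d l) i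
  have eG := fun k => hasDerivAt_inner_line (d k) dG i
  have es := (hasDerivAt_inner_line d0 dG i).const_sub 1
  have eD := (hasDerivAt_metricDet_line hU h.smooth₁ hz i).sqrt
    (by simpa using (hD z hz).ne')
  refine pd_eq_of_hasDerivAt
    (differentiableAt_of_contDiffOn hU (h.contDiffOn_fluxTerm hD i) hz) ?_
  refine (((((e (1 - i) (1 - i)).mul (eG i)).sub ((e 0 1).mul (eG (1 - i)))).div (es.mul eD)
    ?_).const_mul 2).congr_deriv ?_
  · simpa using ⟨(h.pos z hz).ne', (Real.sqrt_pos.2 (hD z hz)).ne'⟩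
  · simp only [zero_smul, add_zero, Pi.mul_apply, Pi.sub_apply]
    have c0 : inner ℝ (pd i G z) (F z) = inner ℝ (F z) (pd i G z) := real_inner_comm _ _
    have c1 : ∀ l, inner ℝ (pd i G z) (pd l F z) = inner ℝ (pd l F z) (pd i G z) :=
      fun l => real_inner_comm _ _
    rw [c0, c1, c1]
    ring

lemma pd_connectionForm (hU : IsOpen U) (hF : ContDiffOn ℝ ∞ F U)
    (hD : ∀ z ∈ U, 0 < metricDet F z) {z : ℂ} (hz : z ∈ U) (k i : Fin 2) :
    pd k (connectionForm i F) z =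
      ((2 * inner ℝ (pd k (pd 0 F) z) (pd 0 F z) * inner ℝ (pd i (pd 0 F) z) (pd 1 F z)
          + inner ℝ (pd 0 F z) (pd 0 F z) *
            (inner ℝ (pd k (pd i (pd 0 F)) z) (pd 1 F z)
              + inner ℝ (pd k (pd 1 F) z) (pd i (pd 0 F) z))
          - (inner ℝ (pd k (pd 0 F) z) (pd 1 F z) + inner ℝ (pd k (pd 1 F) z) (pd 0 F z)) *
            inner ℝ (pd i (pd 0 F) z) (pd 0 F z)
          - inner ℝ (pd 0 F z) (pd 1 F z) *
            (inner ℝ (pd k (pd i (pd 0 F)) z) (pd 0 F z)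
              + inner ℝ (pd k (pd 0 F) z) (pd i (pd 0 F) z))) *
          (inner ℝ (pd 0 F z) (pd 0 F z) * Real.sqrt (metricDet F z))
        - (inner ℝ (pd 0 F z) (pd 0 F z) * inner ℝ (pd i (pd 0 F) z) (pd 1 F z)
            - inner ℝ (pd 0 F z) (pd 1 F z) * inner ℝ (pd i (pd 0 F) z) (pd 0 F z)) *
          (2 * inner ℝ (pd k (pd 0 F) z) (pd 0 F z) * Real.sqrt (metricDet F z)
            + inner ℝ (pd 0 F z) (pd 0 F z) *
              (metricDetDeriv k F z / (2 * Real.sqrt (metricDet F z))))) /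
        (inner ℝ (pd 0 F z) (pd 0 F z) * Real.sqrt (metricDet F z)) ^ 2 := by
  have d := fun l => differentiableAt_of_contDiffOn hU (contDiffOn_pd hU hF l) hz
  have d2 := differentiableAt_of_contDiffOn hU (contDiffOn_pd hU (contDiffOn_pd hU hF 0) i) hz
  have e := fun l m => hasDerivAt_inner_line (d l) (d m) k
  have e2 := fun l => hasDerivAt_inner_line d2 (d l) k
  have eD := (hasDerivAt_metricDet_line hU hF hz k).sqrt (by simpa using (hD z hz).ne')
  refine pd_eq_of_hasDerivAt
    (differentiableAt_of_contDiffOn hU (contDiffOn_connectionForm hU hF hD i) hz) ?_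
  refine ((((e 0 0).mul (e2 1)).sub ((e 0 1).mul (e2 0))).div ((e 0 0).mul eD) ?_).congr_deriv ?_
  · simpa using ⟨fun h0 => (metricDet_pos_left (hD z hz)).ne' (by rw [h0, inner_zero_left]),
      (Real.sqrt_pos.2 (hD z hz)).ne'⟩
  · simp only [zero_smul, add_zero, Pi.mul_apply, Pi.sub_apply]
    ring

end Divergence

/-! ### The Willmore density as an energy density up to divergences -/

section Decomposition

variable {n : ℕ} {U : Set ℂ} {F G : ℂ → Euc n}

/-- The normal component at `F(z)`. -/
noncomputable def normalAt (F : ℂ → Euc n) (z : ℂ) (v : Euc n) : Euc n :=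
  normalPart (F z) (pd 0 F z) (pd 1 F z) v

/-- The difference of the trace of the second fundamental form of `F` and the one of the sphere
tangent to `F` and containing `G`. -/
noncomputable def sphereDefect (F G : ℂ → Euc n) (z : ℂ) : Euc n :=
  (metricDet F z)⁻¹ • (inner ℝ (pd 1 F z) (pd 1 F z) • normalAt F z (pd 0 (pd 0 F) z)
      - (2 * inner ℝ (pd 0 F z) (pd 1 F z)) • normalAt F z (pd 1 (pd 0 F) z)
      + inner ℝ (pd 0 F z) (pd 0 F z) • normalAt F z (pd 1 (pd 1 F) z))
    - (2 / (1 - inner ℝ (F z) (G z))) • normalAt F z (G z)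

/-- The energy density of the map into the Grassmannian, with respect to the metric induced by
`F`. -/
noncomputable def grassmannDensity (F G : ℂ → Euc n) (z : ℂ) : ℝ :=
  (inner ℝ (pd 1 F z) (pd 1 F z) *
      binner (pd 0 (fun w => pointPair (F w) (G w)) z) (pd 0 (fun w => pointPair (F w) (G w)) z)
    - 2 * inner ℝ (pd 0 F z) (pd 1 F z) *
      binner (pd 0 (fun w => pointPair (F w) (G w)) z) (pd 1 (fun w => pointPair (F w) (G w)) z)
    + inner ℝ (pd 0 F z) (pd 0 F z) *
      binner (pd 1 (fun w => pointPair (F w) (G w)) z) (pd 1 (fun w => pointPair (F w) (G w)) z)) /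
    Real.sqrt (metricDet F z)

lemma SpherePair.isTangentFrame (h : SpherePair U F G) {z : ℂ} (hz : z ∈ U)
    (hD : 0 < metricDet F z) : IsTangentFrame (F z) (pd 0 F z) (pd 1 F z) :=
  ⟨h.unit₁ z hz, h.inner_pd hz 0, h.inner_pd hz 1, hD.ne'⟩

lemma SpherePair.inner_pd_pd (h : SpherePair U F G) {z : ℂ} (hz : z ∈ U) (i j : Fin 2) :
    inner ℝ (pd i (pd j F) z) (F z) = - inner ℝ (pd i F z) (pd j F z) := by
  have dF := differentiableAt_of_contDiffOn h.isOpen h.smooth₁ hz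
  have d := differentiableAt_of_contDiffOn h.isOpen (contDiffOn_pd h.isOpen h.smooth₁ j) hz
  have := pd_inner dF d i
  rw [pd_congr h.isOpen (fun w hw => h.inner_pd hw j) i hz, pd_const,
    real_inner_comm (pd i (pd j F) z)] at this
  linarith

/-- The determinant is written as the square of its root, the form in which `flux_identity` and
`curvature_identity` use it. -/
lemma SpherePair.inner_normalAt (h : SpherePair U F G) {z : ℂ} (hz : z ∈ U)
    (hD : 0 < metricDet F z) (u v : Euc n) :
    inner ℝ (normalAt F z u) (normalAt F z v) = inner ℝ u v - inner ℝ u (F z) * inner ℝ v (F z)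
      - (inner ℝ (pd 1 F z) (pd 1 F z) * inner ℝ u (pd 0 F z) * inner ℝ v (pd 0 F z)
        - inner ℝ (pd 0 F z) (pd 1 F z) * (inner ℝ u (pd 0 F z) * inner ℝ v (pd 1 F z)
          + inner ℝ u (pd 1 F z) * inner ℝ v (pd 0 F z))
        + inner ℝ (pd 0 F z) (pd 0 F z) * inner ℝ u (pd 1 F z) * inner ℝ v (pd 1 F z)) /
        Real.sqrt (metricDet F z) ^ 2 := by
  rw [Real.sq_sqrt hD.le]
  exact ((h.isTangentFrame hz hD).inner_normalPart_normalPart u v).trans (inner_normalPart_left u v)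

/-- Integration by parts of the mixed term. -/
lemma SpherePair.flux_eq (h : SpherePair U F G) (hD : ∀ z ∈ U, 0 < metricDet F z) {z : ℂ}
    (hz : z ∈ U) :
    2 / (1 - inner ℝ (F z) (G z)) *
        ((inner ℝ (pd 1 F z) (pd 1 F z) *
            inner ℝ (normalAt F z (pd 0 (pd 0 F) z)) (normalAt F z (G z))
          - 2 * inner ℝ (pd 0 F z) (pd 1 F z) *
            inner ℝ (normalAt F z (pd 1 (pd 0 F) z)) (normalAt F z (G z))
          + inner ℝ (pd 0 F z) (pd 0 F z) *
            inner ℝ (normalAt F z (pd 1 (pd 1 F) z)) (normalAt F z (G z))) /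
          Real.sqrt (metricDet F z))
      - 2 / (1 - inner ℝ (F z) (G z)) ^ 2 * Real.sqrt (metricDet F z) *
        inner ℝ (normalAt F z (G z)) (normalAt F z (G z))
      + 2 * Real.sqrt (metricDet F z)
      = pd 0 (fluxTerm 0 F G) z + pd 1 (fluxTerm 1 F G) z - grassmannDensity F G z := by
  have hDz := hD z hz
  have hcomm : pd 0 (pd 1 F) z = pd 1 (pd 0 F) z := pd_comm h.isOpen h.smooth₁ hz 0 1
  have hr2 : Real.sqrt (metricDet F z) ^ 2 = metricDet F z := Real.sq_sqrt hDz.le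
  have hflux := flux_identity (r := Real.sqrt (metricDet F z)) (s := 1 - inner ℝ (F z) (G z))
    (a := inner ℝ (pd 0 F z) (pd 0 F z)) (b := inner ℝ (pd 0 F z) (pd 1 F z))
    (c := inner ℝ (pd 1 F z) (pd 1 F z))
    (A₁ := inner ℝ (pd 0 (pd 0 F) z) (pd 0 F z)) (A₂ := inner ℝ (pd 0 (pd 0 F) z) (pd 1 F z))
    (B₁ := inner ℝ (pd 1 (pd 0 F) z) (pd 0 F z)) (B₂ := inner ℝ (pd 1 (pd 0 F) z) (pd 1 F z))
    (C₁ := inner ℝ (pd 1 (pd 1 F) z) (pd 0 F z)) (C₂ := inner ℝ (pd 1 (pd 1 F) z) (pd 1 F z))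
    (u₁ := inner ℝ (pd 0 F z) (G z)) (u₂ := inner ℝ (pd 1 F z) (G z))
    (w₁ := inner ℝ (F z) (pd 0 G z)) (w₂ := inner ℝ (F z) (pd 1 G z))
    (k₁₁ := inner ℝ (pd 0 F z) (pd 0 G z)) (k₁₂ := inner ℝ (pd 0 F z) (pd 1 G z))
    (k₂₁ := inner ℝ (pd 1 F z) (pd 0 G z)) (k₂₂ := inner ℝ (pd 1 F z) (pd 1 G z))
    (t₁₁ := inner ℝ (pd 0 (pd 0 F) z) (G z)) (t₁₂ := inner ℝ (pd 1 (pd 0 F) z) (G z))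
    (t₂₂ := inner ℝ (pd 1 (pd 1 F) z) (G z))
    (metricDet_pos_left hDz).ne' (Real.sqrt_pos.2 hDz).ne' (h.pos z hz).ne' (hr2.trans rfl)
  have hf0 := h.pd_fluxTerm hD hz 0
  have hf1 := h.pd_fluxTerm hD hz 1
  simp only [sub_zero, sub_self, metricDetDeriv, hcomm] at hf0 hf1
  have c0 : inner ℝ (G z) (F z) = inner ℝ (F z) (G z) := real_inner_comm _ _
  have c1 : ∀ i, inner ℝ (G z) (pd i F z) = inner ℝ (pd i F z) (G z) :=
    fun i => real_inner_comm _ _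
  have c2 : inner ℝ (pd 1 F z) (pd 0 F z) = inner ℝ (pd 0 F z) (pd 1 F z) := real_inner_comm _ _
  rw [hf0, hf1, grassmannDensity, h.binner_pd hz, h.binner_pd hz, h.binner_pd hz]
  simp only [h.inner_normalAt hz hDz, h.inner_pd_pd hz, h.unit₂ z hz, c0, c1, c2]
  linear_combination hflux

/-- Gauss' equation. -/
lemma SpherePair.curvature_eq (h : SpherePair U F G) (hD : ∀ z ∈ U, 0 < metricDet F z) {z : ℂ}
    (hz : z ∈ U) :
    (inner ℝ (normalAt F z (pd 0 (pd 0 F) z)) (normalAt F z (pd 1 (pd 1 F) z))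
        - inner ℝ (normalAt F z (pd 1 (pd 0 F) z)) (normalAt F z (pd 1 (pd 0 F) z))) /
        Real.sqrt (metricDet F z) + Real.sqrt (metricDet F z)
      = pd 1 (connectionForm 0 F) z - pd 0 (connectionForm 1 F) z := by
  have hU := h.isOpen
  have hDz := hD z hz
  have hcomm : pd 0 (pd 1 F) z = pd 1 (pd 0 F) z := pd_comm hU h.smooth₁ hz 0 1
  -- Symmetry of the third derivatives lets them cancel in the curl of the connection form.
  have hcomm3 : pd 0 (pd 1 (pd 0 F)) z = pd 1 (pd 0 (pd 0 F)) z :=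
    pd_comm hU (contDiffOn_pd hU h.smooth₁ 0) hz 0 1
  have hr2 : Real.sqrt (metricDet F z) ^ 2 = metricDet F z := Real.sq_sqrt hDz.le
  have hcurv := curvature_identity (r := Real.sqrt (metricDet F z))
    (a := inner ℝ (pd 0 F z) (pd 0 F z)) (b := inner ℝ (pd 0 F z) (pd 1 F z))
    (c := inner ℝ (pd 1 F z) (pd 1 F z))
    (A₁ := inner ℝ (pd 0 (pd 0 F) z) (pd 0 F z)) (A₂ := inner ℝ (pd 0 (pd 0 F) z) (pd 1 F z))
    (B₁ := inner ℝ (pd 1 (pd 0 F) z) (pd 0 F z)) (B₂ := inner ℝ (pd 1 (pd 0 F) z) (pd 1 F z))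
    (C₁ := inner ℝ (pd 1 (pd 1 F) z) (pd 0 F z)) (C₂ := inner ℝ (pd 1 (pd 1 F) z) (pd 1 F z))
    (m₁ := inner ℝ (pd 1 (pd 0 (pd 0 F)) z) (pd 1 F z))
    (m₂ := inner ℝ (pd 1 (pd 0 (pd 0 F)) z) (pd 0 F z)
      + inner ℝ (pd 0 (pd 0 F) z) (pd 1 (pd 0 F) z))
    (p := inner ℝ (pd 0 (pd 0 F) z) (pd 1 (pd 1 F) z))
    (q := inner ℝ (pd 1 (pd 0 F) z) (pd 1 (pd 0 F) z))
    (metricDet_pos_left hDz).ne' (Real.sqrt_pos.2 hDz).ne' (hr2.trans rfl)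
  have hc0 := pd_connectionForm hU h.smooth₁ hD hz 1 0
  have hc1 := pd_connectionForm hU h.smooth₁ hD hz 0 1
  have c1 : inner ℝ (pd 1 (pd 1 F) z) (pd 0 (pd 0 F) z)
      = inner ℝ (pd 0 (pd 0 F) z) (pd 1 (pd 1 F) z) := real_inner_comm _ _
  have c2 : inner ℝ (pd 1 (pd 0 F) z) (pd 0 (pd 0 F) z)
      = inner ℝ (pd 0 (pd 0 F) z) (pd 1 (pd 0 F) z) := real_inner_comm _ _
  have c3 : inner ℝ (pd 1 F z) (pd 0 F z) = inner ℝ (pd 0 F z) (pd 1 F z) := real_inner_comm _ _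
  simp only [metricDetDeriv, hcomm, hcomm3, c1, c2] at hc0 hc1
  rw [hc0, hc1]
  simp only [h.inner_normalAt hz hDz, h.inner_pd_pd hz, c3]
  linear_combination hcurv

/-- Up to a term quadratic in the deviation of the mean curvature spheres from the spheres
containing `G`, and to divergences, the Willmore density is the energy density of the map into the
Grassmannian. -/
lemma SpherePair.willmoreDensity_decomposition (h : SpherePair U F G)
    (hD : ∀ z ∈ U, 0 < metricDet F z) {z : ℂ} (hz : z ∈ U) :
    8 * willmoreDensity F z =
      1 / 2 * Real.sqrt (metricDet F z) * inner ℝ (sphereDefect F G z) (sphereDefect F G z)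
      - grassmannDensity F G z
      + (pd 0 (fluxTerm 0 F G) z + pd 1 (fluxTerm 1 F G) z)
      - 2 * (pd 1 (connectionForm 0 F) z - pd 0 (connectionForm 1 F) z) := by
  have hDz := hD z hz
  have hT := h.isTangentFrame hz hDz
  have hsf : ∀ i j, secondForm F z i j = normalAt F z (pd i (pd j F) z) := fun i j =>
    hT.starProjection_eq _
  have h1 := h.flux_eq hD hz
  have h2 := h.curvature_eq hD hz
  rw [eight_mul_willmoreDensity h.isOpen h.smooth₁ hz hDz, ← h2]
  simp only [hsf]
  have h3 : ∀ x : ℝ, x - grassmannDensity F G z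
      + (pd 0 (fluxTerm 0 F G) z + pd 1 (fluxTerm 1 F G) z)
      = x + (pd 0 (fluxTerm 0 F G) z + pd 1 (fluxTerm 1 F G) z - grassmannDensity F G z) :=
    fun x => by ring
  -- Completing the square in half the squared trace with the vector `2 G^⊥ / s` produces the defect
  -- and the left side of `h1`. The area terms `2 √g` in `h1` and in Gauss' equation `h2` cancel.
  rw [h3, ← h1, sphereDefect]
  have hr := (Real.sqrt_pos.2 hDz).ne'
  have hr2 : metricDet F z = Real.sqrt (metricDet F z) ^ 2 := (Real.sq_sqrt hDz.le).symm
  have hs := (h.pos z hz).ne'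
  have hin : ∀ v, inner ℝ (pd 1 F z) (pd 1 F z) *
            inner ℝ (normalAt F z (pd 0 (pd 0 F) z)) v
          - 2 * inner ℝ (pd 0 F z) (pd 1 F z) *
            inner ℝ (normalAt F z (pd 1 (pd 0 F) z)) v
          + inner ℝ (pd 0 F z) (pd 0 F z) *
            inner ℝ (normalAt F z (pd 1 (pd 1 F) z)) v
        = inner ℝ (inner ℝ (pd 1 F z) (pd 1 F z) • normalAt F z (pd 0 (pd 0 F) z)
          - (2 * inner ℝ (pd 0 F z) (pd 1 F z)) • normalAt F z (pd 1 (pd 0 F) z)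
          + inner ℝ (pd 0 F z) (pd 0 F z) • normalAt F z (pd 1 (pd 1 F) z)) v := fun v => by
    simp only [inner_add_left, inner_sub_left, real_inner_smul_left]
  rw [hin]
  generalize (inner ℝ (pd 1 F z) (pd 1 F z) • normalAt F z (pd 0 (pd 0 F) z)
          - (2 * inner ℝ (pd 0 F z) (pd 1 F z)) • normalAt F z (pd 1 (pd 0 F) z)
          + inner ℝ (pd 0 F z) (pd 0 F z) • normalAt F z (pd 1 (pd 1 F) z)) = T
  generalize normalAt F z (G z) = g
  generalize inner ℝ (normalAt F z (pd 0 (pd 0 F) z)) (normalAt F z (pd 1 (pd 1 F) z))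
        - inner ℝ (normalAt F z (pd 1 (pd 0 F) z)) (normalAt F z (pd 1 (pd 0 F) z)) = k
  generalize 1 - inner ℝ (F z) (G z) = s at hs
  have hTg : inner ℝ g T = inner ℝ T g := real_inner_comm _ _
  simp only [inner_sub_left, inner_sub_right, real_inner_smul_left, real_inner_smul_right, hTg]
  rw [hr2]
  simp only [Real.sqrt_sq (Real.sqrt_nonneg _)]
  generalize Real.sqrt (metricDet F z) = r at hr
  field_simp
  ring

end Decomposition

/-! ### The first variation of the Willmore functional -/

section FirstVariation

variable {n : ℕ} {U K : Set ℂ} {F G : ℂ → Euc n}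

/-- The conformal invariance of the energy, to first order. -/
lemma hasDerivAt_conformal_deficit {a b c h k m : ℝ → ℝ} {a' b' c' h' k' m' t : ℝ}
    (ha : HasDerivAt a a' t) (hb : HasDerivAt b b' t) (hc : HasDerivAt c c' t)
    (hh : HasDerivAt h h' t) (hk : HasDerivAt k k' t) (hm : HasDerivAt m m' t)
    (hac : a t = c t) (hb0 : b t = 0) (hpos : 0 < a t) (hhm : h t = m t) (hk0 : k t = 0) :
    HasDerivAt (fun t => (c t * h t - 2 * b t * k t + a t * m t) / Real.sqrt (a t * c t - b t ^ 2)
      - (h t + m t)) 0 t := by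
  -- At time `t` both metrics are multiples of the identity, so the derivatives of `a`, `b`, `c`
  -- enter only through the trace-free part of the second metric, which vanishes.
  have hD : a t * c t - b t ^ 2 = a t ^ 2 := by rw [hb0, ← hac]; ring
  have hD0 : a t * c t - b t ^ 2 ≠ 0 := by rw [hD]; positivity
  have hs : Real.sqrt (a t * c t - b t ^ 2) = a t := by rw [hD, Real.sqrt_sq hpos.le]
  have hr := ((ha.mul hc).sub (hb.pow 2)).sqrt (by simpa using hD0)
  have hr' := (((((hc.mul hh).sub ((hb.const_mul 2).mul hk)).add (ha.mul hm)).div hr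
    (by simpa [hs] using hpos.ne'))).sub (hh.add hm)
  refine hr'.congr_deriv ?_
  simp only [Pi.mul_apply, Pi.sub_apply, Pi.pow_apply, Pi.add_apply, hs]
  simp only [hb0, hk0, ← hac, ← hhm]
  field_simp
  ring

/-- A change of time that is the identity near 0 and stays in a small interval. Criticality asks for
variations defined for all times, whereas a variation of `F` is known to avoid `G` only for small
times. -/
lemma exists_smooth_truncation {ε : ℝ} (hε : 0 < ε) :
    ∃ ψ : ℝ → ℝ, ContDiff ℝ ∞ ψ ∧ (∀ t, ψ t ∈ Metric.ball 0 ε) ∧ ∀ᶠ t in nhds 0, ψ t = t := by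
  let f : ContDiffBump (0 : ℝ) := ⟨ε / 2, ε, by positivity, by linarith⟩
  refine ⟨fun t => f t * t, f.contDiff.mul contDiff_id, fun t => ?_, ?_⟩
  · by_cases ht : t ∈ Metric.ball 0 ε
    · rw [mem_ball_zero_iff, Real.norm_eq_abs] at ht ⊢
      rw [abs_mul, abs_of_nonneg f.nonneg]
      exact (mul_le_of_le_one_left (abs_nonneg t) f.le_one).trans_lt ht
    · have : f t = 0 := f.zero_of_le_dist (by simpa [f] using ht)
      change f t * t ∈ _
      rw [this, zero_mul]
      exact Metric.mem_ball_self hε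
  · filter_upwards [Metric.closedBall_mem_nhds (0 : ℝ) (half_pos hε)] with t ht
    rw [f.one_of_mem_closedBall ht, one_mul]

/-- A function on `ℝ × U` that is positive at time `0` and constant in time outside a compact set
is positive for small times. -/
lemma exists_pos_of_compact (hU : IsOpen U) (hK : IsCompact K) (hKU : K ⊆ U) {d : ℝ × ℂ → ℝ}
    (hd : ContinuousOn d (univ ×ˢ U)) (h0 : ∀ z ∈ U, 0 < d (0, z))
    (hc : ∀ t, ∀ z ∈ U, z ∉ K → d (t, z) = d (0, z)) :
    ∃ ε > 0, ∀ t ∈ Metric.ball (0 : ℝ) ε, ∀ z ∈ U, 0 < d (t, z) := by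
  have hO : IsOpen ((univ ×ˢ U) ∩ d ⁻¹' Ioi 0) :=
    hd.isOpen_inter_preimage (isOpen_univ.prod hU) isOpen_Ioi
  obtain ⟨u, v, hu, hv, h0u, hKv, huv⟩ := generalized_tube_lemma (s := {(0 : ℝ)}) (t := K)
    isCompact_singleton hK hO (by
      rintro ⟨t, z⟩ ⟨ht, hz⟩
      obtain rfl : t = 0 := ht
      exact ⟨⟨mem_univ _, hKU hz⟩, h0 z (hKU hz)⟩)
  obtain ⟨ε, hε, hεu⟩ := Metric.isOpen_iff.1 hu 0 (h0u rfl)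
  refine ⟨ε, hε, fun t ht z hz => ?_⟩
  by_cases hzK : z ∈ K
  · exact (huv ⟨hεu ht, hKv hzK⟩ : (t, z) ∈ _).2
  · rw [hc t z hz hzK]
    exact h0 z hz

/-- The mean curvature spheres of a conformal immersion contain `G` iff they are the spheres
tangent to `F` through `G`. -/
lemma SpherePair.sphereDefect_eq_zero (h : SpherePair U F G) (hF : IsConformalImmersion U F)
    {z : ℂ} (hz : z ∈ U) (hmem : minkCons 1 (G z) ∈ jetSpan F z) : sphereDefect F G z = 0 := by
  have hU := h.isOpen
  obtain ⟨hc1, hc2, hpos⟩ := hF z hz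
  have hdet : metricDet F z = inner ℝ (pd 0 F z) (pd 0 F z) ^ 2 := by
    rw [metricDet, ← hc1, hc2]; ring
  have hD : 0 < metricDet F z := by rw [hdet]; positivity
  have hT := h.isTangentFrame hz hD
  have d0 := fun w (hw : w ∈ U) => differentiableAt_of_contDiffOn hU h.smooth₁ hw
  have d := fun k => differentiableAt_of_contDiffOn hU (contDiffOn_pd hU h.smooth₁ k) hz
  have hpp : ∀ i, pd i (pd i (fun w => minkCons 1 (F w))) z = minkCons 0 (pd i (pd i F) z) :=
    fun i => by
      rw [pd_congr hU (fun w hw => pd_minkCons 1 (d0 w hw) i) i hz, pd_minkCons 0 (d i)]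
  obtain ⟨α, β, γ, δ, hd⟩ := mem_span_four.1 hmem
  rw [lap, hpp, hpp, pd_minkCons 1 (d0 z hz), pd_minkCons 1 (d0 z hz), ← minkCons_add,
    ← minkCons_smul, ← minkCons_smul, ← minkCons_smul, ← minkCons_smul, ← minkCons_add,
    ← minkCons_add, ← minkCons_add] at hd
  obtain ⟨h1, hG⟩ := minkCons_injective hd
  -- Coordinate 0 of the lifts: it is 1 for `F` and `G`, and 0 for all derivatives. Pairing with `F`
  -- then determines `δ`, and in normal components `G` is `δ ΔF`, which is the vanishing of the
  -- defect.
  have hα : α = 1 := by linarith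
  have hs := (h.pos z hz).ne'
  have hδ : 1 - inner ℝ (F z) (G z) = δ * (2 * inner ℝ (pd 0 F z) (pd 0 F z)) := by
    rw [hG]
    simp only [inner_add_right, real_inner_smul_right, h.unit₁ z hz, h.inner_pd hz,
      real_inner_comm (pd 0 (pd 0 F) z) (F z), real_inner_comm (pd 1 (pd 1 F) z) (F z),
      h.inner_pd_pd hz, ← hc1, hα]
    ring
  have hn : ∀ v, normalAt F z v
      = (Submodule.span ℝ {F z, pd 0 F z, pd 1 F z})ᗮ.starProjection v := fun v =>
    (hT.starProjection_eq v).symm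
  have hn0 : ∀ v ∈ Submodule.span ℝ {F z, pd 0 F z, pd 1 F z},
      (Submodule.span ℝ {F z, pd 0 F z, pd 1 F z})ᗮ.starProjection v = 0 := fun v hv =>
    Submodule.starProjection_orthogonal_apply_eq_zero hv
  have hnG : normalAt F z (G z)
      = δ • (normalAt F z (pd 0 (pd 0 F) z) + normalAt F z (pd 1 (pd 1 F) z)) := by
    simp only [hn]
    rw [hG]
    simp only [map_add, map_smul]
    rw [hn0 (F z) (Submodule.subset_span (by simp)),
      hn0 (pd 0 F z) (Submodule.subset_span (by simp)),
      hn0 (pd 1 F z) (Submodule.subset_span (by simp))]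
    simp
  have hδ0 : δ ≠ 0 := by
    rintro rfl
    exact hs (by rw [hδ]; ring)
  rw [sphereDefect, hnG, hδ, hdet, ← hc1, hc2]
  have e1 : (2 / (δ * (2 * inner ℝ (pd 0 F z) (pd 0 F z)))) * δ
      = (inner ℝ (pd 0 F z) (pd 0 F z))⁻¹ := by
    field_simp
  have e2 : (inner ℝ (pd 0 F z) (pd 0 F z) ^ 2)⁻¹ * inner ℝ (pd 0 F z) (pd 0 F z)
      = (inner ℝ (pd 0 F z) (pd 0 F z))⁻¹ := by
    field_simp
  rw [smul_smul, e1, mul_zero, zero_smul, sub_zero, ← smul_add, smul_smul, e2, sub_self]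

end FirstVariation

/-! ### The divergence and quadratic parts along a variation -/

section FirstVariation

variable {n : ℕ} {U K : Set ℂ} {F F' G : ℂ → Euc n}

lemma metricDet_congr (hU : IsOpen U) (h : EqOn F F' U) : EqOn (metricDet F) (metricDet F') U :=
  fun z hz => by rw [metricDet, metricDet, pd_congr hU h 0 hz, pd_congr hU h 1 hz]

lemma fluxTerm_congr (hU : IsOpen U) (h : EqOn F F' U) (i : Fin 2) :
    EqOn (fluxTerm i F G) (fluxTerm i F' G) U := fun z hz => by
  simp only [fluxTerm, metricDet_congr hU h hz, pd_congr hU h _ hz, h hz]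

lemma connectionForm_congr (hU : IsOpen U) (h : EqOn F F' U) (i : Fin 2) :
    EqOn (connectionForm i F) (connectionForm i F') U := fun z hz => by
  simp only [connectionForm, metricDet_congr hU h hz, pd_congr hU h _ hz,
    pd_congr hU (pd_congr hU h _) _ hz]

lemma willmoreDensity_congr (hU : IsOpen U) (h : EqOn F F' U) :
    EqOn (willmoreDensity F) (willmoreDensity F') U := fun z hz => by
  have h1 : metricMat F z = metricMat F' z := by
    ext i j
    simp only [metricMat, Matrix.of_apply, pd_congr hU h _ hz]
  have h2 : ∀ i j, secondForm F z i j = secondForm F' z i j := fun i j => by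
    simp only [secondForm, pd_congr hU h _ hz, pd_congr hU (pd_congr hU h _) _ hz, h hz]
  simp only [willmoreDensity, h1, h2]

lemma setIntegral_pd_congr (hU : IsOpen U) (hK : IsCompact K) (hKU : K ⊆ U) {X X' : ℂ → ℝ}
    (hX : ContDiffOn ℝ ∞ X U) (hX' : ContDiffOn ℝ ∞ X' U) (h : ∀ z ∈ U, z ∉ K → X z = X' z)
    (i : Fin 2) : ∫ z in K, pd i X z = ∫ z in K, pd i X' z := by
  have h0 := setIntegral_pd_eq_zero hU hK hKU (hX.sub hX')
    (fun z hz hzK => sub_eq_zero.2 (h z hz hzK)) i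
  have hint : ∀ {Z : ℂ → ℝ}, ContDiffOn ℝ ∞ Z U → IntegrableOn (pd i Z) K := fun hZ =>
    ((contDiffOn_pd hU hZ i).continuousOn.mono hKU).integrableOn_compact hK
  rw [setIntegral_congr_fun hK.measurableSet fun z hz => pd_sub
    (differentiableAt_of_contDiffOn hU hX (hKU hz))
    (differentiableAt_of_contDiffOn hU hX' (hKU hz)) i, integral_sub (hint hX) (hint hX')] at h0
  exact sub_eq_zero.1 h0

/-- The divergence part of the Willmore density. -/
noncomputable def divergencePart (F G : ℂ → Euc n) (z : ℂ) : ℝ :=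
  (pd 0 (fluxTerm 0 F G) z + pd 1 (fluxTerm 1 F G) z)
    - 2 * (pd 1 (connectionForm 0 F) z - pd 0 (connectionForm 1 F) z)

lemma SpherePair.continuousOn_divergencePart (h : SpherePair U F G)
    (hD : ∀ z ∈ U, 0 < metricDet F z) : ContinuousOn (divergencePart F G) U :=
  have hU := h.isOpen
  have hf := h.contDiffOn_fluxTerm hD
  have hc := contDiffOn_connectionForm hU h.smooth₁ hD
  (((contDiffOn_pd hU (hf 0) 0).add (contDiffOn_pd hU (hf 1) 1)).sub
    (contDiffOn_const.mul ((contDiffOn_pd hU (hc 0) 1).sub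
      (contDiffOn_pd hU (hc 1) 0)))).continuousOn

/-- The fields whose derivatives are taken depend only on the jet of the surface, so those of `F`
and `F'` agree on the open set `U \ K`, and the integrals over `K` of their derivatives agree by
`setIntegral_pd_congr`. -/
lemma SpherePair.setIntegral_divergencePart_eq (h : SpherePair U F G) (h' : SpherePair U F' G)
    (hD : ∀ z ∈ U, 0 < metricDet F z) (hD' : ∀ z ∈ U, 0 < metricDet F' z) (hK : IsCompact K)
    (hKU : K ⊆ U) (hFF : ∀ z ∈ U, z ∉ K → F z = F' z) :
    ∫ z in K, divergencePart F G z = ∫ z in K, divergencePart F' G z := by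
  have hU := h.isOpen
  have hW : IsOpen (U \ K) := hU.sdiff hK.isClosed
  have hE : EqOn F F' (U \ K) := fun z hz => hFF z hz.1 hz.2
  have hint : ∀ {Z : ℂ → ℝ} (i : Fin 2), ContDiffOn ℝ ∞ Z U → IntegrableOn (pd i Z) K :=
    fun i hZ => ((contDiffOn_pd hU hZ i).continuousOn.mono hKU).integrableOn_compact hK
  have hsplit : ∀ {F : ℂ → Euc n}, SpherePair U F G → (∀ z ∈ U, 0 < metricDet F z) →
      ∫ z in K, divergencePart F G z
        = ((∫ z in K, pd 0 (fluxTerm 0 F G) z) + ∫ z in K, pd 1 (fluxTerm 1 F G) z)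
          - 2 * ((∫ z in K, pd 1 (connectionForm 0 F) z)
            - ∫ z in K, pd 0 (connectionForm 1 F) z) := fun {F} h hD => by
    have f0 := hint 0 (h.contDiffOn_fluxTerm hD 0)
    have f1 := hint 1 (h.contDiffOn_fluxTerm hD 1)
    have c0 := hint 1 (contDiffOn_connectionForm hU h.smooth₁ hD 0)
    have c1 := hint 0 (contDiffOn_connectionForm hU h.smooth₁ hD 1)
    have f01 : IntegrableOn (fun z => pd 0 (fluxTerm 0 F G) z + pd 1 (fluxTerm 1 F G) z) K :=
      f0.add f1
    have c01 : IntegrableOn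
        (fun z => pd 1 (connectionForm 0 F) z - pd 0 (connectionForm 1 F) z) K := c0.sub c1
    unfold divergencePart
    rw [integral_sub f01 (c01.const_mul 2), integral_add f0 f1, integral_const_mul,
      integral_sub c0 c1]
  rw [hsplit h hD, hsplit h' hD']
  have hf := fun i => setIntegral_pd_congr hU hK hKU (h.contDiffOn_fluxTerm hD i)
    (h'.contDiffOn_fluxTerm hD' i) (fun z hz hzK => fluxTerm_congr hW hE i ⟨hz, hzK⟩)
  have hc := fun i => setIntegral_pd_congr hU hK hKU
    (contDiffOn_connectionForm hU h.smooth₁ hD i)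
    (contDiffOn_connectionForm hU h'.smooth₁ hD' i)
    (fun z hz hzK => connectionForm_congr hW hE i ⟨hz, hzK⟩)
  rw [hf 0, hf 1, hc 0, hc 1]

/-- The part of the Willmore density that is neither a divergence nor the energy density of the
map into the Grassmannian. -/
noncomputable def quadraticPart (F G : ℂ → Euc n) (z : ℂ) : ℝ :=
  1 / 2 * Real.sqrt (metricDet F z) * inner ℝ (sphereDefect F G z) (sphereDefect F G z)
    - (grassmannDensity F G z - energyDensity (fun w => pointPair (F w) (G w)) z)

variable {I : Set ℝ} {Φ : ℝ → ℂ → Euc n}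

lemma contDiffOn_normalAt (hI : IsOpen I) (hU : IsOpen U)
    (hΦ : ContDiffOn ℝ ∞ (fun q : ℝ × ℂ => Φ q.1 q.2) (I ×ˢ U))
    (hD : ∀ t ∈ I, ∀ z ∈ U, 0 < metricDet (Φ t) z) {v : ℝ × ℂ → Euc n}
    (hv : ContDiffOn ℝ ∞ v (I ×ˢ U)) :
    ContDiffOn ℝ ∞ (fun q : ℝ × ℂ => normalAt (Φ q.1) q.2 (v q)) (I ×ˢ U) := by
  have hp : ∀ i, ContDiffOn ℝ ∞ (fun q : ℝ × ℂ => pd i (Φ q.1) q.2) (I ×ˢ U) := fun i =>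
    contDiffOn_pd_slice (hI.prod hU) hΦ i
  have hdet : ContDiffOn ℝ ∞ (fun q : ℝ × ℂ => metricDet (Φ q.1) q.2) (I ×ˢ U) :=
    (((hp 0).inner ℝ (hp 0)).mul ((hp 1).inner ℝ (hp 1))).sub (((hp 0).inner ℝ (hp 1)).pow 2)
  refine (hv.sub ((hv.inner ℝ hΦ).smul hΦ)).sub
    ((hdet.inv fun q hq => (hD q.1 hq.1 q.2 hq.2).ne').smul (ContDiffOn.add ?_ ?_))
  · exact ((((hp 1).inner ℝ (hp 1)).mul (hv.inner ℝ (hp 0))).sub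
      (((hp 0).inner ℝ (hp 1)).mul (hv.inner ℝ (hp 1)))).smul (hp 0)
  · exact ((((hp 0).inner ℝ (hp 0)).mul (hv.inner ℝ (hp 1))).sub
      (((hp 0).inner ℝ (hp 1)).mul (hv.inner ℝ (hp 0)))).smul (hp 1)

/-- The quadratic part of the Willmore density is smooth along a variation, and its first
variation vanishes at a conformal immersion whose mean curvature spheres contain `G`, for conformal
`H`. -/
lemma quadraticPart_variation (hI : IsOpen I) (h0I : (0 : ℝ) ∈ I)
    (hp : ∀ t ∈ I, SpherePair U (Φ t) G)
    (hΦ : ContDiffOn ℝ ∞ (fun q : ℝ × ℂ => Φ q.1 q.2) (I ×ˢ U))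
    (hD : ∀ t ∈ I, ∀ z ∈ U, 0 < metricDet (Φ t) z)
    (hF : IsConformalImmersion U (Φ 0)) (hmem : ∀ z ∈ U, minkCons 1 (G z) ∈ jetSpan (Φ 0) z)
    (hH : ∀ z ∈ U, binner (pd 0 (fun w => pointPair (Φ 0 w) (G w)) z)
          (pd 0 (fun w => pointPair (Φ 0 w) (G w)) z)
        = binner (pd 1 (fun w => pointPair (Φ 0 w) (G w)) z)
          (pd 1 (fun w => pointPair (Φ 0 w) (G w)) z) ∧
      binner (pd 0 (fun w => pointPair (Φ 0 w) (G w)) z)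
        (pd 1 (fun w => pointPair (Φ 0 w) (G w)) z) = 0) :
    ContDiffOn ℝ ∞ (fun q : ℝ × ℂ => quadraticPart (Φ q.1) G q.2) (I ×ˢ U) ∧
      ContDiffOn ℝ ∞ (fun q : ℝ × ℂ => energyDensity (fun w => pointPair (Φ q.1 w) (G w)) q.2)
        (I ×ˢ U) ∧
      ∀ z ∈ U, deriv (fun t => quadraticPart (Φ t) G z) 0 = 0 := by
  have hU := (hp 0 h0I).isOpen
  have hO := hI.prod hU
  have hG : ContDiffOn ℝ ∞ (fun q : ℝ × ℂ => G q.2) (I ×ˢ U) :=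
    (hp 0 h0I).smooth₂.comp contDiff_snd.contDiffOn fun q hq => hq.2
  have j1 : ∀ i, ContDiffOn ℝ ∞ (fun q : ℝ × ℂ => pd i (Φ q.1) q.2) (I ×ˢ U) := fun i =>
    contDiffOn_pd_slice hO hΦ i
  have j2 : ∀ i j, ContDiffOn ℝ ∞ (fun q : ℝ × ℂ => pd i (pd j (Φ q.1)) q.2) (I ×ˢ U) :=
    fun i j => contDiffOn_pd_slice hO (j1 j) i
  have jg : ∀ i j, ContDiffOn ℝ ∞
      (fun q : ℝ × ℂ => inner ℝ (pd i (Φ q.1) q.2) (pd j (Φ q.1) q.2)) (I ×ˢ U) := fun i j =>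
    (j1 i).inner ℝ (j1 j)
  have jdet : ContDiffOn ℝ ∞ (fun q : ℝ × ℂ => metricDet (Φ q.1) q.2) (I ×ˢ U) :=
    ((jg 0 0).mul (jg 1 1)).sub ((jg 0 1).pow 2)
  have jr : ContDiffOn ℝ ∞ (fun q : ℝ × ℂ => Real.sqrt (metricDet (Φ q.1) q.2)) (I ×ˢ U) :=
    jdet.sqrt fun q hq => (hD q.1 hq.1 q.2 hq.2).ne'
  have js : ContDiffOn ℝ ∞ (fun q : ℝ × ℂ => 1 - inner ℝ (Φ q.1 q.2) (G q.2)) (I ×ˢ U) :=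
    contDiffOn_const.sub (hΦ.inner ℝ hG)
  have js0 : ∀ q ∈ I ×ˢ U, 1 - inner ℝ (Φ q.1 q.2) (G q.2) ≠ 0 := fun q hq =>
    ((hp q.1 hq.1).pos q.2 hq.2).ne'
  have jN : ContDiffOn ℝ ∞ (fun q : ℝ × ℂ => sphereDefect (Φ q.1) G q.2) (I ×ˢ U) := by
    have hn := fun {v : ℝ × ℂ → Euc n} (hv : ContDiffOn ℝ ∞ v (I ×ˢ U)) =>
      contDiffOn_normalAt hI hU hΦ hD hv
    exact ((jdet.inv fun q hq => (hD q.1 hq.1 q.2 hq.2).ne').smul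
      ((((jg 1 1).smul (hn (j2 0 0))).sub ((contDiffOn_const.mul (jg 0 1)).smul (hn (j2 1 0)))).add
        ((jg 0 0).smul (hn (j2 1 1))))).sub ((contDiffOn_const.div js js0).smul (hn hG))
  have jP : ContDiffOn ℝ ∞ (fun q : ℝ × ℂ => pointPair (Φ q.1 q.2) (G q.2)) (I ×ˢ U) :=
    (js.inv js0).smul (contDiffOn_wedge (contDiffOn_minkCons_one hΦ) (contDiffOn_minkCons_one hG))
  have jPi : ∀ i, ContDiffOn ℝ ∞
      (fun q : ℝ × ℂ => pd i (fun w => pointPair (Φ q.1 w) (G w)) q.2) (I ×ˢ U) := fun i =>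
    contDiffOn_pd_slice hO jP i
  have jh : ∀ i j, ContDiffOn ℝ ∞
      (fun q : ℝ × ℂ => binner (pd i (fun w => pointPair (Φ q.1 w) (G w)) q.2)
        (pd j (fun w => pointPair (Φ q.1 w) (G w)) q.2)) (I ×ˢ U) := fun i j =>
    contDiffOn_binner (jPi i) (jPi j)
  have jE : ContDiffOn ℝ ∞
      (fun q : ℝ × ℂ => energyDensity (fun w => pointPair (Φ q.1 w) (G w)) q.2) (I ×ˢ U) :=
    (jh 0 0).add (jh 1 1)
  have jgd : ContDiffOn ℝ ∞ (fun q : ℝ × ℂ => grassmannDensity (Φ q.1) G q.2) (I ×ˢ U) :=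
    ((((jg 1 1).mul (jh 0 0)).sub ((contDiffOn_const.mul (jg 0 1)).mul (jh 0 1))).add
      ((jg 0 0).mul (jh 1 1))).div jr fun q hq => (Real.sqrt_pos.2 (hD q.1 hq.1 q.2 hq.2)).ne'
  refine ⟨((contDiffOn_const.mul jr).mul (jN.inner ℝ jN)).sub (jgd.sub jE), jE, fun z hz => ?_⟩
  have ht := fun {W : Type} [NormedAddCommGroup W] [NormedSpace ℝ W] {Q : ℝ × ℂ → W}
    (hQ : ContDiffOn ℝ ∞ Q (I ×ˢ U)) =>
      hasDerivAt_time (differentiableAt_of_contDiffOn hO hQ ⟨h0I, hz⟩)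
  have hN0 : sphereDefect (Φ 0) G z = 0 :=
    (hp 0 h0I).sphereDefect_eq_zero hF hz (hmem z hz)
  -- Each term of the product rule contains the defect at time 0, which vanishes because `G` lies on
  -- the mean curvature sphere. The deficit `d2` is stationary because `F` and the map into the
  -- Grassmannian are both conformal.
  have d1 := ((ht jr).const_mul (1 / 2)).mul ((ht jN).inner ℝ (ht jN))
  have d2 := hasDerivAt_conformal_deficit (ht (jg 0 0)) (ht (jg 0 1)) (ht (jg 1 1)) (ht (jh 0 0))
    (ht (jh 0 1)) (ht (jh 1 1)) (hF z hz).1 (hF z hz).2.1 (hF z hz).2.2 (hH z hz).1 (hH z hz).2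
  have d3 : deriv (fun t => quadraticPart (Φ t) G z) 0 = _ := (d1.sub d2).deriv
  rw [d3]
  simp only [hN0, inner_zero_left, inner_zero_right]
  ring

end FirstVariation

/-! ### Criticality of the Willmore functional -/

section WillmoreFunctional

variable {n : ℕ} {U K : Set ℂ} {F G : ℂ → Euc n} {Φ : ℝ → ℂ → Euc n}

lemma SpherePair.setIntegral_willmoreDensity (h : SpherePair U F G)
    (hD : ∀ z ∈ U, 0 < metricDet F z) (hK : IsCompact K) (hKU : K ⊆ U)
    (hQ : ContinuousOn (quadraticPart F G) U)
    (hE : ContinuousOn (energyDensity (fun w => pointPair (F w) (G w))) U) :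
    ∫ z in K, willmoreDensity F z = 1 / 8 * ((∫ z in K, quadraticPart F G z)
      - (∫ z in K, energyDensity (fun w => pointPair (F w) (G w)) z)
      + ∫ z in K, divergencePart F G z) := by
  have iQ := (hQ.mono hKU).integrableOn_compact hK (μ := volume)
  have iE := (hE.mono hKU).integrableOn_compact hK (μ := volume)
  have iV := ((h.continuousOn_divergencePart hD).mono hKU).integrableOn_compact hK (μ := volume)
  have iQE : IntegrableOn (fun z => quadraticPart F G z
    - energyDensity (fun w => pointPair (F w) (G w)) z) K := iQ.sub iE
  rw [← integral_sub iQ iE, ← integral_add iQE iV, ← integral_const_mul]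
  refine setIntegral_congr_fun hK.measurableSet fun z hz => ?_
  have := h.willmoreDensity_decomposition hD (hKU hz)
  simp only [quadraticPart, divergencePart]
  linarith

/-- Moving `F` and keeping `G` is a variation through the Grassmannian as long as the points differ.
Truncated time makes it admissible for all `t` without changing it near 0. -/
lemma hasDerivAt_energy_pointPair (hp : SpherePair U F G)
    (hcrit : IsCriticalBivec U (fun w => pointPair (F w) (G w))) (hK : IsCompact K) (hKU : K ⊆ U)
    (hΦ : ContDiffOn ℝ ∞ (fun q : ℝ × ℂ => Φ q.1 q.2) (univ ×ˢ U))
    (h1 : ∀ t, ∀ z ∈ U, inner ℝ (Φ t z) (Φ t z) = 1) (h0 : Φ 0 = F)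
    (hsupp : ∀ t, ∀ z ∈ U, z ∉ K → Φ t z = F z) {ε : ℝ} (hε : 0 < ε)
    (hpos : ∀ t ∈ Metric.ball (0 : ℝ) ε, ∀ z ∈ U, 0 < 1 - inner ℝ (Φ t z) (G z)) :
    HasDerivAt (fun t => ∫ z in K, energyDensity (fun w => pointPair (Φ t w) (G w)) z) 0 0 := by
  obtain ⟨ψ, hψ, hψε, hψ0⟩ := exists_smooth_truncation hε
  have hψ00 : ψ 0 = 0 := hψ0.self_of_nhds
  have hψΦ : ContDiffOn ℝ ∞ (fun q : ℝ × ℂ => Φ (ψ q.1) q.2) (univ ×ˢ U) :=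
    hΦ.comp ((hψ.comp contDiff_fst).prodMk contDiff_snd).contDiffOn fun q hq => ⟨mem_univ _, hq.2⟩
  have hG : ContDiffOn ℝ ∞ (fun q : ℝ × ℂ => G q.2) (univ ×ˢ U) :=
    hp.smooth₂.comp contDiff_snd.contDiffOn fun q hq => hq.2
  have hpt : ∀ t, SpherePair U (Φ (ψ t)) G := fun t =>
    ⟨hp.isOpen, contDiffOn_slice hψΦ (mem_univ t), hp.smooth₂, h1 (ψ t), hp.unit₂,
      hpos (ψ t) (hψε t)⟩
  have hy' : ContDiffOn ℝ ∞ (fun q : ℝ × ℂ =>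
      (1 - inner ℝ (Φ (ψ q.1) q.2) (G q.2))⁻¹ • minkCons 1 (G q.2)) (univ ×ˢ U) :=
    ((contDiffOn_const.sub (hψΦ.inner ℝ hG)).inv fun q hq =>
      ((hpt q.1).pos q.2 hq.2).ne').smul (contDiffOn_minkCons_one hG)
  have hd := hcrit K hK hKU (fun t z => minkCons 1 (Φ (ψ t) z))
    (fun t z => (1 - inner ℝ (Φ (ψ t) z) (G z))⁻¹ • minkCons 1 (G z))
    (contDiffOn_minkCons_one hψΦ) hy'
    (fun t z hz => ⟨(hpt t).nullPair.null₁ z hz, (hpt t).nullPair.null₂ z hz,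
      (hpt t).nullPair.pairing z hz⟩)
    (fun z _ => by rw [← pointPair_eq_wedge, hψ00, h0])
    (fun t z hz hzK => by rw [← pointPair_eq_wedge, hsupp _ z hz hzK])
  refine hd.congr_of_eventuallyEq ?_
  filter_upwards [hψ0] with t ht
  simp only [← pointPair_eq_wedge, ht]

/-- If the map into the Grassmannian is conformal and harmonic, then `F` is critical for the
Willmore functional. -/
lemma SpherePair.hasDerivAt_willmore (h : SpherePair U F G) (hF : IsConformalImmersion U F)
    (hmem : ∀ z ∈ U, minkCons 1 (G z) ∈ jetSpan F z)
    (hH : ∀ z ∈ U, binner (pd 0 (fun w => pointPair (F w) (G w)) z)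
          (pd 0 (fun w => pointPair (F w) (G w)) z)
        = binner (pd 1 (fun w => pointPair (F w) (G w)) z)
          (pd 1 (fun w => pointPair (F w) (G w)) z) ∧
      binner (pd 0 (fun w => pointPair (F w) (G w)) z)
        (pd 1 (fun w => pointPair (F w) (G w)) z) = 0)
    (hcrit : IsCriticalBivec U (fun w => pointPair (F w) (G w))) (hK : IsCompact K) (hKU : K ⊆ U)
    (hΦ : ContDiffOn ℝ ∞ (fun q : ℝ × ℂ => Φ q.1 q.2) (univ ×ˢ U))
    (h1 : ∀ t, ∀ z ∈ U, inner ℝ (Φ t z) (Φ t z) = 1) (h0 : Φ 0 = F)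
    (hsupp : ∀ t, ∀ z ∈ U, z ∉ K → Φ t z = F z) :
    HasDerivAt (fun t => ∫ z in K, willmoreDensity (Φ t) z) 0 0 := by
  have hU := h.isOpen
  have hG : ContDiffOn ℝ ∞ (fun q : ℝ × ℂ => G q.2) (univ ×ˢ U) :=
    h.smooth₂.comp contDiff_snd.contDiffOn fun q hq => hq.2
  have j := fun i => contDiffOn_pd_slice (isOpen_univ.prod hU) hΦ i
  have hdet : ContDiffOn ℝ ∞ (fun q : ℝ × ℂ => metricDet (Φ q.1) q.2) (univ ×ˢ U) :=
    (((j 0).inner ℝ (j 0)).mul ((j 1).inner ℝ (j 1))).sub (((j 0).inner ℝ (j 1)).pow 2)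
  have hW : IsOpen (U \ K) := hU.sdiff hK.isClosed
  -- For small times the varied map is still an immersion, and next also still avoids `G`: nothing
  -- moves outside `K`, so compactness gives one interval for all points.
  obtain ⟨ε₁, hε₁, hD⟩ := exists_pos_of_compact hU hK hKU hdet.continuousOn (fun z hz => by
      obtain ⟨hc1, hc2, hpos⟩ := hF z hz
      rw [h0, metricDet, ← hc1, hc2]
      simpa using mul_pos hpos hpos)
    (fun t z hz hzK => metricDet_congr hW (fun w hw => by
      rw [hsupp t w hw.1 hw.2, hsupp 0 w hw.1 hw.2]) ⟨hz, hzK⟩)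
  obtain ⟨ε₂, hε₂, hs⟩ := exists_pos_of_compact hU hK hKU
    (d := fun q : ℝ × ℂ => 1 - inner ℝ (Φ q.1 q.2) (G q.2))
    (contDiffOn_const.sub (hΦ.inner ℝ hG)).continuousOn (fun z hz => by
      rw [h0]
      exact h.pos z hz)
    (fun t z hz hzK => by rw [hsupp t z hz hzK, hsupp 0 z hz hzK])
  have hε : 0 < min ε₁ ε₂ := lt_min hε₁ hε₂
  set I : Set ℝ := Metric.ball 0 (min ε₁ ε₂) with hI
  have h0I : (0 : ℝ) ∈ I := Metric.mem_ball_self hε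
  have hIo : IsOpen I := Metric.isOpen_ball
  have hDI : ∀ t ∈ I, ∀ z ∈ U, 0 < metricDet (Φ t) z := fun t ht =>
    hD t (Metric.ball_subset_ball (min_le_left _ _) ht)
  have hsI : ∀ t ∈ I, ∀ z ∈ U, 0 < 1 - inner ℝ (Φ t z) (G z) := fun t ht =>
    hs t (Metric.ball_subset_ball (min_le_right _ _) ht)
  have hp : ∀ t ∈ I, SpherePair U (Φ t) G := fun t ht =>
    ⟨hU, contDiffOn_slice hΦ (mem_univ t), h.smooth₂, h1 t, h.unit₂, hsI t ht⟩
  have hdF := hasDerivAt_energy_pointPair h hcrit hK hKU hΦ h1 h0 hsupp hε hsI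
  subst h0
  obtain ⟨hQ, hE, hQ0⟩ := quadraticPart_variation hIo h0I hp
    (hΦ.mono (prod_mono (subset_univ _) subset_rfl)) hDI hF hmem hH
  have hdQ := hasDerivAt_setIntegral hIo hU hK hKU hQ h0I
  rw [setIntegral_congr_fun hK.measurableSet (fun z hz => hQ0 z (hKU hz)), integral_zero] at hdQ
  -- The divergence part may be evaluated at time 0, since its integral does not change along the
  -- variation.
  have hd := ((hdQ.sub hdF).add_const (∫ z in K, divergencePart (Φ 0) G z)).const_mul (1 / 8)
  rw [sub_zero, mul_zero] at hd
  refine hd.congr_of_eventuallyEq ?_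
  filter_upwards [hIo.mem_nhds h0I] with t ht
  rw [(hp t ht).setIntegral_willmoreDensity (hDI t ht) hK hKU (contDiffOn_slice hQ ht).continuousOn
    (contDiffOn_slice hE ht).continuousOn,
    (hp t ht).setIntegral_divergencePart_eq h (hDI t ht) (hDI 0 h0I) hK hKU (hsupp t)]
  rfl

/-- A variation is prescribed only over `U`; redefining it as `F` elsewhere gives equality of
functions at time 0 and leaves the densities on `U` unchanged. -/
lemma SpherePair.hasDerivAt_willmore_of_eqOn (h : SpherePair U F G)
    (hF : IsConformalImmersion U F) (hmem : ∀ z ∈ U, minkCons 1 (G z) ∈ jetSpan F z)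
    (hH : ∀ z ∈ U, binner (pd 0 (fun w => pointPair (F w) (G w)) z)
          (pd 0 (fun w => pointPair (F w) (G w)) z)
        = binner (pd 1 (fun w => pointPair (F w) (G w)) z)
          (pd 1 (fun w => pointPair (F w) (G w)) z) ∧
      binner (pd 0 (fun w => pointPair (F w) (G w)) z)
        (pd 1 (fun w => pointPair (F w) (G w)) z) = 0)
    (hcrit : IsCriticalBivec U (fun w => pointPair (F w) (G w))) (hK : IsCompact K) (hKU : K ⊆ U)
    (hΦ : ContDiffOn ℝ ∞ (fun q : ℝ × ℂ => Φ q.1 q.2) (univ ×ˢ U))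
    (h1 : ∀ t, ∀ z ∈ U, inner ℝ (Φ t z) (Φ t z) = 1) (h0 : ∀ z ∈ U, Φ 0 z = F z)
    (hsupp : ∀ t, ∀ z ∈ U, z ∉ K → Φ t z = F z) :
    HasDerivAt (fun t => ∫ z in K, willmoreDensity (Φ t) z) 0 0 := by
  classical
  have he : ∀ t, EqOn (U.piecewise (Φ t) F) (Φ t) U := fun t => piecewise_eqOn U _ _
  have hd := h.hasDerivAt_willmore (Φ := fun t => U.piecewise (Φ t) F) hF hmem hH hcrit hK hKU
    (hΦ.congr fun q hq => he q.1 hq.2) (fun t z hz => by rw [he t hz, h1 t z hz])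
    (funext fun z => by
      by_cases hz : z ∈ U
      · rw [piecewise_eq_of_mem U _ _ hz, h0 z hz]
      · rw [piecewise_eq_of_notMem U _ _ hz])
    (fun t z hz hzK => by rw [he t hz, hsupp t z hz hzK])
  refine hd.congr_of_eventuallyEq (Filter.Eventually.of_forall fun t => ?_)
  exact setIntegral_congr_fun hK.measurableSet fun z hz =>
    (willmoreDensity_congr h.isOpen (he t) (hKU hz)).symm

end WillmoreFunctional

/-! ### Surfaces in the sphere and their charts -/

section Global

variable {n : ℕ} {M : Type*} [TopologicalSpace M] [ChartedSpace ℂ M] {f fh : M → Sph n}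
  {Y Yh : M → Mink n}

lemma inner_self_sphere (x : Sph n) : inner ℝ (x : Euc n) (x : Euc n) = 1 := by
  rw [real_inner_self_eq_norm_sq, norm_eq_of_mem_sphere]
  norm_num

/-- The scale factors of lifts `Y`, `Yh` with `⟨Y, Yh⟩ = -1`. -/
lemma IsLift.exists_scale (hY : IsLift Y f) (hYh : IsLift Yh fh) (p : M)
    (hp : mink (Y p) (Yh p) = -1) :
    ∃ c d : ℝ, c * d * (1 - inner ℝ (f p : Euc n) (fh p : Euc n)) = 1 ∧
      wedge (Y p) (Yh p) = (c * d) • wedge (minkCons 1 (f p : Euc n)) (minkCons 1 (fh p)) := by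
  obtain ⟨c, -, hc⟩ := hY.spans p
  obtain ⟨d, -, hd⟩ := hYh.spans p
  rw [stdLift_eq] at hc hd
  refine ⟨c, d, ?_, ?_⟩
  · rw [hc, hd, mink_smul_left, mink_smul_right, mink_minkCons] at hp
    linarith
  · rw [hc, hd, wedge_smul_left, wedge_smul_right, smul_smul]

lemma IsLift.wedge_eq_pointPair (hY : IsLift Y f) (hYh : IsLift Yh fh) (p : M)
    (hp : mink (Y p) (Yh p) = -1) : wedge (Y p) (Yh p) = pointPair (f p : Euc n) (fh p) := by
  obtain ⟨c, d, h1, h2⟩ := hY.exists_scale hYh p hp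
  rw [h2, pointPair, eq_inv_of_mul_eq_one_left h1]

/-- Cauchy-Schwarz for unit vectors gives the weak inequality, and the pairing -1 of the lifts
excludes equality; so the two surfaces never meet. -/
lemma IsLift.one_sub_inner_pos (hY : IsLift Y f) (hYh : IsLift Yh fh) (p : M)
    (hp : mink (Y p) (Yh p) = -1) : 0 < 1 - inner ℝ (f p : Euc n) (fh p : Euc n) := by
  obtain ⟨c, d, h1, -⟩ := hY.exists_scale hYh p hp
  have hle := real_inner_le_norm (f p : Euc n) (fh p : Euc n)
  rw [norm_eq_of_mem_sphere, norm_eq_of_mem_sphere, one_mul] at hle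
  exact (sub_nonneg.2 hle).lt_of_ne' (right_ne_zero_of_mul_eq_one h1)

lemma spherePair_chart [IsManifold 𝓘(ℂ, ℂ) ω M] (hf : IsSmoothImmersion f)
    (hfh : IsSmoothImmersion fh)
    (hpos : ∀ p, 0 < 1 - inner ℝ (f p : Euc n) (fh p : Euc n))
    {e : OpenPartialHomeomorph M ℂ} (he : e ∈ atlas ℂ M) :
    SpherePair e.target (eucRep e f) (eucRep e fh) :=
  ⟨e.open_target, contDiffOn_chart hf.smooth he, contDiffOn_chart hfh.smooth he,
    fun _ _ => inner_self_sphere _, fun _ _ => inner_self_sphere _, fun _ _ => hpos _⟩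

lemma IsConformal.isConformalImmersion (h : IsConformal f) (hf : IsSmoothImmersion f)
    {e : OpenPartialHomeomorph M ℂ} (he : e ∈ atlas ℂ M) :
    IsConformalImmersion e.target (eucRep e f) := fun z hz => by
  refine ⟨(h e he z hz).1, (h e he z hz).2, real_inner_self_pos.2 fun h0 => ?_⟩
  have h1 : dir 0 = 0 := hf.injective_fderiv e he z hz (h0.trans (map_zero _).symm)
  simp [dir] at h1

/-- Harmonicity of the map into the Grassmannian means that each surface lies on the mean
curvature spheres of the other one. -/
lemma isHarmonicBivec_iff [IsManifold 𝓘(ℂ, ℂ) ω M] (hf : IsSmoothImmersion f)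
    (hfh : IsSmoothImmersion fh) (hpos : ∀ p, 0 < 1 - inner ℝ (f p : Euc n) (fh p : Euc n))
    (hc : IsConformal f) (hch : IsConformal fh) :
    IsHarmonicBivec (fun p => pointPair (f p : Euc n) (fh p)) ↔
      LiesOnMeanSphere f fh ∧ LiesOnMeanSphere fh f := by
  have h := fun (e : OpenPartialHomeomorph M ℂ) (he : e ∈ atlas ℂ M) =>
    (spherePair_chart hf hfh hpos he).isCritical_iff (hc.isConformalImmersion hf he)
      (hch.isConformalImmersion hfh he)
  exact ⟨fun H => ⟨fun e he z hz => ((h e he).1 (H e he) z hz).1,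
      fun e he z hz => ((h e he).1 (H e he) z hz).2⟩,
    fun H e he => (h e he).2 fun z hz => ⟨H.1 e he z hz, H.2 e he z hz⟩⟩

/-- Co-touching of the mean curvature spheres is conformality of the map into the Grassmannian. -/
lemma isAdjointTransform_iff [IsManifold 𝓘(ℂ, ℂ) ω M] (hf : IsSmoothImmersion f)
    (hfh : IsSmoothImmersion fh) (hpos : ∀ p, 0 < 1 - inner ℝ (f p : Euc n) (fh p : Euc n))
    (hc : IsConformal f) (hch : IsConformal fh) :
    IsAdjointTransform f fh ↔ LiesOnMeanSphere f fh ∧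
      IsConformalBivec (fun p => pointPair (f p : Euc n) (fh p)) := by
  have h := fun (e : OpenPartialHomeomorph M ℂ) (he : e ∈ atlas ℂ M) (z : ℂ) (hz : z ∈ e.target)
    (hm : liftRep e fh z ∈ meanSphere e f z) =>
    (spherePair_chart hf hfh hpos he).coTouch_iff (hc.isConformalImmersion hf he) hz hm
  exact ⟨fun H => ⟨fun e he z hz => (H.2.2 e he z hz).1,
      fun e he z hz => (h e he z hz (H.2.2 e he z hz).1).1 (H.2.2 e he z hz).2⟩,
    fun H => ⟨hc, hch, fun e he z hz => ⟨H.1 e he z hz,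
      (h e he z hz (H.1 e he z hz)).2 (H.2 e he z hz)⟩⟩⟩

lemma isWillmore_of_harmonic [IsManifold 𝓘(ℂ, ℂ) ω M] (hf : IsSmoothImmersion f)
    (hfh : IsSmoothImmersion fh) (hpos : ∀ p, 0 < 1 - inner ℝ (f p : Euc n) (fh p : Euc n))
    (hc : IsConformal f) (hm : LiesOnMeanSphere f fh)
    (hH : IsConformalBivec (fun p => pointPair (f p : Euc n) (fh p)))
    (hh : IsHarmonicBivec (fun p => pointPair (f p : Euc n) (fh p))) : IsWillmore f := by
  intro e he K hK hKU Φ hΦ hS h0 hsupp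
  exact (spherePair_chart hf hfh hpos he).hasDerivAt_willmore_of_eqOn
    (hc.isConformalImmersion hf he) (hm e he) (hH e he) (hh e he) hK hKU hΦ
    (fun t z hz => inner_self_sphere ⟨Φ t z, hS t z hz⟩) h0 hsupp

lemma IsConformalBivec.neg {H : M → Bivec n} (h : IsConformalBivec H) :
    IsConformalBivec (fun p => -H p) := fun e he z hz => by
  have hn : ∀ i, pd i ((fun p => -H p) ∘ e.symm) z = -pd i (H ∘ e.symm) z := fun i =>
    congrFun (pd_neg (H ∘ e.symm) i) z
  simp only [hn, binner_neg_left, binner_neg_right, neg_neg]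
  exact h e he z hz

lemma IsHarmonicBivec.neg {H : M → Bivec n} (h : IsHarmonicBivec H) :
    IsHarmonicBivec (fun p => -H p) := fun e he => IsCriticalBivec.neg (h e he)

end Global

end MoebiusSurface

theorem theorem3 {n : ℕ} (hn : 3 ≤ n)
    {M : Type*} [TopologicalSpace M] [T2Space M] [ChartedSpace ℂ M] [IsManifold 𝓘(ℂ, ℂ) ω M]
    (f fh : M → MoebiusSurface.Sph n)
    (hf : MoebiusSurface.IsSmoothImmersion f) (hfh : MoebiusSurface.IsSmoothImmersion fh)
    (Y Yh : M → MoebiusSurface.Mink n)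
    (hY : MoebiusSurface.IsLift Y f) (hYh : MoebiusSurface.IsLift Yh fh)
    (hYYh : ∀ p, MoebiusSurface.mink (Y p) (Yh p) = -1)
    (H : M → MoebiusSurface.Bivec n)
    (hH : ∀ p, H p = MoebiusSurface.wedge (Y p) (Yh p)) :
    List.TFAE [
      MoebiusSurface.IsWillmore f ∧ MoebiusSurface.IsWillmore fh ∧
        MoebiusSurface.IsAdjointTransform f fh ∧ MoebiusSurface.IsAdjointTransform fh f,
      MoebiusSurface.IsConformal f ∧ MoebiusSurface.IsConformal fh ∧
        MoebiusSurface.IsConformalBivec H ∧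
        MoebiusSurface.LiesOnMeanSphere f fh ∧ MoebiusSurface.LiesOnMeanSphere fh f,
      MoebiusSurface.IsConformal f ∧ MoebiusSurface.IsConformal fh ∧
        MoebiusSurface.IsConformalBivec H ∧ MoebiusSurface.IsHarmonicBivec H] := by
  open MoebiusSurface in
  have hpos := fun p => hY.one_sub_inner_pos hYh p (hYYh p)
  have hpos' : ∀ p, 0 < 1 - inner ℝ (fh p : Euc n) (f p : Euc n) := fun p => by
    rw [real_inner_comm]
    exact hpos p
  obtain rfl : H = fun p => pointPair (f p : Euc n) (fh p) := funext fun p =>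
    (hH p).trans (hY.wedge_eq_pointPair hYh p (hYYh p))
  have hswap : (fun p => pointPair (fh p : Euc n) (f p)) =
      fun p => -pointPair (f p : Euc n) (fh p) := funext fun p => pointPair_swap _ _
  tfae_have 1 → 2 := fun ⟨_, _, ha, ha'⟩ =>
    ⟨ha.1, ha.2.1, ((isAdjointTransform_iff hf hfh hpos ha.1 ha.2.1).1 ha).2,
      ((isAdjointTransform_iff hf hfh hpos ha.1 ha.2.1).1 ha).1,
      ((isAdjointTransform_iff hfh hf hpos' ha'.1 ha'.2.1).1 ha').1⟩
  tfae_have 2 → 3 := fun ⟨hc, hch, hb, hm⟩ =>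
    ⟨hc, hch, hb, (isHarmonicBivec_iff hf hfh hpos hc hch).2 hm⟩
  tfae_have 3 → 1 := fun ⟨hc, hch, hb, hh⟩ => by
    obtain ⟨hm, hm'⟩ := (isHarmonicBivec_iff hf hfh hpos hc hch).1 hh
    -- Exchanging the surfaces replaces `H` by `-H`, which is again conformal and harmonic, so the
    -- statements for `fh` are those for `f` with the roles exchanged.
    have hb' := hb.neg
    have hh' := hh.neg
    rw [← hswap] at hb' hh'
    exact ⟨isWillmore_of_harmonic hf hfh hpos hc hm hb hh,
      isWillmore_of_harmonic hfh hf hpos' hch hm' hb' hh',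
      (isAdjointTransform_iff hf hfh hpos hc hch).2 ⟨hm, hb⟩,
      (isAdjointTransform_iff hfh hf hpos' hch hc).2 ⟨hm', hb'⟩⟩
  tfae_finish
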